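/- **Setting.** Let $p\in\mathbb N$ and let $\mathcal I=\bigcup_{n\ge 0}\mathbb N^n$ be the Ulam–Harris tree. On a probability space $(\Omega,\mathcal A,\mathbf P)$ let $\boldsymbol\xi_u=(\xi_u^{i,j})_{i,j=1}^p$, $u\in\mathcal I$, be i.i.d. copies of a matrix of point processes (random locally finite point measures) on $[0,\infty)$ such that, for every $u$ and $i$, also $\sum_j\xi_u^{i,j}$ is locally finite. If an individual $u$ has type $i$, then its children of type $j$ are born when $u$ has the ages given by the points of $\xi_u^{i,j}$; the children are labelled $u1,u2,\dots$ in the order of birth (the enumerations of the children, with their types and ages of the parent, being i.i.d. over $u$ too). The ancestor $\varnothing$ is born at time $S(\varnothing)=0$, $\mathcal T$ is the set of individuals that are ever born, $\tau(u)$ and $S(u)$ are the type and the time of birth of $u\in\mathcal T$, and $\mathbf E^i$ is the expectation if $\tau(\varnothing)=i$. Let $\boldsymbol\varphi_u=(\varphi_u^1,\dots,\varphi_u^p)^{\mathsf T}:\Omega\times\mathbb R\to\mathbb R^p$, $u\in\mathcal I$, be identically distributed random characteristics such that $\boldsymbol\varphi_u$ is measurable with respect to $\mathcal G_u\otimes\mathcal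 B(\mathbb R)$ for some $\sigma$-algebras $\mathcal G_u\subseteq\mathcal A$, where for every $n$ the $\mathcal G_u$, $u\in\mathbb N^n$, are independent and jointly independent of $(\boldsymbol\xi_v)_{|v|<n}$. The process counted with the characteristic is $$\mathcal Z_t^{\boldsymbol\varphi}=\sum_{u\in\mathcal T}\varphi_u^{\tau(u)}(t-S(u)).$$ Let $\mu^{i,j}=\mathbf E[\xi^{i,j}]$ be the intensity measures, $\mathcal L\boldsymbol\mu(z)=\big(\int e^{-zx}\,\mu^{i,j}(\mathrm dx)\big)_{i,j}$, $\mathcal D=\{z\in\mathbb C:\int e^{-\mathrm{Re}(z)x}\mu^{i,j}(\mathrm dx)<\infty\ \forall i,j\}$, $\Lambda=\{\lambda\in\mathcal D:\det(\mathbf I_p-\mathcal L\boldsymbol\mu(\lambda))=0\}$ and $\Lambda_\theta=\{\lambda\in\Lambda:\mathrm{Re}(\lambda)>\theta\}$ for $\theta\in\mathbb R$. For $\lambda\in\Lambda$ let $\mathtt k(\lambda)$ be the smallest natural number such that all entries of $(z-\lambda)^{\mathtt k(\lambda)}(\mathbf I_p-\mathcal L\boldsymbol\mu(z))^{-1}$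 are holomorphic near $\lambda$. For $g:\mathbb R\to\mathbb R$ let $\mathrm Vg(x)$ be the total variation of $g$ on $(-\infty,x]$. **Theorem.** Assume that, for some real $\vartheta$ in the interior of $\mathcal D$, $$\sup_{\eta\in\mathbb R}\big\|(\mathbf I_p-\mathcal L\boldsymbol\mu(\vartheta+\mathrm i\eta))^{-1}\big\|<\infty$$ (in particular, the inverses exist), that the matrix $(\mu^{i,j}(\{0\}))_{i,j}$ has spectral radius less than $1$, and that $\Lambda_\vartheta$ is finite. Assume that the expectations $\mathbf E^i[\mathcal Z_t^{\boldsymbol\varphi}]$, $t\ge0$, $i=1,\dots,p$, exist in $[-\infty,\infty]$, in the sense that $\mathbf E^i\big[\sum_{u\in\mathcal T}(\varphi_u^{\tau(u)}(t-S(u)))^+\big]<\infty$ or $\mathbf E^i\big[\sum_{u\in\mathcal T}(\varphi_u^{\tau(u)}(t-S(u)))^-\big]<\infty$ (this holds, for instance, whenever $\boldsymbol\varphi\ge0$). Assume that $\varphi^i(t)$ is integrable for all $i$ and $t$, that $f(t)=(\mathbf E[\varphi^1(t)],\dots,\mathbf E[\varphi^p(t)])^{\mathsf T}$ vanishes for $t<0$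 and is right-continuous with existing left limits, and that $$\int_0^\infty e^{-\theta x}\,\mathrm V f_i(x)\,\mathrm dx<\infty,\qquad i=1,\dots,p,$$ for some $\theta>\vartheta$ with $\Lambda_\vartheta=\Lambda_\theta$. Then, for all $t\ge0$ and all ancestor types $i$, the sum $\mathcal Z_t^{\boldsymbol\varphi}$ converges absolutely almost surely and is integrable, and there exist matrices $B_{\lambda,k}\in\mathbb C^{p\times p}$ and vectors $b_{\lambda,k}\in\mathbb C^p$, $\lambda\in\Lambda_\vartheta$, $k=0,\dots,\mathtt k(\lambda)-1$, with $B_{\bar\lambda,k}=\overline{B_{\lambda,k}}$ and $b_{\bar\lambda,k}=\overline{b_{\lambda,k}}$ (hence real for real $\lambda$), such that $F(t)=(\mathbf E^1[\mathcal Z_t^{\boldsymbol\varphi}],\dots,\mathbf E^p[\mathcal Z_t^{\boldsymbol\varphi}])^{\mathsf T}$ satisfies, as $t\to\infty$ and component by component, $$F(t)=\sum_{\lambda\in\Lambda_\theta}e^{\lambda t}\sum_{k=0}^{\mathtt k(\lambda)-1}B_{\lambda,k}\int_0^t f(x)(t-x)^k e^{-\lambda x}\,\mathrm dx+O(e^{\theta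 t})$$ and, for every $\varepsilon>0$, $$F(t)=\sum_{\lambda\in\Lambda_\theta}e^{\lambda t}\sum_{k=0}^{\mathtt k(\lambda)-1}t^k b_{\lambda,k}+O(e^{(\theta+\varepsilon)t}).$$ -/

import Mathlib

open MeasureTheory ProbabilityTheory Filter Topology Asymptotics
open scoped ENNReal NNReal Matrix ComplexConjugate

noncomputable section

namespace CMJ

/-! ### Matrices of measures and the characteristic equation -/

section Analytic

variable {p : ℕ}

/-- The domain `D(Lμ)`: those `z` with `∫ e^{-Re(z) x} μ^{i,j}(dx) < ∞` for all `i, j`. -/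
def laplaceDomain (μ : Fin p → Fin p → Measure ℝ) : Set ℂ :=
  {z | ∀ i j, ∫⁻ x, ENNReal.ofReal (Real.exp (-z.re * x)) ∂(μ i j) < ∞}

/-- The matrix-valued Laplace transform `Lμ(z) = (∫ e^{-z x} μ^{i,j}(dx))_{i,j}`. -/
def laplace (μ : Fin p → Fin p → Measure ℝ) (z : ℂ) : Matrix (Fin p) (Fin p) ℂ :=
  Matrix.of fun i j => ∫ x, Complex.exp (-z * (x : ℂ)) ∂(μ i j)

/-- The matrix `μ(0) = (μ^{i,j}({0}))_{i,j}`, as a complex matrix. -/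
def massAtZero (μ : Fin p → Fin p → Measure ℝ) : Matrix (Fin p) (Fin p) ℂ :=
  Matrix.of fun i j => (((μ i j {0}).toReal : ℝ) : ℂ)

/-- The set `Λ` of roots of the characteristic equation `det (I - Lμ(z)) = 0`. -/
def roots (μ : Fin p → Fin p → Measure ℝ) : Set ℂ :=
  {z | z ∈ laplaceDomain μ ∧ (1 - laplace μ z).det = 0}

/-- `Λ_θ = {λ ∈ Λ : Re λ > θ}`. -/
def rootsAbove (μ : Fin p → Fin p → Measure ℝ) (θ : ℝ) : Set ℂ :=
  {z | z ∈ roots μ ∧ θ < z.re}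

/-- The order `k(λ)`: the smallest natural number `n` such that all entries of
`(z - λ)^n (I - Lμ(z))⁻¹` are (that is, extend to) holomorphic functions near `λ`. -/
def poleOrder (μ : Fin p → Fin p → Measure ℝ) (l : ℂ) : ℕ :=
  sInf {n : ℕ | ∀ i j, ∃ g : ℂ → ℂ, AnalyticAt ℂ g l ∧
    ∀ᶠ z in 𝓝[≠] l, g z = (z - l) ^ n * ((1 - laplace μ z)⁻¹ : Matrix (Fin p) (Fin p) ℂ) i j}

/-- `sup_η ‖(I - Lμ(ϑ + iη))⁻¹‖ < ∞`; this includes that the inverse exists for every real `η`.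
All matrix norms being equivalent, it is expressed through the entries. -/
def BoundedInverseOnLine (μ : Fin p → Fin p → Measure ℝ) (ϑ : ℝ) : Prop :=
  ∃ C : ℝ, ∀ η : ℝ,
    (1 - laplace μ ((ϑ : ℂ) + (η : ℂ) * Complex.I)).det ≠ 0 ∧
    ∀ i j, ‖((1 - laplace μ ((ϑ : ℂ) + (η : ℂ) * Complex.I))⁻¹ :
      Matrix (Fin p) (Fin p) ℂ) i j‖ ≤ C

/-- Right-continuous with existing left limits. -/
def IsCadlag (g : ℝ → ℝ) : Prop :=
  ∀ t, ContinuousWithinAt g (Set.Ici t) t ∧ ∃ l, Tendsto g (𝓝[<] t) (𝓝 l)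

end Analytic

/-! ### The branching process -/

/-- The data of a multi-type general (Crump-Mode-Jagers) branching process with type space `Fin p`,
counted with a random characteristic. Individuals are labelled by the Ulam-Harris tree `List ℕ`: `[]`
is the ancestor and `k :: u` is child number `k` of `u` (a label is thus read from right to left).

`repro u ω i k = (X, j)` means: if `u` has type `i`, then its child number `k` is born when `u` has age
`X` and has type `j`; `X = ∞` means that there is no such child. So `repro u ω i` is the ordered
enumeration of the points of the point processes `ξ_u^{i,1}, …, ξ_u^{i,p}`.

`char u ω t i` is the score `φ_u^i(t)`. The σ-algebra `sig u` carries `φ_u` as a random function: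
`φ_u` is measurable for the product of `sig u` and the Borel σ-algebra of the age axis, and the
independence of the characteristics is that of these σ-algebras. -/
structure Model (p : ℕ) {Ω : Type*} [mΩ : MeasurableSpace Ω] (P : Measure Ω) where
  repro : List ℕ → Ω → Fin p → ℕ → ℝ≥0∞ × Fin p
  measurable_repro : ∀ u, Measurable (repro u)
  monotone_repro : ∀ u ω i, Monotone fun k => (repro u ω i k).1
  finite_repro : ∀ u ω i (t : ℝ≥0), {k | (repro u ω i k).1 ≤ (t : ℝ≥0∞)}.Finite
  indep_repro : iIndepFun repro P
  ident_repro : ∀ u, IdentDistrib (repro u) (repro []) P P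
  char : List ℕ → Ω → ℝ → Fin p → ℝ
  sig : List ℕ → MeasurableSpace Ω
  sig_le : ∀ u, sig u ≤ mΩ
  measurable_char : ∀ u i,
    Measurable[(sig u).prod (inferInstance : MeasurableSpace ℝ)] fun q : Ω × ℝ => char u q.1 q.2 i
  ident_char : ∀ u, IdentDistrib (char u) (char []) P P
  indep_char : ∀ n : ℕ, iIndep (fun u : {u : List ℕ // u.length = n} => sig u) P
  indep_char_past : ∀ n : ℕ,
    Indep (⨆ u : {u : List ℕ // u.length = n}, sig u)
      (⨆ v : {v : List ℕ // v.length < n}, MeasurableSpace.comap (repro v) inferInstance) P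

namespace Model

variable {p : ℕ} {Ω : Type*} [MeasurableSpace Ω] {P : Measure Ω} (M : Model p P)

/-- The point process `ξ_u^{i,j}`, as a random measure: the births of the children of type `j`. -/
def birthMeasure (u : List ℕ) (i j : Fin p) (ω : Ω) : Measure ℝ :=
  Measure.sum fun k =>
    if (M.repro u ω i k).1 ≠ ∞ ∧ (M.repro u ω i k).2 = j then
      Measure.dirac (M.repro u ω i k).1.toReal
    else 0

/-- The intensity measure `μ^{i,j} = E[ξ^{i,j}]`, see `intensity_apply`. -/
def intensity (i j : Fin p) : Measure ℝ := P.bind (M.birthMeasure [] i j)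

theorem measurable_birthMeasure (u : List ℕ) (i j : Fin p) :
    Measurable (M.birthMeasure u i j) := by
  have hX : ∀ k, Measurable fun ω => M.repro u ω i k := fun k =>
    (measurable_pi_apply k).comp ((measurable_pi_apply i).comp (M.measurable_repro u))
  refine Measure.measurable_of_measurable_coe _ fun s hs => ?_
  simp only [birthMeasure, Measure.sum_apply _ hs]
  refine Measurable.tsum fun k => ?_
  have hset : MeasurableSet {ω | (M.repro u ω i k).1 ≠ ∞ ∧ (M.repro u ω i k).2 = j} :=
    ((measurableSet_singleton (∞ : ℝ≥0∞)).compl.preimage (hX k).fst).inter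
      ((measurableSet_singleton j).preimage (hX k).snd)
  have h1 : Measurable fun ω =>
      (if (M.repro u ω i k).1 ≠ ∞ ∧ (M.repro u ω i k).2 = j then
        Measure.dirac (M.repro u ω i k).1.toReal else (0 : Measure ℝ)) :=
    Measurable.ite hset (Measure.measurable_dirac.comp (hX k).fst.ennreal_toReal)
      measurable_const
  exact (Measure.measurable_coe hs).comp h1

theorem intensity_apply (i j : Fin p) {s : Set ℝ} (hs : MeasurableSet s) :
    M.intensity i j s = ∫⁻ ω, M.birthMeasure [] i j ω s ∂P :=
  Measure.bind_apply hs (M.measurable_birthMeasure [] i j).aemeasurable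

/-- The type `τ(u)` of the individual `u`, if the ancestor has type `i`. -/
def type (i : Fin p) : List ℕ → Ω → Fin p
  | [], _ => i
  | k :: u, ω => (M.repro u ω (type i u ω) k).2

/-- The time of birth `S(u)` of the individual `u`, if the ancestor has type `i`;
it is `∞` if `u` is never born. -/
def birth (i : Fin p) : List ℕ → Ω → ℝ≥0∞
  | [], _ => 0
  | k :: u, ω => birth i u ω + (M.repro u ω (M.type i u ω) k).1

open Classical in
/-- The score `φ_u(t - S(u))` at time `t` of the individual `u`, and `0` if `u` is never born. -/
def score (i : Fin p) (t : ℝ) (u : List ℕ) (ω : Ω) : ℝ :=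
  if M.birth i u ω = ∞ then 0
  else M.char u ω (t - (M.birth i u ω).toReal) (M.type i u ω)

/-- The process counted with the characteristic, `Z_t^φ = ∑_{u ∈ T} φ_u(t - S(u))`,
if the ancestor has type `i`. -/
def count (i : Fin p) (t : ℝ) (ω : Ω) : ℝ := ∑' u, M.score i t u ω

/-- `f_i(t) = E[φ^i(t)]`. -/
def charMean (i : Fin p) (t : ℝ) : ℝ := ∫ ω, M.char [] ω t i ∂P

/-- `F_i(t) = E^i[Z_t^φ]`. -/
def mean (i : Fin p) (t : ℝ) : ℝ := ∫ ω, M.count i t ω ∂P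

/-- The expectation `E^i[Z_t^φ]` exists, possibly as an infinite value: the sum of the positive parts
of the scores at time `t`, or the sum of the negative parts, has a finite expectation. -/
def MeanExists (i : Fin p) (t : ℝ) : Prop :=
  ∫⁻ ω, ∑' u, ENNReal.ofReal (M.score i t u ω) ∂P < ∞ ∨
  ∫⁻ ω, ∑' u, ENNReal.ofReal (-M.score i t u ω) ∂P < ∞

end Model

end CMJ

end

/-! ### Generations as convolution powers of the intensity. -/

namespace CMJ

/-! The problem reduces to matrix renewal theory. The type and birth time of an individual depend
only on earlier generations, and its own reproduction is independent of them. So generation n has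
the n-fold convolution power of μ as its intensity (`genSum_eq`), and summing over n gives F_i(t) =
Σ_j ∫ f_j(t-x) U^{i,j}(dx) with U = Σ_n μ^{*n} (`mean_eq_renewal`). As ∫ |f_j(t-x)| U^{i,j}(dx) is
finite, a finite sum of the positive parts of the scores forces a finite sum of the negative parts
and conversely; this gives absolute convergence.

As s → ∞, Lμ(s) tends to μ({0}), whose spectral radius is below one, so the Neumann series converges
for large s, and there LU = (I - Lμ)⁻¹ (`laplace_renewal`). This resolvent is meromorphic on Re z >
ϑ with finitely many poles. High up in a strip it is bounded: det(I - Lμ) is bounded, has no zeros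
on discs there and is bounded away from zero at their centres, so Borel-Carathéodory for its
logarithm bounds it from below on smaller discs. Hence the resolvent is a bounded holomorphic R plus
principal parts (`exists_resolvent_decomposition`), and the latter are the transform of an
exponential polynomial G (`expPoly`).

The inversion integral of R itself need not converge absolutely, so U is integrated once more:
(t-x)⁺ corresponds to z⁻², and ∫ (t-x)⁺ (U(dx) - G(x)dx) is an absolutely convergent integral of
e^{zt} z⁻² R(z), which can be moved to Re z = σ with σ < θ. Difference quotients of step h enclose
the distribution function of U and lose only a factor h^{-e}; an h exponentially small in t then
gives U[0,t] = ∫_0^t G + O(e^{θt}) (`exists_distribution_estimate`). Superlevel sets of monotone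
functions are half-lines, so the layer-cake formula carries the estimate to convolutions with
monotone functions, hence to f = Vf - (Vf - f) (`exists_conv_estimate`). Expanding the convolution
of f and G gives the B_{λ,k}; completing the integrals to (0, ∞) turns these into the moments
b_{λ,k}.

The double pole of z⁻² at 0 requires σ > 0, hence θ > 0. For θ ≤ 0 the integral of the nondecreasing
function Vf can only be finite if f = 0, and then F = 0. -/

/-- For independent `X` and `Y`, the expectation of `F (X, Y)` is an iterated integral. -/
theorem lintegral_comp_of_indepFun {Ω α β : Type*} {_ : MeasurableSpace Ω} {_ : MeasurableSpace α}
    {_ : MeasurableSpace β} {P : Measure Ω} [IsProbabilityMeasure P] {X : Ω → α} {Y : Ω → β}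
    (hX : Measurable X) (hY : Measurable Y) (h : IndepFun X Y P) {F : α → β → ℝ≥0∞}
    (hF : Measurable (Function.uncurry F)) :
    ∫⁻ ω, F (X ω) (Y ω) ∂P = ∫⁻ ω, ∫⁻ ω', F (X ω') (Y ω) ∂P ∂P := by
  have : IsProbabilityMeasure (P.map X) := Measure.isProbabilityMeasure_map hX.aemeasurable
  have : IsProbabilityMeasure (P.map Y) := Measure.isProbabilityMeasure_map hY.aemeasurable
  calc ∫⁻ ω, F (X ω) (Y ω) ∂P
      = ∫⁻ q, Function.uncurry F q ∂(P.map fun ω => (X ω, Y ω)) := by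
        rw [lintegral_map hF (hX.prodMk hY)]; rfl
    _ = ∫⁻ q, Function.uncurry F q ∂((P.map X).prod (P.map Y)) := by
        rw [h.map_prod_eq_prod_map_map hX.aemeasurable hY.aemeasurable]
    _ = ∫⁻ y, ∫⁻ x, F x y ∂(P.map X) ∂(P.map Y) := by
        rw [lintegral_prod_symm _ hF.aemeasurable]; rfl
    _ = ∫⁻ ω, ∫⁻ x, F x (Y ω) ∂(P.map X) ∂P := by
        rw [lintegral_map _ hY]
        exact hF.lintegral_prod_left'
    _ = _ := by
        refine lintegral_congr fun ω => ?_
        rw [lintegral_map _ hX]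
        exact hF.comp (measurable_id.prodMk measurable_const)

/-- Powers of a matrix of measures with respect to convolution. -/
noncomputable def convPow {p : ℕ} (μ : Fin p → Fin p → Measure ℝ) :
    ℕ → Fin p → Fin p → Measure ℝ
  | 0 => fun i j => if i = j then Measure.dirac 0 else 0
  | n + 1 => fun i j => ∑ k, (convPow μ n i k).conv (μ k j)

/-- The renewal measure: the sum of all convolution powers. -/
noncomputable def renewal {p : ℕ} (μ : Fin p → Fin p → Measure ℝ) (i j : Fin p) : Measure ℝ :=
  Measure.sum fun n => convPow μ n i j

theorem sum_lintegral_convPow_succ {p : ℕ} (μ : Fin p → Fin p → Measure ℝ)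
    [∀ i j, SFinite (μ i j)] (n : ℕ) (i : Fin p) {g : Fin p → ℝ → ℝ≥0∞}
    (hg : ∀ j, Measurable (g j)) :
    ∑ j, ∫⁻ x, g j x ∂(convPow μ (n + 1) i j) =
      ∑ k, ∫⁻ x, (∑ j, ∫⁻ y, g j (x + y) ∂(μ k j)) ∂(convPow μ n i k) := by
  have hm : ∀ k j, Measurable fun x => ∫⁻ y, g j (x + y) ∂(μ k j) := fun k j =>
    Measurable.lintegral_prod_right' (f := fun q : ℝ × ℝ => g j (q.1 + q.2))
      ((hg j).comp (measurable_fst.add measurable_snd))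
  simp only [convPow]
  simp_rw [lintegral_finsetSum_measure]
  rw [Finset.sum_comm]
  refine Finset.sum_congr rfl fun k _ => ?_
  rw [lintegral_finsetSum _ fun j _ => hm k j]
  refine Finset.sum_congr rfl fun j _ => ?_
  rw [Measure.lintegral_conv (hg j)]

namespace Model

variable {p : ℕ} {Ω : Type*} [mΩ : MeasurableSpace Ω] {P : Measure Ω} (M : Model p P)

/-- The σ-algebra generated by the reproduction of the generations before `n`. -/
abbrev past (n : ℕ) : MeasurableSpace Ω :=
  ⨆ v : {v : List ℕ // v.length < n}, MeasurableSpace.comap (M.repro v) inferInstance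

theorem past_le (n : ℕ) : M.past n ≤ mΩ :=
  iSup_le fun v => (M.measurable_repro v).comap_le

theorem past_mono {m n : ℕ} (h : m ≤ n) : M.past m ≤ M.past n :=
  iSup_le fun v => le_iSup (fun v : {v : List ℕ // v.length < n} =>
    MeasurableSpace.comap (M.repro v) inferInstance) ⟨v.1, v.2.trans_le h⟩

theorem measurable_repro_past (u : List ℕ) : Measurable[M.past (u.length + 1)] (M.repro u) :=
  Measurable.mono (comap_measurable _)
    (le_iSup (fun v : {v : List ℕ // v.length < u.length + 1} =>
      MeasurableSpace.comap (M.repro v) inferInstance) ⟨u, Nat.lt_succ_self _⟩) le_rfl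

theorem measurable_apply_type :
    Measurable fun q : (Fin p → ℕ → ℝ≥0∞ × Fin p) × Fin p => q.1 q.2 :=
  measurable_from_prod_countable_left fun a => measurable_pi_apply a

theorem measurable_type_birth (i : Fin p) (u : List ℕ) :
    Measurable[M.past u.length] (M.type i u) ∧ Measurable[M.past u.length] (M.birth i u) := by
  induction u with
  | nil => exact ⟨@measurable_const _ _ _ (M.past 0) _, @measurable_const _ _ _ (M.past 0) _⟩
  | cons k u ih =>
    have hle : M.past u.length ≤ M.past (u.length + 1) := M.past_mono (Nat.le_succ _)
    have h1 := ih.1.mono hle le_rfl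
    have h2 := ih.2.mono hle le_rfl
    have h3 := (measurable_pi_apply k).comp
      (measurable_apply_type.comp ((M.measurable_repro_past u).prodMk h1))
    exact ⟨measurable_snd.comp h3, h2.add (measurable_fst.comp h3)⟩

theorem measurable_type (i : Fin p) (u : List ℕ) : Measurable (M.type i u) :=
  (M.measurable_type_birth i u).1.mono (M.past_le _) le_rfl

theorem measurable_birth (i : Fin p) (u : List ℕ) : Measurable (M.birth i u) :=
  (M.measurable_type_birth i u).2.mono (M.past_le _) le_rfl

/-- The type and birth time of `u` are functions of the reproduction of shorter words, a family of
labels that does not contain `u`. -/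
theorem indepFun_repro (i : Fin p) (u : List ℕ) :
    IndepFun (M.repro u) (fun ω => (M.type i u ω, M.birth i u ω)) P := by
  have h := indep_iSup_of_disjoint (fun v => (M.measurable_repro v).comap_le) M.indep_repro
    (S := {u}) (T := {v | v.length < u.length}) (by simp)
  rw [IndepFun_iff_Indep]
  refine indep_of_indep_of_le_right (indep_of_indep_of_le_left h ?_) ?_
  · simp
  · refine ((M.measurable_type_birth i u).1.prodMk (M.measurable_type_birth i u).2).comap_le.trans ?_
    exact iSup_le fun v => le_iSup₂_of_le v.1 v.2 le_rfl

/-- The identity, as a map into `Ω` with the σ-algebra `sig u`, stands for the whole random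
function: `char u` is jointly measurable over this space and can later be evaluated at a random age
and type. -/
theorem indep_sig (i : Fin p) (u : List ℕ) :
    @IndepFun Ω Ω (Fin p × ℝ≥0∞) mΩ (M.sig u) _ id
      (fun ω => (M.type i u ω, M.birth i u ω)) P := by
  refine (@IndepFun_iff_Indep Ω Ω _ mΩ (M.sig u) _ _ _ P).2 ?_
  refine indep_of_indep_of_le_right
    (indep_of_indep_of_le_left (M.indep_char_past u.length) ?_) ?_
  · rw [MeasurableSpace.comap_id]
    exact le_iSup (fun v : {v : List ℕ // v.length = u.length} => M.sig v) ⟨u, rfl⟩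
  · exact ((M.measurable_type_birth i u).1.prodMk (M.measurable_type_birth i u).2).comap_le

/-- The expected sum of `g` over the types and birth times of generation `n`. -/
noncomputable def genSum (i : Fin p) (n : ℕ) (g : Fin p → ℝ → ℝ≥0∞) : ℝ≥0∞ :=
  ∑' u : {u : List ℕ // u.length = n},
    ∫⁻ ω, (if M.birth i u ω = ∞ then 0 else g (M.type i u ω) (M.birth i u ω).toReal) ∂P

/-- Passes from the ordered enumeration of the children to the point processes; the type of child
`k` selects a single summand `j`. -/
theorem lintegral_birthMeasure (u : List ℕ) (i : Fin p) (ω : Ω) {g : Fin p → ℝ → ℝ≥0∞}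
    (hg : ∀ j, Measurable (g j)) :
    ∑' k, (if (M.repro u ω i k).1 = ∞ then 0
      else g (M.repro u ω i k).2 (M.repro u ω i k).1.toReal) =
      ∑ j, ∫⁻ x, g j x ∂(M.birthMeasure u i j ω) := by
  simp only [birthMeasure, lintegral_sum_measure]
  rw [← Summable.tsum_finsetSum fun _ _ => ENNReal.summable]
  refine tsum_congr fun k => ?_
  by_cases h : (M.repro u ω i k).1 = ∞
  · simp [h]
  · rw [if_neg h, Finset.sum_eq_single (M.repro u ω i k).2]
    · rw [if_pos ⟨h, rfl⟩, lintegral_dirac' _ (hg _)]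
    · intro j _ hj
      rw [if_neg (fun hh => hj hh.2.symm)]
      simp
    · simp

theorem lintegral_intensity (i j : Fin p) {g : ℝ → ℝ≥0∞} (hg : Measurable g) :
    ∫⁻ x, g x ∂(M.intensity i j) = ∫⁻ ω, ∫⁻ x, g x ∂(M.birthMeasure [] i j ω) ∂P :=
  Measure.lintegral_bind (M.measurable_birthMeasure [] i j).aemeasurable hg.aemeasurable

theorem lintegral_children [IsProbabilityMeasure P] (u : List ℕ) (i : Fin p)
    {g : Fin p → ℝ → ℝ≥0∞} (hg : ∀ j, Measurable (g j)) :
    ∫⁻ ω, ∑' k, (if (M.repro u ω i k).1 = ∞ then 0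
      else g (M.repro u ω i k).2 (M.repro u ω i k).1.toReal) ∂P =
      ∑ j, ∫⁻ x, g j x ∂(M.intensity i j) := by
  have hG : Measurable fun q : ℝ≥0∞ × Fin p => if q.1 = ∞ then 0 else g q.2 q.1.toReal := by
    refine measurable_from_prod_countable_left fun a => ?_
    exact Measurable.ite (measurableSet_singleton _) measurable_const
      ((hg a).comp ENNReal.measurable_toReal)
  have hF : Measurable fun ρ : Fin p → ℕ → ℝ≥0∞ × Fin p =>
      ∑' k, if (ρ i k).1 = ∞ then 0 else g (ρ i k).2 (ρ i k).1.toReal :=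
    Measurable.tsum fun k => hG.comp ((measurable_pi_apply k).comp (measurable_pi_apply i))
  have h1 := ((M.ident_repro u).comp hF).lintegral_eq
  simp only [Function.comp_def] at h1
  rw [h1]
  simp_rw [M.lintegral_birthMeasure [] i _ hg]
  rw [lintegral_finsetSum]
  · simp_rw [M.lintegral_intensity _ _ (hg _)]
  · exact fun j _ => (Measure.measurable_lintegral (hg j)).comp (M.measurable_birthMeasure [] i j)

/-- The nonempty words of length `n + 1` are a letter and a word of length `n`. -/
def wordsSucc (n : ℕ) :
    {v : List ℕ // v.length = n} × ℕ ≃ {u : List ℕ // u.length = n + 1} where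
  toFun q := ⟨q.2 :: q.1.1, by simp [q.1.2]⟩
  invFun u := (⟨u.1.tail, by simp [u.2]⟩, u.1.headI)
  left_inv q := rfl
  right_inv u := by
    obtain ⟨u, hu⟩ := u
    cases u with
    | nil => simp at hu
    | cons k u => rfl

/-- Given the type and birth time of the parent, which are independent of its reproduction, the
children contribute an integral against the intensity. Labels grow at the head, so a word of length
`n + 1` is a child number followed by the parent. -/
theorem genSum_succ [IsProbabilityMeasure P] (i : Fin p) (n : ℕ)
    {g : Fin p → ℝ → ℝ≥0∞} (hg : ∀ j, Measurable (g j)) :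
    M.genSum i (n + 1) g =
      M.genSum i n fun k x => ∑ j, ∫⁻ y, g j (x + y) ∂(M.intensity k j) := by
  rw [genSum, ← (wordsSucc n).tsum_eq, ENNReal.tsum_prod' (f := fun c => _), genSum]
  refine tsum_congr fun v => ?_
  have hG : Measurable fun q : (ℝ≥0∞ × Fin p) × ℝ≥0∞ =>
      if q.2 = ∞ then 0 else if q.1.1 = ∞ then 0 else g q.1.2 (q.2.toReal + q.1.1.toReal) := by
    have hg' : Measurable fun q : ℝ × Fin p => g q.2 q.1 :=
      measurable_from_prod_countable_left fun a => hg a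
    have := hg'.comp (f := fun q : (ℝ≥0∞ × Fin p) × ℝ≥0∞ =>
      (q.2.toReal + q.1.1.toReal, q.1.2)) (by fun_prop)
    exact Measurable.ite (measurable_snd (measurableSet_singleton _)) measurable_const
      (Measurable.ite ((measurable_fst.comp measurable_fst) (measurableSet_singleton _))
        measurable_const this)
  let H : (Fin p → ℕ → ℝ≥0∞ × Fin p) → Fin p × ℝ≥0∞ → ℝ≥0∞ := fun ρ q =>
    ∑' k, if q.2 = ∞ then 0 else if (ρ q.1 k).1 = ∞ then 0
      else g (ρ q.1 k).2 (q.2.toReal + (ρ q.1 k).1.toReal)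
  have hH : Measurable (Function.uncurry H) := by
    refine Measurable.tsum fun k => ?_
    refine hG.comp (f := fun q : (Fin p → ℕ → ℝ≥0∞ × Fin p) × (Fin p × ℝ≥0∞) =>
      (q.1 q.2.1 k, q.2.2)) ?_
    refine Measurable.prodMk ?_ (by fun_prop)
    exact (measurable_pi_apply k).comp (measurable_apply_type.comp
      (measurable_fst.prodMk (measurable_fst.comp measurable_snd)))
  have hterm : ∀ k, Measurable fun ω => (if M.birth i v ω = ∞ then 0 else
      if (M.repro v ω (M.type i v ω) k).1 = ∞ then 0 else
        g (M.repro v ω (M.type i v ω) k).2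
          ((M.birth i v ω).toReal + (M.repro v ω (M.type i v ω) k).1.toReal)) := fun k =>
    hG.comp (f := fun ω => (M.repro v ω (M.type i v ω) k, M.birth i v ω))
      (((measurable_pi_apply k).comp (measurable_apply_type.comp
        ((M.measurable_repro v).prodMk (M.measurable_type i v)))).prodMk (M.measurable_birth i v))
  calc ∑' k, ∫⁻ ω, (if M.birth i (k :: v.1) ω = ∞ then 0
          else g (M.type i (k :: v.1) ω) (M.birth i (k :: v.1) ω).toReal) ∂P
      = ∑' k, ∫⁻ ω, (if M.birth i v ω = ∞ then 0 else
      if (M.repro v ω (M.type i v ω) k).1 = ∞ then 0 else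
        g (M.repro v ω (M.type i v ω) k).2
          ((M.birth i v ω).toReal + (M.repro v ω (M.type i v ω) k).1.toReal)) ∂P := by
        refine tsum_congr fun k => lintegral_congr fun ω => ?_
        simp only [birth, type, ENNReal.add_eq_top]
        by_cases h1 : M.birth i v ω = ∞
        · simp [h1]
        · by_cases h2 : (M.repro v ω (M.type i v ω) k).1 = ∞
          · simp [h2]
          · simp only [h1, h2, or_self, if_false]
            rw [ENNReal.toReal_add h1 h2]
    _ = ∫⁻ ω, H (M.repro v ω) (M.type i v ω, M.birth i v ω) ∂P := by
        rw [← lintegral_tsum fun k => (hterm k).aemeasurable]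
    _ = ∫⁻ ω, ∫⁻ ω', H (M.repro v ω') (M.type i v ω, M.birth i v ω) ∂P ∂P :=
        lintegral_comp_of_indepFun (M.measurable_repro v)
          ((M.measurable_type i v).prodMk (M.measurable_birth i v)) (M.indepFun_repro i v) hH
    _ = _ := by
        refine lintegral_congr fun ω => ?_
        by_cases h1 : M.birth i v ω = ∞
        · simp [H, h1]
        · simp only [H, h1, if_false]
          exact M.lintegral_children v _ fun j => (hg j).comp (measurable_const.add measurable_id)

/-- The types and birth times of generation `n` have the intensity `convPow μ n`. -/
theorem genSum_eq [IsProbabilityMeasure P] [∀ i j, SFinite (M.intensity i j)] (i : Fin p) (n : ℕ)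
    {g : Fin p → ℝ → ℝ≥0∞} (hg : ∀ j, Measurable (g j)) :
    M.genSum i n g = ∑ j, ∫⁻ x, g j x ∂(convPow M.intensity n i j) := by
  induction n generalizing g with
  | zero =>
    rw [genSum, tsum_eq_single (⟨[], rfl⟩ : {u : List ℕ // u.length = 0}) fun u hu =>
      absurd (Subtype.ext (List.length_eq_zero_iff.1 u.2)) hu]
    rw [Finset.sum_eq_single i]
    · simp [convPow, birth, type, lintegral_dirac' _ (hg i)]
    · intro j _ hj
      simp [convPow, hj.symm]
    · simp
  | succ n ih =>
    rw [M.genSum_succ i n hg, ih, sum_lintegral_convPow_succ _ _ _ hg]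
    exact fun k => Finset.measurable_sum _ fun j _ =>
      Measurable.lintegral_prod_right' (f := fun q : ℝ × ℝ => g j (q.1 + q.2))
        ((hg j).comp (measurable_fst.add measurable_snd))

end Model

end CMJ

/-! ### Expected scores and the renewal formula for the mean. -/

namespace CMJ

/-- The σ-algebra on `Ω` is arbitrary, so that `sig u` can take the place of the ambient one. -/
theorem measurable_delayed {p : ℕ} {Ω : Type*} [MeasurableSpace Ω] {c : Ω → ℝ → Fin p → ℝ}
    (hc : ∀ i, Measurable fun q : Ω × ℝ => c q.1 q.2 i) (t : ℝ) {ψ : ℝ → ℝ≥0∞}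
    (hψ : Measurable ψ) : Measurable fun q : Ω × (Fin p × ℝ≥0∞) =>
      if q.2.2 = ∞ then 0 else ψ (c q.1 (t - q.2.2.toReal) q.2.1) := by
  have h : Measurable fun q : (Ω × ℝ) × Fin p => ψ (c q.1.1 q.1.2 q.2) :=
    measurable_from_prod_countable_left fun a => hψ.comp (hc a)
  refine Measurable.ite ((measurable_snd.comp measurable_snd) (measurableSet_singleton _))
    measurable_const ?_
  exact h.comp (f := fun q : Ω × (Fin p × ℝ≥0∞) => ((q.1, t - q.2.2.toReal), q.2.1))
    (by fun_prop)

namespace Model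

variable {p : ℕ} {Ω : Type*} [mΩ : MeasurableSpace Ω] {P : Measure Ω} (M : Model p P)

theorem measurable_char_joint (u : List ℕ) (j : Fin p) :
    Measurable fun q : Ω × ℝ => M.char u q.1 q.2 j :=
  (M.measurable_char u j).mono (sup_le_sup (MeasurableSpace.comap_mono (M.sig_le u)) le_rfl) le_rfl

theorem measurable_score (i : Fin p) (t : ℝ) (u : List ℕ) : Measurable (M.score i t u) := by
  classical
  have h : Measurable fun q : (Ω × ℝ) × Fin p => M.char u q.1.1 q.1.2 q.2 :=
    measurable_from_prod_countable_left fun a => M.measurable_char_joint u a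
  refine Measurable.ite (M.measurable_birth i u (measurableSet_singleton _)) measurable_const ?_
  exact h.comp ((measurable_id.prodMk
    (measurable_const.sub (M.measurable_birth i u).ennreal_toReal)).prodMk (M.measurable_type i u))

theorem measurable_lintegral_char (t : ℝ) (j : Fin p) [SFinite P] {ψ : ℝ → ℝ≥0∞}
    (hψ : Measurable ψ) : Measurable fun x => ∫⁻ ω, ψ (M.char [] ω (t - x) j) ∂P :=
  Measurable.lintegral_prod_left' (f := fun q : Ω × ℝ => ψ (M.char [] q.1 (t - q.2) j))
    (hψ.comp ((M.measurable_char_joint [] j).comp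
      (measurable_fst.prodMk (measurable_const.sub measurable_snd))))

/-- Age and type are independent of `sig u` and can be frozen. Then only the law of the
characteristic at one fixed age and type matters, and this is the same as for the ancestor. The
condition `ψ 0 = 0` matches the score `0` of the unborn. -/
theorem lintegral_score [IsProbabilityMeasure P] (i : Fin p) (t : ℝ) (u : List ℕ)
    {ψ : ℝ → ℝ≥0∞} (hψ : Measurable ψ) (h0 : ψ 0 = 0) :
    ∫⁻ ω, ψ (M.score i t u ω) ∂P = ∫⁻ ω, (if M.birth i u ω = ∞ then 0
      else ∫⁻ ω', ψ (M.char [] ω' (t - (M.birth i u ω).toReal) (M.type i u ω)) ∂P) ∂P := by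
  let F : Ω → Fin p × ℝ≥0∞ → ℝ≥0∞ := fun ω q =>
    if q.2 = ∞ then 0 else ψ (M.char u ω (t - q.2.toReal) q.1)
  have hF : @Measurable _ _ (@Prod.instMeasurableSpace _ _ (M.sig u) _) _
      (Function.uncurry F) :=
     @measurable_delayed p Ω (M.sig u) (M.char u) (M.measurable_char u) t ψ hψ
  calc ∫⁻ ω, ψ (M.score i t u ω) ∂P
      = ∫⁻ ω, F (id ω) (M.type i u ω, M.birth i u ω) ∂P := by
        refine lintegral_congr fun ω => ?_
        simp only [score, F, id]
        split_ifs <;> simp [h0]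
    _ = ∫⁻ ω, ∫⁻ ω', F (id ω') (M.type i u ω, M.birth i u ω) ∂P ∂P :=
        @lintegral_comp_of_indepFun Ω Ω (Fin p × ℝ≥0∞) mΩ (M.sig u) _ P _ id _
          (measurable_id'' (M.sig_le u)) ((M.measurable_type i u).prodMk (M.measurable_birth i u))
          (M.indep_sig i u) F hF
    _ = _ := by
        refine lintegral_congr fun ω => ?_
        simp only [F, id]
        split_ifs
        · simp
        · exact (((M.ident_char u).comp (measurable_pi_apply (t - (M.birth i u ω).toReal))).comp
            (hψ.comp (measurable_pi_apply (M.type i u ω)))).lintegral_eq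

/-- The many-to-one formula. -/
theorem tsum_lintegral_score [IsProbabilityMeasure P] [∀ i j, SFinite (M.intensity i j)]
    (i : Fin p) (t : ℝ) {ψ : ℝ → ℝ≥0∞} (hψ : Measurable ψ) (h0 : ψ 0 = 0) :
    ∑' u, ∫⁻ ω, ψ (M.score i t u ω) ∂P =
      ∑ j, ∫⁻ x, ∫⁻ ω, ψ (M.char [] ω (t - x) j) ∂P ∂(renewal M.intensity i j) := by
  simp_rw [M.lintegral_score i t _ hψ h0]
  rw [← (Equiv.sigmaFiberEquiv (List.length : List ℕ → ℕ)).tsum_eq, ENNReal.tsum_sigma']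
  have := fun n => M.genSum_eq i n
    (g := fun j x => ∫⁻ ω', ψ (M.char [] ω' (t - x) j) ∂P)
    fun j => M.measurable_lintegral_char t j hψ
  simp only [genSum] at this
  refine (tsum_congr this).trans ?_
  rw [Summable.tsum_finsetSum fun _ _ => ENNReal.summable]
  simp only [renewal, lintegral_sum_measure]

/-- By the many-to-one formula both sums are renewal integrals, of the means of the positive and of
the negative part of the characteristic. These two functions differ by at most `|f|`, whose renewal
integral is finite, so finiteness passes from one sum to the other. -/
theorem tsum_lintegral_score_lt_top [IsProbabilityMeasure P] [∀ i j, SFinite (M.intensity i j)]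
    (i : Fin p) (t : ℝ) (hint : ∀ j t, Integrable (fun ω => M.char [] ω t j) P)
    (hex : M.MeanExists i t)
    (hf : ∀ j, ∫⁻ x, ‖M.charMean j (t - x)‖ₑ ∂(renewal M.intensity i j) < ∞) :
    ∑' u, ∫⁻ ω, ENNReal.ofReal (M.score i t u ω) ∂P < ∞ ∧
      ∑' u, ∫⁻ ω, ENNReal.ofReal (-M.score i t u ω) ∂P < ∞ := by
  have hm1 : Measurable fun x : ℝ => ENNReal.ofReal x := ENNReal.measurable_ofReal
  have hm2 : Measurable fun x : ℝ => ENNReal.ofReal (-x) := ENNReal.measurable_ofReal.comp measurable_neg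
  have e1 := M.tsum_lintegral_score i t hm1 (by simp)
  have e2 := M.tsum_lintegral_score i t hm2 (by simp)
  have hlt : ∑ j, ∫⁻ x, ‖M.charMean j (t - x)‖ₑ ∂(renewal M.intensity i j) < ∞ :=
    ENNReal.sum_lt_top.2 fun j _ => hf j
  have key : ∀ j x, (∫⁻ ω, ENNReal.ofReal (M.char [] ω (t - x) j) ∂P ≤
      ∫⁻ ω, ENNReal.ofReal (-M.char [] ω (t - x) j) ∂P + ‖M.charMean j (t - x)‖ₑ) ∧
      (∫⁻ ω, ENNReal.ofReal (-M.char [] ω (t - x) j) ∂P ≤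
      ∫⁻ ω, ENNReal.ofReal (M.char [] ω (t - x) j) ∂P + ‖M.charMean j (t - x)‖ₑ) := by
    intro j x
    have h := hint j (t - x)
    have h1 : ∫⁻ ω, ENNReal.ofReal (M.char [] ω (t - x) j) ∂P ≠ ∞ := h.lintegral_lt_top.ne
    have h2 : ∫⁻ ω, ENNReal.ofReal (-M.char [] ω (t - x) j) ∂P ≠ ∞ := h.neg.lintegral_lt_top.ne
    have h3 : M.charMean j (t - x) = (∫⁻ ω, ENNReal.ofReal (M.char [] ω (t - x) j) ∂P).toReal -
        (∫⁻ ω, ENNReal.ofReal (-M.char [] ω (t - x) j) ∂P).toReal :=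
      integral_eq_lintegral_pos_part_sub_lintegral_neg_part h
    rw [h3, ← ofReal_norm, Real.norm_eq_abs]
    generalize (∫⁻ ω, ENNReal.ofReal (M.char [] ω (t - x) j) ∂P) = a at *
    generalize (∫⁻ ω, ENNReal.ofReal (-M.char [] ω (t - x) j) ∂P) = b at *
    have ha := ENNReal.ofReal_toReal h1
    have hb := ENNReal.ofReal_toReal h2
    constructor
    · calc a = ENNReal.ofReal a.toReal := ha.symm
        _ ≤ ENNReal.ofReal (b.toReal + |a.toReal - b.toReal|) :=
          ENNReal.ofReal_le_ofReal (by linarith [le_abs_self (a.toReal - b.toReal)])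
        _ = _ := by rw [ENNReal.ofReal_add ENNReal.toReal_nonneg (abs_nonneg _), hb]
    · calc b = ENNReal.ofReal b.toReal := hb.symm
        _ ≤ ENNReal.ofReal (a.toReal + |a.toReal - b.toReal|) :=
          ENNReal.ofReal_le_ofReal (by linarith [neg_abs_le (a.toReal - b.toReal)])
        _ = _ := by rw [ENNReal.ofReal_add ENNReal.toReal_nonneg (abs_nonneg _), ha]
  have hadd : ∀ {ψ : ℝ → ℝ≥0∞}, Measurable ψ →
      ∑ j, ∫⁻ x, (∫⁻ ω, ψ (M.char [] ω (t - x) j) ∂P + ‖M.charMean j (t - x)‖ₑ)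
        ∂(renewal M.intensity i j) =
      ∑ j, ∫⁻ x, ∫⁻ ω, ψ (M.char [] ω (t - x) j) ∂P ∂(renewal M.intensity i j) +
      ∑ j, ∫⁻ x, ‖M.charMean j (t - x)‖ₑ ∂(renewal M.intensity i j) := by
    intro ψ hψ
    rw [← Finset.sum_add_distrib]
    exact Finset.sum_congr rfl fun j _ =>
      lintegral_add_left (M.measurable_lintegral_char t j hψ) _
  have hs : ∀ {ψ : ℝ → ℝ≥0∞}, Measurable ψ → ∫⁻ ω, ∑' u, ψ (M.score i t u ω) ∂P =
      ∑' u, ∫⁻ ω, ψ (M.score i t u ω) ∂P := fun hψ =>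
    lintegral_tsum fun u => (hψ.comp (M.measurable_score i t u)).aemeasurable
  have l1 : ∑' u, ∫⁻ ω, ENNReal.ofReal (M.score i t u ω) ∂P ≤
      ∑' u, ∫⁻ ω, ENNReal.ofReal (-M.score i t u ω) ∂P +
      ∑ j, ∫⁻ x, ‖M.charMean j (t - x)‖ₑ ∂(renewal M.intensity i j) := by
    rw [e1, e2, ← hadd hm2]
    exact Finset.sum_le_sum fun j _ => lintegral_mono fun x => (key j x).1
  have l2 : ∑' u, ∫⁻ ω, ENNReal.ofReal (-M.score i t u ω) ∂P ≤
      ∑' u, ∫⁻ ω, ENNReal.ofReal (M.score i t u ω) ∂P +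
      ∑ j, ∫⁻ x, ‖M.charMean j (t - x)‖ₑ ∂(renewal M.intensity i j) := by
    rw [e1, e2, ← hadd hm1]
    exact Finset.sum_le_sum fun j _ => lintegral_mono fun x => (key j x).2
  rcases hex with h | h
  · rw [hs hm1] at h
    exact ⟨h, l2.trans_lt (ENNReal.add_lt_top.2 ⟨h, hlt⟩)⟩
  · rw [hs hm2] at h
    exact ⟨l1.trans_lt (ENNReal.add_lt_top.2 ⟨h, hlt⟩), h⟩

/-- The mean of the process counted with a characteristic solves the renewal equation: it is the
convolution of the mean characteristic with the renewal measure. -/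
theorem mean_eq_renewal [IsProbabilityMeasure P] [∀ i j, SFinite (M.intensity i j)]
    (i : Fin p) (t : ℝ) (hint : ∀ j t, Integrable (fun ω => M.char [] ω t j) P)
    (hex : M.MeanExists i t)
    (hf : ∀ j, ∫⁻ x, ‖M.charMean j (t - x)‖ₑ ∂(renewal M.intensity i j) < ∞) :
    (∀ᵐ ω ∂P, Summable fun u => M.score i t u ω) ∧ Integrable (M.count i t) P ∧
      M.mean i t = ∑ j, ∫ x, M.charMean j (t - x) ∂(renewal M.intensity i j) := by
  obtain ⟨hpos, hneg⟩ := M.tsum_lintegral_score_lt_top i t hint hex hf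
  have hm1 : Measurable fun x : ℝ => ENNReal.ofReal x := ENNReal.measurable_ofReal
  have hm2 : Measurable fun x : ℝ => ENNReal.ofReal (-x) := ENNReal.measurable_ofReal.comp measurable_neg
  have e1 := M.tsum_lintegral_score i t hm1 (by simp)
  have e2 := M.tsum_lintegral_score i t hm2 (by simp)
  have hsplit : ∀ x : ℝ, ‖x‖ₑ = ENNReal.ofReal x + ENNReal.ofReal (-x) := by
    intro x
    rw [← ofReal_norm, Real.norm_eq_abs]
    rcases le_total 0 x with h | h
    · rw [abs_of_nonneg h, ENNReal.ofReal_of_nonpos (neg_nonpos.2 h), add_zero]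
    · rw [abs_of_nonpos h, ENNReal.ofReal_of_nonpos h, zero_add]
  have hms := M.measurable_score i t
  have habs : ∑' u, ∫⁻ ω, ‖M.score i t u ω‖ₑ ∂P < ∞ := by
    have := fun u => lintegral_add_left (μ := P) (hm1.comp (hms u))
      fun ω => ENNReal.ofReal (-M.score i t u ω)
    simp only [Function.comp_def] at this
    simp_rw [hsplit, this]
    rw [ENNReal.tsum_add]
    exact ENNReal.add_lt_top.2 ⟨hpos, hneg⟩
  have hlt : ∫⁻ ω, ∑' u, ‖M.score i t u ω‖ₑ ∂P < ∞ := by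
    rwa [lintegral_tsum fun u => (hms u).enorm.aemeasurable]
  have hsum : ∀ᵐ ω ∂P, Summable fun u => M.score i t u ω := by
    filter_upwards [ae_lt_top (Measurable.tsum fun u => (hms u).enorm) hlt.ne] with ω hω
    refine Summable.of_enorm ?_
    exact hω.ne
  have hsi : ∀ u, Integrable (M.score i t u) P := fun u =>
    ⟨(hms u).aestronglyMeasurable, (ENNReal.le_tsum u).trans_lt habs⟩
  have hsn : Summable fun u => ∫ ω, ‖M.score i t u ω‖ ∂P := by
    simp_rw [integral_norm_eq_lintegral_enorm (hms _).aestronglyMeasurable]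
    exact ENNReal.summable_toReal habs.ne
  have hcm : AEStronglyMeasurable (M.count i t) P := by
    refine aestronglyMeasurable_of_tendsto_ae (atTop : Filter (Finset (List ℕ)))
      (f := fun s ω => ∑ u ∈ s, M.score i t u ω)
      (fun s => (Finset.measurable_sum s fun u _ => hms u).aestronglyMeasurable) ?_
    filter_upwards [hsum] with ω hω
    exact hω.hasSum
  have hci : Integrable (M.count i t) P := by
    refine ⟨hcm, lt_of_le_of_lt (lintegral_mono fun ω => ?_) hlt⟩
    exact enorm_tsum_le_tsum_enorm
  refine ⟨hsum, hci, ?_⟩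
  have hmean : M.mean i t = ∑' u, ∫ ω, M.score i t u ω ∂P :=
    (hasSum_integral_of_summable_integral_norm hsi hsn).tsum_eq.symm
  -- The many-to-one formula is for nonnegative functions, so positive and negative parts are
  -- transported separately and recombined at the end.
  have hone : ∀ u, ∫ ω, M.score i t u ω ∂P =
      (∫⁻ ω, ENNReal.ofReal (M.score i t u ω) ∂P).toReal -
      (∫⁻ ω, ENNReal.ofReal (-M.score i t u ω) ∂P).toReal := fun u =>
    integral_eq_lintegral_pos_part_sub_lintegral_neg_part (hsi u)
  simp_rw [hone] at hmean
  rw [(ENNReal.summable_toReal hpos.ne).tsum_sub (ENNReal.summable_toReal hneg.ne),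
    ← ENNReal.tsum_toReal_eq fun u => ne_top_of_le_ne_top hpos.ne (ENNReal.le_tsum u),
    ← ENNReal.tsum_toReal_eq fun u => ne_top_of_le_ne_top hneg.ne (ENNReal.le_tsum u),
    e1, e2] at hmean
  rw [e1] at hpos
  rw [e2] at hneg
  have hp := ENNReal.sum_lt_top.1 hpos
  have hn := ENNReal.sum_lt_top.1 hneg
  rw [hmean, ENNReal.toReal_sum fun j hj => (hp j hj).ne, ENNReal.toReal_sum fun j hj => (hn j hj).ne,
    ← Finset.sum_sub_distrib]
  refine Finset.sum_congr rfl fun j hj => ?_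
  have m1 := M.measurable_lintegral_char t j hm1
  have m2 := M.measurable_lintegral_char t j hm2
  rw [← integral_toReal m1.aemeasurable (ae_lt_top m1 (hp j hj).ne),
    ← integral_toReal m2.aemeasurable (ae_lt_top m2 (hn j hj).ne),
    ← integral_sub (integrable_toReal_of_lintegral_ne_top m1.aemeasurable (hp j hj).ne)
      (integrable_toReal_of_lintegral_ne_top m2.aemeasurable (hn j hj).ne)]
  exact integral_congr_ae (ae_of_all _ fun x =>
    (integral_eq_lintegral_pos_part_sub_lintegral_neg_part (hint j (t - x))).symm)

end Model

end CMJ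

/-! ### Laplace transforms on the half-line and the Neumann series far to the right. -/

namespace CMJ

section Laplace

variable {p : ℕ} {μ : Fin p → Fin p → Measure ℝ} {ϑ : ℝ}

theorem norm_exp_neg_mul (z : ℂ) (x : ℝ) :
    ‖Complex.exp (-z * (x : ℂ))‖ = Real.exp (-z.re * x) := by
  rw [Complex.norm_exp]
  simp

theorem enorm_exp_neg_mul (z : ℂ) (x : ℝ) :
    ‖Complex.exp (-z * (x : ℂ))‖ₑ = ENNReal.ofReal (Real.exp (-z.re * x)) := by
  rw [← ofReal_norm, norm_exp_neg_mul]

theorem continuous_exp_neg_mul (z : ℂ) : Continuous fun x : ℝ => Complex.exp (-z * (x : ℂ)) := by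
  fun_prop

theorem integrable_exp_neg_mul_iff {m : Measure ℝ} {z : ℂ} :
    Integrable (fun x : ℝ => Complex.exp (-z * (x : ℂ))) m ↔
      ∫⁻ x, ENNReal.ofReal (Real.exp (-z.re * x)) ∂m < ∞ := by
  have : AEStronglyMeasurable (fun x : ℝ => Complex.exp (-z * (x : ℂ))) m :=
    (continuous_exp_neg_mul z).aestronglyMeasurable
  simp only [Integrable, this, true_and, HasFiniteIntegral, enorm_exp_neg_mul]

theorem ae_nonneg_of_Iio {m : Measure ℝ} (h : m (Set.Iio 0) = 0) : ∀ᵐ x ∂m, 0 ≤ x := by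
  rw [ae_iff]
  convert h using 2
  ext x
  simp

/-- Finiteness of the Laplace transform extends to the right. -/
theorem lintegral_exp_lt_top_of_le {m : Measure ℝ} (h : m (Set.Iio 0) = 0) {s r : ℝ} (hsr : s ≤ r)
    (hs : ∫⁻ x, ENNReal.ofReal (Real.exp (-s * x)) ∂m < ∞) :
    ∫⁻ x, ENNReal.ofReal (Real.exp (-r * x)) ∂m < ∞ := by
  refine lt_of_le_of_lt (lintegral_mono_ae ?_) hs
  filter_upwards [ae_nonneg_of_Iio h] with x hx
  refine ENNReal.ofReal_le_ofReal (Real.exp_le_exp.2 ?_)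
  nlinarith

/-- The measure has the finite density `e^{sx}` with respect to the finite measure `e^{-sx} m(dx)`.
-/
theorem sigmaFinite_of_lintegral_exp {m : Measure ℝ} {s : ℝ}
    (hs : ∫⁻ x, ENNReal.ofReal (Real.exp (-s * x)) ∂m < ∞) : SigmaFinite m := by
  have hm : Measurable fun x : ℝ => ENNReal.ofReal (Real.exp (-s * x)) := by fun_prop
  have : IsFiniteMeasure (m.withDensity fun x => ENNReal.ofReal (Real.exp (-s * x))) :=
    isFiniteMeasure_withDensity hs.ne
  have h2 : m = (m.withDensity fun x => ENNReal.ofReal (Real.exp (-s * x))).withDensity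
      fun x => ENNReal.ofReal (Real.exp (s * x)) := by
    rw [← withDensity_mul _ hm (by fun_prop)]
    conv_lhs => rw [← withDensity_one (μ := m)]
    congr 1
    ext x
    simp only [Pi.one_apply, Pi.mul_apply]
    rw [← ENNReal.ofReal_mul (Real.exp_nonneg _), ← Real.exp_add]
    simp
  rw [h2]
  exact SigmaFinite.withDensity_ofReal _

/-- Markov's inequality: since `0 ≤ s`, the exponential is at least `e^{-st}` on `Iic t`. -/
theorem measure_Iic_lt_top_of_lintegral_exp {m : Measure ℝ} {s : ℝ} (hs0 : 0 ≤ s)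
    (hs : ∫⁻ x, ENNReal.ofReal (Real.exp (-s * x)) ∂m < ∞) (t : ℝ) : m (Set.Iic t) < ∞ := by
  have h := mul_meas_ge_le_lintegral₀ (μ := m)
    (f := fun x => ENNReal.ofReal (Real.exp (-s * x))) (by fun_prop)
    (ENNReal.ofReal (Real.exp (-s * t)))
  have h2 : m (Set.Iic t) ≤ m {x | ENNReal.ofReal (Real.exp (-s * t)) ≤
      ENNReal.ofReal (Real.exp (-s * x))} := by
    refine measure_mono fun x hx => ENNReal.ofReal_le_ofReal (Real.exp_le_exp.2 ?_)
    have : x ≤ t := hx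
    nlinarith
  have h3 := (mul_le_mul_right h2 (ENNReal.ofReal (Real.exp (-s * t)))).trans_lt (h.trans_lt hs)
  by_contra h4
  rw [not_lt, top_le_iff] at h4
  rw [h4, ENNReal.mul_top (by simp [Real.exp_pos])] at h3
  exact lt_irrefl _ h3

theorem mem_laplaceDomain_of_le (hsupp : ∀ i j, μ i j (Set.Iio 0) = 0)
    (hϑ : (ϑ : ℂ) ∈ laplaceDomain μ) {z : ℂ} (hz : ϑ ≤ z.re) : z ∈ laplaceDomain μ :=
  fun i j => lintegral_exp_lt_top_of_le (hsupp i j) hz (by simpa using hϑ i j)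

/-- Each entry is the complex moment generating function of `x ↦ -x`, which is analytic over the
interior of its set of integrability. -/
theorem analyticAt_laplace (hsupp : ∀ i j, μ i j (Set.Iio 0) = 0)
    (hϑ : (ϑ : ℂ) ∈ laplaceDomain μ) {z : ℂ} (hz : ϑ < z.re) (i j : Fin p) :
    AnalyticAt ℂ (fun z => laplace μ z i j) z := by
  have h1 : (fun z => laplace μ z i j) = complexMGF (fun x : ℝ => -x) (μ i j) := by
    ext z
    simp [laplace, complexMGF]
  rw [h1]
  refine analyticAt_complexMGF ?_
  refine interior_maximal (s := integrableExpSet (fun x : ℝ => -x) (μ i j)) (t := Set.Ioi ϑ)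
    ?_ isOpen_Ioi hz
  intro s hs
  have h2 := integrable_exp_neg_mul_iff.2 (mem_laplaceDomain_of_le hsupp hϑ
    (z := (s : ℂ)) (by simpa using (le_of_lt hs)) i j)
  refine h2.norm.congr (ae_of_all _ fun x => (norm_exp_neg_mul _ x).trans ?_)
  simp

theorem norm_laplace_le (hsupp : ∀ i j, μ i j (Set.Iio 0) = 0)
    (hϑ : (ϑ : ℂ) ∈ laplaceDomain μ) {z : ℂ} (hz : ϑ ≤ z.re) (i j : Fin p) :
    ‖laplace μ z i j‖ ≤ ∫ x, Real.exp (-ϑ * x) ∂(μ i j) := by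
  have h2 := integrable_exp_neg_mul_iff.2 (hϑ i j)
  simp only [laplace, Matrix.of_apply]
  refine norm_integral_le_of_norm_le (h2.norm.congr (ae_of_all _ fun x => (norm_exp_neg_mul _ x).trans ?_)) ?_
  · simp
  · filter_upwards [ae_nonneg_of_Iio (hsupp i j)] with x hx
    rw [norm_exp_neg_mul]
    exact Real.exp_le_exp.2 (by nlinarith)

theorem laplace_conj (z : ℂ) (i j : Fin p) :
    laplace μ (conj z) i j = conj (laplace μ z i j) := by
  simp only [laplace, Matrix.of_apply]
  rw [← integral_conj]
  congr 1
  ext x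
  rw [← Complex.exp_conj]
  simp

/-- Dominated convergence: on the half-line, `e^{-sx}` tends to the indicator of `{0}`. -/
theorem tendsto_laplace_massAtZero (hsupp : ∀ i j, μ i j (Set.Iio 0) = 0)
    (hϑ : (ϑ : ℂ) ∈ laplaceDomain μ) :
    Tendsto (fun s : ℝ => laplace μ (s : ℂ)) atTop (𝓝 (massAtZero μ)) := by
  refine tendsto_pi_nhds.2 fun i => tendsto_pi_nhds.2 fun j => ?_
  simp only [laplace, massAtZero, Matrix.of_apply]
  have h0 : (((μ i j {0}).toReal : ℝ) : ℂ) =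
      ∫ x, Set.indicator ({0} : Set ℝ) (fun _ => (1 : ℂ)) x ∂(μ i j) := by
    rw [integral_indicator_const _ (measurableSet_singleton 0)]
    simp [Measure.real]
  rw [h0]
  have h2 := integrable_exp_neg_mul_iff.2 (hϑ i j)
  refine tendsto_integral_filter_of_dominated_convergence _ (Eventually.of_forall fun s =>
    (continuous_exp_neg_mul _).aestronglyMeasurable) ?_ h2.norm ?_
  · filter_upwards [eventually_ge_atTop ϑ] with s hs
    filter_upwards [ae_nonneg_of_Iio (hsupp i j)] with x hx
    rw [norm_exp_neg_mul, norm_exp_neg_mul]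
    refine Real.exp_le_exp.2 ?_
    simp only [Complex.ofReal_re]
    nlinarith
  · filter_upwards [ae_nonneg_of_Iio (hsupp i j)] with x hx
    rcases hx.eq_or_lt with rfl | hx
    · simp
    · rw [Set.indicator_of_notMem (by simpa using hx.ne')]
      rw [tendsto_zero_iff_norm_tendsto_zero]
      simp_rw [norm_exp_neg_mul]
      refine Real.tendsto_exp_atBot.comp ?_
      simp only [Complex.ofReal_re, neg_mul]
      exact tendsto_neg_atTop_atBot.comp (tendsto_id.atTop_mul_const hx)

end Laplace

theorem summable_pow_of_norm_pow_lt_one {A : Type*} [NormedRing A] [CompleteSpace A]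
    {a : A} {n : ℕ} (hn : n ≠ 0) (h : ‖a ^ n‖ < 1) : Summable fun k => a ^ k := by
  have : NeZero n := ⟨hn⟩
  -- Division with remainder of the exponent by `n` splits the series into a geometric series in `a
  -- ^ n` and a finite sum.
  have h1 : Summable fun q : ℕ × Fin n => (a ^ n) ^ q.1 * a ^ (q.2 : ℕ) :=
    summable_mul_of_summable_norm (f := fun k => (a ^ n) ^ k) (g := fun r : Fin n => a ^ (r : ℕ))
      (summable_norm_geometric_of_norm_lt_one h) Summable.of_finite
  rw [← (Nat.divModEquiv n).symm.summable_iff]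
  refine h1.congr fun q => ?_
  simp only [Function.comp, Nat.divModEquiv_symm_apply]
  rw [pow_add, ← pow_mul, mul_comm n]

section Renewal

variable {p : ℕ} {μ : Fin p → Fin p → Measure ℝ} {ϑ : ℝ}

attribute [local instance] Matrix.linftyOpNormedRing Matrix.linftyOpNormedAlgebra

/-- By Gelfand's formula some power of `massAtZero μ` has norm below one. By continuity the same
power of `laplace μ s` has norm below one for all large `s`. -/
theorem exists_summable_laplace_pow (hsupp : ∀ i j, μ i j (Set.Iio 0) = 0)
    (hϑ : (ϑ : ℂ) ∈ laplaceDomain μ) (hrad : spectralRadius ℂ (massAtZero μ) < 1) (r : ℝ) :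
    ∃ s : ℝ, r < s ∧ Summable fun n => laplace μ (s : ℂ) ^ n := by
  have : CompleteSpace (Matrix (Fin p) (Fin p) ℂ) := FiniteDimensional.complete ℂ _
  have h1 := spectrum.pow_nnnorm_pow_one_div_tendsto_nhds_spectralRadius (massAtZero μ)
  obtain ⟨n, hn, hn0⟩ := ((h1.eventually_lt_const hrad).and (eventually_gt_atTop 0)).exists
  have h2 : ‖massAtZero μ ^ n‖ < 1 := by
    have h3 : (‖massAtZero μ ^ n‖₊ : ℝ≥0∞) < 1 := by
      by_contra h4
      rw [not_lt] at h4
      exact absurd hn (not_lt.2 (ENNReal.one_le_rpow h4 (by positivity)))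
    exact_mod_cast h3
  have h3 : Tendsto (fun s : ℝ => ‖laplace μ (s : ℂ) ^ n‖) atTop (𝓝 ‖massAtZero μ ^ n‖) :=
    ((tendsto_laplace_massAtZero hsupp hϑ).pow n).norm
  obtain ⟨s, hs, hs'⟩ := ((h3.eventually_lt_const h2).and (eventually_gt_atTop r)).exists
  exact ⟨s, hs', summable_pow_of_norm_pow_lt_one hn0.ne' hs⟩

end Renewal

end CMJ

/-! ### The Laplace transform of the renewal measure. -/

namespace CMJ

section Renewal

variable {p : ℕ} {μ : Fin p → Fin p → Measure ℝ}

theorem sFinite_convPow [∀ i j, SFinite (μ i j)] (n : ℕ) (i j : Fin p) :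
    SFinite (convPow μ n i j) := by
  induction n generalizing i j with
  | zero =>
    simp only [convPow]
    split_ifs <;> infer_instance
  | succ n ih =>
    simp only [convPow, ← Measure.sum_fintype]
    infer_instance

theorem convPow_Iio [∀ i j, SFinite (μ i j)] (hsupp : ∀ i j, μ i j (Set.Iio 0) = 0)
    (n : ℕ) (i j : Fin p) : convPow μ n i j (Set.Iio 0) = 0 := by
  induction n generalizing i j with
  | zero =>
    simp only [convPow]
    split_ifs <;> simp
  | succ n ih =>
    have := sFinite_convPow (μ := μ) n
    simp only [convPow, Measure.finsetSum_apply]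
    refine Finset.sum_eq_zero fun k _ => ?_
    rw [Measure.conv, Measure.map_apply (by fun_prop) measurableSet_Iio]
    have h1 := (Measure.quasiMeasurePreserving_fst (μ := convPow μ n i k) (ν := μ k j)).ae
      (ae_nonneg_of_Iio (ih i k))
    have h2 := (Measure.quasiMeasurePreserving_snd (μ := convPow μ n i k) (ν := μ k j)).ae
      (ae_nonneg_of_Iio (hsupp k j))
    have h3 : ∀ᵐ q ∂((convPow μ n i k).prod (μ k j)), 0 ≤ q.1 + q.2 := by
      filter_upwards [h1, h2] with q hq1 hq2 using add_nonneg hq1 hq2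
    rw [ae_iff] at h3
    convert h3 using 2
    ext q
    simp

theorem renewal_Iio [∀ i j, SFinite (μ i j)] (hsupp : ∀ i j, μ i j (Set.Iio 0) = 0)
    (i j : Fin p) : renewal μ i j (Set.Iio 0) = 0 := by
  rw [renewal, Measure.sum_apply _ measurableSet_Iio]
  simp [convPow_Iio hsupp]

theorem laplace_convPow [∀ i j, SFinite (μ i j)] {z : ℂ} (hz : z ∈ laplaceDomain μ)
    (n : ℕ) (i j : Fin p) :
    Integrable (fun x : ℝ => Complex.exp (-z * (x : ℂ))) (convPow μ n i j) ∧
      ∫ x, Complex.exp (-z * (x : ℂ)) ∂(convPow μ n i j) = (laplace μ z ^ n) i j := by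
  induction n generalizing i j with
  | zero =>
    simp only [convPow, pow_zero, Matrix.one_apply]
    split_ifs with h
    · refine ⟨integrable_dirac (by simp), ?_⟩
      rw [integral_dirac]
      simp
    · exact ⟨integrable_zero_measure, integral_zero_measure _⟩
  | succ n ih =>
    have := sFinite_convPow (μ := μ) n
    have hfac : ∀ x y : ℝ, Complex.exp (-z * ((x + y : ℝ) : ℂ)) =
        Complex.exp (-z * (x : ℂ)) * Complex.exp (-z * (y : ℂ)) := fun x y => by
      rw [← Complex.exp_add]
      push_cast
      ring_nf
    have hμ : ∀ k, Integrable (fun x : ℝ => Complex.exp (-z * (x : ℂ))) (μ k j) := fun k =>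
      integrable_exp_neg_mul_iff.2 (hz k j)
    have hI : ∀ k, Integrable (fun x : ℝ => Complex.exp (-z * (x : ℂ)))
        ((convPow μ n i k).conv (μ k j)) := fun k => by
      rw [integrable_conv_iff (continuous_exp_neg_mul z).aestronglyMeasurable]
      simp_rw [hfac, norm_mul]
      refine ⟨ae_of_all _ fun x => (hμ k).const_mul _, ?_⟩
      simp_rw [integral_const_mul]
      exact (ih i k).1.norm.mul_const _
    simp only [convPow]
    refine ⟨integrable_finsetSum_measure.2 fun k _ => hI k, ?_⟩
    rw [integral_finsetSum_measure fun k _ => hI k, pow_succ, Matrix.mul_apply]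
    refine Finset.sum_congr rfl fun k _ => ?_
    rw [integral_conv (hI k)]
    simp_rw [hfac, integral_const_mul, integral_mul_const]
    rw [(ih i k).2]
    rfl

/-- For real `s` the entries of `laplace μ s ^ n` are integrals of positive functions against the
convolution powers, so the Neumann series sums the transform of the renewal measure. -/
theorem lintegral_exp_renewal_lt_top [∀ i j, SFinite (μ i j)] {s : ℝ}
    (hs : (s : ℂ) ∈ laplaceDomain μ) (hsum : Summable fun n => laplace μ (s : ℂ) ^ n)
    (i j : Fin p) : ∫⁻ x, ENNReal.ofReal (Real.exp (-s * x)) ∂(renewal μ i j) < ∞ := by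
  have h1 : ∀ n, ∫⁻ x, ENNReal.ofReal (Real.exp (-s * x)) ∂(convPow μ n i j) =
      ENNReal.ofReal ((laplace μ (s : ℂ) ^ n) i j).re := by
    intro n
    obtain ⟨hi, he⟩ := laplace_convPow hs n i j
    have h2 : ∀ x : ℝ, Complex.exp (-(s : ℂ) * (x : ℂ)) = ((Real.exp (-s * x) : ℝ) : ℂ) := by
      intro x
      push_cast
      rfl
    rw [← he]
    simp_rw [h2] at hi ⊢
    have hi' : Integrable (fun x : ℝ => Real.exp (-s * x)) (convPow μ n i j) := by
      have h3 := hi.re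
      simpa only [RCLike.re_to_complex, Complex.ofReal_re] using h3
    rw [integral_complex_ofReal, Complex.ofReal_re,
      ofReal_integral_eq_lintegral_ofReal hi' (ae_of_all _ fun x => Real.exp_nonneg _)]
  rw [renewal, lintegral_sum_measure]
  simp_rw [h1]
  have h3 : Summable fun n => ((laplace μ (s : ℂ) ^ n) i j).re :=
    Complex.reCLM.summable (Pi.summable.1 (Pi.summable.1 hsum i) j)
  exact h3.tsum_ofReal_lt_top

/-- Right of the abscissa of convergence, the Laplace transform of the renewal measure is the
inverse of `I - Lμ`. -/
theorem laplace_renewal [∀ i j, SFinite (μ i j)] (hsupp : ∀ i j, μ i j (Set.Iio 0) = 0) {s : ℝ}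
    (hs : (s : ℂ) ∈ laplaceDomain μ) (hsum : Summable fun n => laplace μ (s : ℂ) ^ n)
    {z : ℂ} (hz : s ≤ z.re) :
    (∀ i j, Integrable (fun x : ℝ => Complex.exp (-z * (x : ℂ))) (renewal μ i j)) ∧
    (1 - laplace μ z).det ≠ 0 ∧
    ∀ i j, ∫ x, Complex.exp (-z * (x : ℂ)) ∂(renewal μ i j) = (1 - laplace μ z)⁻¹ i j := by
  have hI : ∀ i j, Integrable (fun x : ℝ => Complex.exp (-z * (x : ℂ))) (renewal μ i j) :=
    fun i j => integrable_exp_neg_mul_iff.2 (lintegral_exp_lt_top_of_le (renewal_Iio hsupp i j) hz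
      (lintegral_exp_renewal_lt_top hs hsum i j))
  have hzD : z ∈ laplaceDomain μ := mem_laplaceDomain_of_le hsupp hs hz
  -- Integrability against the sum of the measures gives convergence of the Neumann series at `z`,
  -- with no norm estimate for `laplace μ z`.
  have hS : HasSum (fun n => laplace μ z ^ n)
      (Matrix.of fun i j => ∫ x, Complex.exp (-z * (x : ℂ)) ∂(renewal μ i j)) := by
    refine Pi.hasSum.2 fun i => Pi.hasSum.2 fun j => ?_
    have := hasSum_integral_measure (hI i j)
    simp only [(laplace_convPow hzD _ i j).2] at this
    exact this
  have h1 := hS.summable.one_sub_mul_tsum_pow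
  rw [hS.tsum_eq] at h1
  have hdet : (1 - laplace μ z).det ≠ 0 := by
    intro h0
    have := congrArg Matrix.det h1
    rw [Matrix.det_mul, h0, zero_mul, Matrix.det_one] at this
    exact zero_ne_one this
  refine ⟨hI, hdet, fun i j => ?_⟩
  rw [Matrix.inv_eq_right_inv h1]
  rfl

end Renewal

end CMJ

/-! ### Principal parts, and lower bounds for zero-free holomorphic functions. -/

namespace CMJ

section ComplexAnalysis

/-- The principal part of a function with a pole of order at most `n`. -/
theorem exists_principalPart {F g : ℂ → ℂ} {l : ℂ} {n : ℕ} (hg : AnalyticAt ℂ g l)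
    (h : ∀ᶠ z in 𝓝[≠] l, g z = (z - l) ^ n * F z) :
    ∃ (A : ℕ → ℂ) (q : ℂ → ℂ), AnalyticAt ℂ q l ∧
      ∀ᶠ z in 𝓝[≠] l, F z = q z + ∑ k ∈ Finset.range n, A k * ((z - l) ^ (k + 1))⁻¹ := by
  induction n generalizing F g with
  | zero =>
    refine ⟨fun _ => 0, g, hg, ?_⟩
    filter_upwards [h] with z hz
    simp [hz]
  | succ n ih =>
    obtain ⟨s, hs⟩ := hg
    -- Since `dslope g l` is `(g z - g l) / (z - l)` off `l`, removing the leading term lowers the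
    -- order of the pole by one.
    obtain ⟨A, q, hq, hA⟩ := ih (F := fun z => F z - g l * ((z - l) ^ (n + 1))⁻¹)
      (g := dslope g l) ⟨_, hs.has_fpower_series_dslope_fslope⟩ (by
        filter_upwards [h, self_mem_nhdsWithin] with z hz hzl
        have hne : z - l ≠ 0 := sub_ne_zero.2 hzl
        rw [dslope_of_ne _ hzl, slope_def_field, hz]
        field_simp
        ring)
    refine ⟨fun k => if k = n then g l else A k, q, hq, ?_⟩
    filter_upwards [hA] with z hz
    rw [Finset.sum_range_succ, if_pos rfl, ← add_assoc, ← sub_eq_iff_eq_add, hz]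
    congr 1
    refine Finset.sum_congr rfl fun k hk => ?_
    rw [if_neg (Finset.mem_range.1 hk).ne]

/-- Subtracting the principal parts at finitely many poles leaves a holomorphic function. -/
theorem exists_regularPart {F : ℂ → ℂ} {O : Set ℂ} (S : Finset ℂ) (n : ℂ → ℕ)
    (hF : ∀ z ∈ O, z ∉ S → DifferentiableAt ℂ F z)
    (hp : ∀ l ∈ S, ∃ g : ℂ → ℂ, AnalyticAt ℂ g l ∧
      ∀ᶠ z in 𝓝[≠] l, g z = (z - l) ^ n l * F z) :
    ∃ (A : ℂ → ℕ → ℂ) (R : ℂ → ℂ), DifferentiableOn ℂ R O ∧ ∀ z, z ∉ S →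
      F z = R z + ∑ l ∈ S, ∑ k ∈ Finset.range (n l), A l k * ((z - l) ^ (k + 1))⁻¹ := by
  classical
  have hp' : ∀ l : ℂ, ∃ (A : ℕ → ℂ) (q : ℂ → ℂ), l ∈ S → AnalyticAt ℂ q l ∧
      ∀ᶠ z in 𝓝[≠] l, F z = q z + ∑ k ∈ Finset.range (n l), A k * ((z - l) ^ (k + 1))⁻¹ := by
    intro l
    by_cases hl : l ∈ S
    · obtain ⟨g, hg, hg'⟩ := hp l hl
      obtain ⟨A, q, h⟩ := exists_principalPart hg hg'
      exact ⟨A, q, fun _ => h⟩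
    · exact ⟨fun _ => 0, fun _ => 0, fun h => absurd h hl⟩
  choose A q hq using hp'
  have hPd : ∀ l z, z ≠ l → DifferentiableAt ℂ
      (fun z => ∑ k ∈ Finset.range (n l), A l k * ((z - l) ^ (k + 1))⁻¹) z := by
    intro l z hz
    refine DifferentiableAt.fun_sum fun k _ => DifferentiableAt.const_mul ?_ _
    exact DifferentiableAt.inv (by fun_prop) (pow_ne_zero _ (sub_ne_zero.2 hz))
  -- The values of `F` on `S` are arbitrary; they are replaced by those of the local holomorphic
  -- remainders.
  refine ⟨A, fun z => (if z ∈ S then q z z else F z) -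
    ∑ l ∈ S, ∑ k ∈ Finset.range (n l), A l k * ((z - l) ^ (k + 1))⁻¹, ?_, ?_⟩
  · intro z hz
    refine DifferentiableAt.differentiableWithinAt ?_
    by_cases hzS : z ∈ S
    · have hd : DifferentiableAt ℂ (fun w => q z w -
          ∑ l ∈ S.erase z, ∑ k ∈ Finset.range (n l), A l k * ((w - l) ^ (k + 1))⁻¹) z :=
        (hq z hzS).1.differentiableAt.sub
          (DifferentiableAt.fun_sum fun l hl => hPd l z (Finset.ne_of_mem_erase hl).symm)
      refine hd.congr_of_eventuallyEq ?_
      have hne : ∀ᶠ w in 𝓝[≠] z, w ∉ S := by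
        have : ∀ᶠ w in 𝓝 z, w ∉ S.erase z :=
          (S.erase z).finite_toSet.isClosed.isOpen_compl.mem_nhds (by simp)
        filter_upwards [this.filter_mono nhdsWithin_le_nhds, self_mem_nhdsWithin] with w hw hwz hwS
        exact hw (Finset.mem_erase.2 ⟨hwz, hwS⟩)
      have hev := (hq z hzS).2.and hne
      rw [eventually_nhdsWithin_iff] at hev
      filter_upwards [hev] with w hw
      rw [← Finset.add_sum_erase S _ hzS]
      by_cases hwz : w = z
      -- At the pole itself its own principal part is zero, as `0⁻¹ = 0`.
      · subst hwz
        rw [if_pos hzS]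
        simp
      · obtain ⟨h1, h2⟩ := hw hwz
        rw [if_neg h2, h1]
        ring
    · have hd : DifferentiableAt ℂ (fun w => F w -
          ∑ l ∈ S, ∑ k ∈ Finset.range (n l), A l k * ((w - l) ^ (k + 1))⁻¹) z :=
        (hF z hz hzS).sub (DifferentiableAt.fun_sum fun l hl => hPd l z fun h => hzS (h ▸ hl))
      refine hd.congr_of_eventuallyEq ?_
      filter_upwards [S.finite_toSet.isClosed.isOpen_compl.mem_nhds
        (show z ∈ (S : Set ℂ)ᶜ from hzS)] with w hw
      rw [if_neg (show w ∉ S from hw)]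
  · intro z hz
    simp only [if_neg hz, sub_add_cancel]

/-- A bounded holomorphic function without zeros on a disc is bounded away from zero on smaller
discs, in terms of its value at the center. -/
theorem exists_lower_bound_of_ne_zero {C c₀ R r : ℝ} (hc₀ : 0 < c₀) (hr : 0 ≤ r) (hrR : r < R) :
    ∃ δ > 0, ∀ (D : ℂ → ℂ) (c : ℂ), DifferentiableOn ℂ D (Metric.ball c R) →
      (∀ z ∈ Metric.ball c R, D z ≠ 0) → (∀ z ∈ Metric.ball c R, ‖D z‖ ≤ C) → c₀ ≤ ‖D c‖ →
      ∀ z, ‖z - c‖ ≤ r → δ ≤ ‖D z‖ := by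
  have hR : 0 < R := hr.trans_lt hrR
  -- The added `1` makes `m` positive, as Borel-Carathéodory requires.
  set m : ℝ := |Real.log (C / c₀)| + 1 with hm
  have hm0 : 0 < m := by positivity
  refine ⟨c₀ * Real.exp (-(2 * m * r / (R - r))), by positivity, ?_⟩
  intro D c hD hne hC hc z hz
  have hcb : c ∈ Metric.ball c R := Metric.mem_ball_self hR
  have hD' : DifferentiableOn ℂ (fun z => deriv D z / D z) (Metric.ball c R) :=
    (hD.deriv Metric.isOpen_ball).div hD hne
  -- A primitive of `D' / D` vanishing at the centre is a logarithm of `D / D c`; its real part is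
  -- at most `log (C / c₀)`.
  obtain ⟨L, hLc, hL⟩ := hD'.isExactOn_ball.with_val_at c 0
  have hEd : ∀ w ∈ Metric.ball c R, HasDerivAt (fun w => D w * Complex.exp (-L w)) 0 w := by
    intro w hw
    have h1 := (hD.differentiableAt (Metric.isOpen_ball.mem_nhds hw)).hasDerivAt
    have h2 := h1.mul (hL w hw).neg.cexp
    refine h2.congr_deriv ?_
    rw [mul_neg, mul_neg, mul_left_comm, mul_div_cancel₀ _ (hne w hw)]
    ring
  have hE : ∀ w ∈ Metric.ball c R, D w = D c * Complex.exp (L w) := by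
    intro w hw
    have h1 := Metric.isOpen_ball.is_const_of_deriv_eq_zero
      (convex_ball c R).isPreconnected
      (fun w hw => (hEd w hw).differentiableAt.differentiableWithinAt)
      (fun w hw => (hEd w hw).deriv) hw hcb
    simp only [hLc, neg_zero, Complex.exp_zero, mul_one] at h1
    rw [← h1, mul_assoc, ← Complex.exp_add]
    simp
  have hre : ∀ w ∈ Metric.ball c R, (L w).re ≤ m := by
    intro w hw
    have h1 : c₀ * Real.exp (L w).re ≤ C := by
      calc c₀ * Real.exp (L w).re ≤ ‖D c‖ * Real.exp (L w).re := by gcongr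
        _ = ‖D w‖ := by rw [hE w hw, norm_mul, Complex.norm_exp]
        _ ≤ C := hC w hw
    have h2 : Real.exp (L w).re ≤ C / c₀ := by
      rw [le_div_iff₀ hc₀, mul_comm]
      exact h1
    have h3 := (Real.le_log_iff_exp_le (lt_of_lt_of_le (Real.exp_pos _) h2)).2 h2
    linarith [le_abs_self (Real.log (C / c₀))]
  have hzb : z - c ∈ Metric.ball (0 : ℂ) R := by
    simpa using hz.trans_lt hrR
  have hmem : ∀ w ∈ Metric.ball (0 : ℂ) R, c + w ∈ Metric.ball c R := by
    intro w hw
    simpa using hw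
  have hBC := Complex.borelCaratheodory (f := fun w => L (c + w)) hm0
    (fun w hw => ((hL (c + w) (hmem w hw)).differentiableAt.comp w
      (by fun_prop)).differentiableWithinAt)
    (fun w hw => hre _ (hmem w hw)) hR hzb
  simp only [add_sub_cancel, add_zero, hLc, norm_zero, zero_mul, zero_div] at hBC
  have hzb' : z ∈ Metric.ball c R := by simpa [dist_eq_norm] using hz.trans_lt hrR
  have h4 : 2 * m * ‖z - c‖ / (R - ‖z - c‖) ≤ 2 * m * r / (R - r) := by
    have : 0 < R - r := sub_pos.2 hrR
    gcongr
  rw [hE z hzb', norm_mul, Complex.norm_exp]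
  gcongr
  have := (abs_le.1 (Complex.abs_re_le_norm (L z))).1
  linarith

theorem analyticAt_det {p : ℕ} {A : ℂ → Matrix (Fin p) (Fin p) ℂ} {z : ℂ}
    (h : ∀ i j, AnalyticAt ℂ (fun z => A z i j) z) : AnalyticAt ℂ (fun z => (A z).det) z := by
  simp only [Matrix.det_apply']
  exact Finset.analyticAt_fun_sum _ fun σ _ => analyticAt_const.mul
    (Finset.analyticAt_fun_prod _ fun i _ => h _ _)

theorem analyticAt_adjugate {p : ℕ} {A : ℂ → Matrix (Fin p) (Fin p) ℂ} {z : ℂ}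
    (h : ∀ i j, AnalyticAt ℂ (fun z => A z i j) z) (i j : Fin p) :
    AnalyticAt ℂ (fun z => (A z).adjugate i j) z := by
  simp only [Matrix.adjugate_apply]
  refine analyticAt_det fun a b => ?_
  simp only [Matrix.updateRow_apply]
  split_ifs
  · exact analyticAt_const
  · exact h a b

theorem norm_det_le {p : ℕ} {A : Matrix (Fin p) (Fin p) ℂ} {x : ℝ} (h : ∀ i j, ‖A i j‖ ≤ x) :
    ‖A.det‖ ≤ p.factorial * x ^ p := by
  have := Matrix.det_le (A := A) (abv := NormedField.toAbsoluteValue ℂ) (x := x) h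
  rw [Fintype.card_fin, nsmul_eq_mul] at this
  exact this

theorem norm_adjugate_le {p : ℕ} {A : Matrix (Fin p) (Fin p) ℂ} {x : ℝ} (hx : 1 ≤ x)
    (h : ∀ i j, ‖A i j‖ ≤ x) (i j : Fin p) : ‖A.adjugate i j‖ ≤ p.factorial * x ^ p := by
  rw [Matrix.adjugate_apply]
  refine norm_det_le fun a b => ?_
  rw [Matrix.updateRow_apply]
  split_ifs
  · by_cases hb : b = i
    · subst hb
      simpa using hx
    · rw [Pi.single_eq_of_ne hb, norm_zero]
      linarith
  · exact h a b

end ComplexAnalysis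

end CMJ

/-! ### The resolvent (I - Lμ)⁻¹ to the right of ϑ. -/

namespace CMJ

section Resolvent

variable {p : ℕ} {μ : Fin p → Fin p → Measure ℝ} {ϑ : ℝ}

theorem isOpen_re_gt (ϑ : ℝ) : IsOpen {z : ℂ | ϑ < z.re} :=
  isOpen_lt continuous_const Complex.continuous_re

theorem analyticAt_one_sub_laplace (hsupp : ∀ i j, μ i j (Set.Iio 0) = 0)
    (hϑ : (ϑ : ℂ) ∈ laplaceDomain μ) {z : ℂ} (hz : ϑ < z.re) (i j : Fin p) :
    AnalyticAt ℂ (fun z => (1 - laplace μ z) i j) z := by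
  simp only [Matrix.sub_apply]
  exact analyticAt_const.sub (analyticAt_laplace hsupp hϑ hz i j)

theorem inv_apply_eq (A : Matrix (Fin p) (Fin p) ℂ) (i j : Fin p) :
    A⁻¹ i j = (A.det)⁻¹ * A.adjugate i j := by
  rw [Matrix.inv_def, Matrix.smul_apply, Ring.inverse_eq_inv', smul_eq_mul]

theorem det_ne_zero_of_notMem (hsupp : ∀ i j, μ i j (Set.Iio 0) = 0)
    (hϑ : (ϑ : ℂ) ∈ laplaceDomain μ) {z : ℂ} (hz : ϑ < z.re) (h : z ∉ rootsAbove μ ϑ) :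
    (1 - laplace μ z).det ≠ 0 := fun h0 =>
  h ⟨⟨mem_laplaceDomain_of_le hsupp hϑ hz.le, h0⟩, hz⟩

theorem eventually_det_ne_zero (hsupp : ∀ i j, μ i j (Set.Iio 0) = 0)
    (hϑ : (ϑ : ℂ) ∈ laplaceDomain μ) (hfin : (rootsAbove μ ϑ).Finite) {l : ℂ} (hl : ϑ < l.re) :
    ∀ᶠ z in 𝓝[≠] l, (1 - laplace μ z).det ≠ 0 := by
  have h1 : ∀ᶠ z in 𝓝 l, z ∉ rootsAbove μ ϑ \ {l} :=
    (hfin.subset Set.sdiff_subset).isClosed.isOpen_compl.mem_nhds (by simp)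
  filter_upwards [h1.filter_mono nhdsWithin_le_nhds, self_mem_nhdsWithin,
    mem_nhdsWithin_of_mem_nhds ((isOpen_re_gt ϑ).mem_nhds hl)] with z hz hzl hzre
  exact det_ne_zero_of_notMem hsupp hϑ hzre fun h => hz ⟨h, hzl⟩

/-- The infimum in `poleOrder` is attained because the set is nonempty: it contains the order of
vanishing of the determinant, the adjugate being holomorphic. -/
theorem poleOrder_spec (hsupp : ∀ i j, μ i j (Set.Iio 0) = 0)
    (hϑ : (ϑ : ℂ) ∈ laplaceDomain μ) (hfin : (rootsAbove μ ϑ).Finite) {l : ℂ} (hl : ϑ < l.re)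
    (i j : Fin p) : ∃ g : ℂ → ℂ, AnalyticAt ℂ g l ∧
      ∀ᶠ z in 𝓝[≠] l, g z = (z - l) ^ poleOrder μ l *
        ((1 - laplace μ z)⁻¹ : Matrix (Fin p) (Fin p) ℂ) i j := by
  have hne : {n : ℕ | ∀ i j, ∃ g : ℂ → ℂ, AnalyticAt ℂ g l ∧
    ∀ᶠ z in 𝓝[≠] l, g z = (z - l) ^ n *
      ((1 - laplace μ z)⁻¹ : Matrix (Fin p) (Fin p) ℂ) i j}.Nonempty := by
    have hent := analyticAt_one_sub_laplace hsupp hϑ hl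
    have hev := eventually_det_ne_zero hsupp hϑ hfin hl
    obtain ⟨n, g, hg, hg0, hgn⟩ := (analyticAt_det hent).exists_eventuallyEq_pow_smul_nonzero_iff.2
      (fun h0 => by
        obtain ⟨z, h1, h2⟩ := ((h0.filter_mono nhdsWithin_le_nhds).and hev).exists
        exact h2 h1)
    refine ⟨n, fun i j => ⟨fun z => (g z)⁻¹ * (1 - laplace μ z).adjugate i j,
      (hg.inv hg0).mul (analyticAt_adjugate hent i j), ?_⟩⟩
    filter_upwards [hgn.filter_mono nhdsWithin_le_nhds, self_mem_nhdsWithin,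
      (hg.continuousAt.eventually_ne hg0).filter_mono nhdsWithin_le_nhds] with z hz hzl hgz
    have hzl' : z - l ≠ 0 := sub_ne_zero.2 hzl
    rw [inv_apply_eq, hz, smul_eq_mul]
    field_simp
  exact Nat.sInf_mem hne i j

/-- In a vertical strip to the right of `ϑ`, the resolvent is bounded far from the real axis. -/
theorem exists_resolvent_bound [∀ i j, SFinite (μ i j)] (hsupp : ∀ i j, μ i j (Set.Iio 0) = 0)
    (hϑ : (ϑ : ℂ) ∈ laplaceDomain μ) (hfin : (rootsAbove μ ϑ).Finite) {s σ : ℝ} (hσ : ϑ < σ)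
    (hσs : σ ≤ s) (hsum : Summable fun n => laplace μ (s : ℂ) ^ n) :
    ∃ T C : ℝ, ∀ z : ℂ, σ ≤ z.re → z.re ≤ s → T ≤ |z.im| → ∀ i j,
      ‖(1 - laplace μ z)⁻¹ i j‖ ≤ C := by
  have hs : (s : ℂ) ∈ laplaceDomain μ :=
    mem_laplaceDomain_of_le hsupp hϑ (by simpa using (hσ.trans_le hσs).le)
  obtain ⟨T₀, hT₀⟩ : ∃ T₀ : ℝ, ∀ z ∈ rootsAbove μ ϑ, ‖z‖ ≤ T₀ := by
    obtain ⟨T₀, h⟩ := hfin.isBounded.exists_norm_le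
    exact ⟨T₀, h⟩
  have hbd : ∃ x : ℝ, 1 ≤ x ∧ ∀ z : ℂ, ϑ ≤ z.re → ∀ i j, ‖(1 - laplace μ z) i j‖ ≤ x := by
    refine ⟨1 + ∑ i, ∑ j, ∫ x, Real.exp (-ϑ * x) ∂(μ i j), ?_, fun z hz i j => ?_⟩
    · have : 0 ≤ ∑ i, ∑ j, ∫ x, Real.exp (-ϑ * x) ∂(μ i j) := Finset.sum_nonneg fun i _ =>
        Finset.sum_nonneg fun j _ => integral_nonneg fun x => Real.exp_nonneg _
      linarith
    · rw [Matrix.sub_apply]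
      refine (norm_sub_le _ _).trans (add_le_add ?_ ((norm_laplace_le hsupp hϑ hz i j).trans ?_))
      · rw [Matrix.one_apply]
        split_ifs <;> simp
      · have hnn : ∀ i j, 0 ≤ ∫ x, Real.exp (-ϑ * x) ∂(μ i j) := fun i j =>
          integral_nonneg fun x => Real.exp_nonneg _
        exact (Finset.single_le_sum (f := fun j => ∫ x, Real.exp (-ϑ * x) ∂(μ i j))
          (fun j _ => hnn i j) (Finset.mem_univ j)).trans
          (Finset.single_le_sum (f := fun i => ∑ j, ∫ x, Real.exp (-ϑ * x) ∂(μ i j))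
            (fun i _ => Finset.sum_nonneg fun j _ => hnn i j) (Finset.mem_univ i))
  obtain ⟨x, hx1, hx⟩ := hbd
  -- On `Re z = s` the inverse is the transform of the renewal measure, hence bounded. So is its
  -- determinant, which keeps `det (I - Lμ)` away from zero.
  obtain ⟨y, hy0, hy⟩ : ∃ y : ℝ, 0 < y ∧ ∀ z : ℂ, z.re = s → y ≤ ‖(1 - laplace μ z).det‖ := by
    have hnn : ∀ i j, 0 ≤ ∫ x, Real.exp (-s * x) ∂(renewal μ i j) := fun i j =>
      integral_nonneg fun x => Real.exp_nonneg _
    set Y : ℝ := 1 + ∑ i, ∑ j, ∫ x, Real.exp (-s * x) ∂(renewal μ i j) with hY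
    have hY0 : 0 < Y := by
      have : 0 ≤ ∑ i, ∑ j, ∫ x, Real.exp (-s * x) ∂(renewal μ i j) := Finset.sum_nonneg fun i _ =>
        Finset.sum_nonneg fun j _ => hnn i j
      linarith
    have hfac : (0 : ℝ) < p.factorial * Y ^ p := by positivity
    refine ⟨(p.factorial * Y ^ p)⁻¹, by positivity, fun z hz => ?_⟩
    obtain ⟨-, hdet, hL⟩ := laplace_renewal hsupp hs hsum hz.ge
    have h1 : ‖((1 - laplace μ z)⁻¹).det‖ ≤ p.factorial * Y ^ p := by
      refine norm_det_le fun i j => ?_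
      rw [← hL i j]
      refine (norm_integral_le_integral_norm _).trans ?_
      simp_rw [norm_exp_neg_mul, hz]
      have h2 := (Finset.single_le_sum (f := fun j => ∫ x, Real.exp (-s * x) ∂(renewal μ i j))
          (fun j _ => hnn i j) (Finset.mem_univ j)).trans
          (Finset.single_le_sum (f := fun i => ∑ j, ∫ x, Real.exp (-s * x) ∂(renewal μ i j))
            (fun i _ => Finset.sum_nonneg fun j _ => hnn i j) (Finset.mem_univ i))
      linarith
    rw [Matrix.det_nonsing_inv, Ring.inverse_eq_inv', norm_inv] at h1
    exact inv_le_of_inv_le₀ (norm_pos_iff.2 hdet) h1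
  -- The discs are centred at `s + i Im z`: the radius `s - ϑ` extends to the line `Re = ϑ`, and `s
  -- - σ` is enough to reach `z`.
  obtain ⟨δ, hδ, hlow⟩ := exists_lower_bound_of_ne_zero (C := p.factorial * x ^ p) hy0
    (sub_nonneg.2 hσs) (sub_lt_sub_left hσ s)
  -- All roots have norm at most `T₀`, so at this height the larger disc contains none of them.
  refine ⟨T₀ + (s - ϑ) + 1, δ⁻¹ * (p.factorial * x ^ p), fun z hz1 hz2 hzT i j => ?_⟩
  have hball : ∀ w ∈ Metric.ball (⟨s, z.im⟩ : ℂ) (s - ϑ), ϑ < w.re ∧ w ∉ rootsAbove μ ϑ := by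
    intro w hw
    rw [Metric.mem_ball, dist_eq_norm] at hw
    constructor
    · have h1 := (Complex.abs_re_le_norm (w - ⟨s, z.im⟩)).trans_lt hw
      rw [Complex.sub_re, abs_lt] at h1
      simp only at h1
      linarith [h1.1]
    · intro hwr
      have h1 := (Complex.abs_im_le_norm (w - ⟨s, z.im⟩)).trans_lt hw
      have h2 := (Complex.abs_im_le_norm w).trans (hT₀ w hwr)
      rw [Complex.sub_im] at h1
      simp only at h1
      have h3 := abs_sub_abs_le_abs_sub z.im w.im
      rw [abs_sub_comm] at h3
      linarith
  have hD := hlow (fun z => (1 - laplace μ z).det) ⟨s, z.im⟩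
    (fun w hw => (analyticAt_det (analyticAt_one_sub_laplace hsupp hϑ
      (hball w hw).1)).differentiableAt.differentiableWithinAt)
    (fun w hw => det_ne_zero_of_notMem hsupp hϑ (hball w hw).1 (hball w hw).2)
    (fun w hw => norm_det_le (hx w (hball w hw).1.le)) (hy _ rfl) z (by
      have : z - ⟨s, z.im⟩ = ((z.re - s : ℝ) : ℂ) := by
        apply Complex.ext <;> simp
      rw [this, Complex.norm_real, Real.norm_eq_abs, abs_of_nonpos (by linarith)]
      linarith)
  rw [inv_apply_eq, norm_mul, norm_inv]
  have := norm_adjugate_le hx1 (hx z (hσ.le.trans hz1)) i j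
  gcongr

/-- The resolvent is a sum of principal parts and of a function that is holomorphic to the right
of `ϑ` and bounded in strips. -/
theorem exists_resolvent_decomposition [∀ i j, SFinite (μ i j)]
    (hsupp : ∀ i j, μ i j (Set.Iio 0) = 0)
    (hϑ : (ϑ : ℂ) ∈ laplaceDomain μ) (hfin : (rootsAbove μ ϑ).Finite) {s σ : ℝ} (hσ : ϑ < σ)
    (hσs : σ ≤ s) (hsum : Summable fun n => laplace μ (s : ℂ) ^ n) (i j : Fin p) :
    ∃ (A : ℂ → ℕ → ℂ) (R : ℂ → ℂ), DifferentiableOn ℂ R {z | ϑ < z.re} ∧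
      (∃ C, ∀ z : ℂ, σ ≤ z.re → z.re ≤ s → ‖R z‖ ≤ C) ∧
      ∀ z, z ∉ rootsAbove μ ϑ → (1 - laplace μ z)⁻¹ i j = R z +
        ∑ l ∈ hfin.toFinset, ∑ k ∈ Finset.range (poleOrder μ l),
          A l k * ((z - l) ^ (k + 1))⁻¹ := by
  obtain ⟨A, R, hR, hAR⟩ := exists_regularPart (F := fun z => (1 - laplace μ z)⁻¹ i j)
    (O := {z : ℂ | ϑ < z.re}) hfin.toFinset (poleOrder μ) (fun z hz hzS => by
      have hdet := det_ne_zero_of_notMem hsupp hϑ hz (by simpa using hzS)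
      have hent := analyticAt_one_sub_laplace hsupp hϑ hz
      simp only [inv_apply_eq]
      exact (((analyticAt_det hent).inv hdet).mul (analyticAt_adjugate hent i j)).differentiableAt)
    (fun l hl => poleOrder_spec hsupp hϑ hfin ((hfin.mem_toFinset.1 hl).2) i j)
  refine ⟨A, R, hR, ?_, fun z hz => hAR z (by simpa using hz)⟩
  obtain ⟨T, C, hTC⟩ := exists_resolvent_bound hsupp hϑ hfin hσ hσs hsum
  obtain ⟨T₀, hT₀⟩ := hfin.isBounded.exists_norm_le
  -- Up to the height `max T (T₀ + 1)` compactness bounds `R`; above it the resolvent is bounded and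
  -- all poles are at distance at least one.
  have hK : IsCompact (Set.Icc σ s ×ℂ Set.Icc (-(max T (T₀ + 1))) (max T (T₀ + 1))) :=
    isCompact_Icc.reProdIm isCompact_Icc
  obtain ⟨C', hC'⟩ := hK.exists_bound_of_continuousOn (f := R) (hR.continuousOn.mono fun z hz =>
    hσ.trans_le hz.1.1)
  refine ⟨max C' (C + ∑ l ∈ hfin.toFinset, ∑ k ∈ Finset.range (poleOrder μ l), ‖A l k‖),
    fun z hz1 hz2 => ?_⟩
  by_cases hzT : |z.im| ≤ max T (T₀ + 1)
  · exact (hC' z ⟨⟨hz1, hz2⟩, abs_le.1 hzT⟩).trans (le_max_left _ _)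
  · rw [not_le, max_lt_iff] at hzT
    refine le_trans ?_ (le_max_right _ _)
    have hzr : ∀ l ∈ rootsAbove μ ϑ, 1 ≤ ‖z - l‖ := by
      intro l hl
      have h1 := (Complex.abs_im_le_norm l).trans (hT₀ l hl)
      have h2 := Complex.abs_im_le_norm (z - l)
      rw [Complex.sub_im] at h2
      have h3 := abs_sub_abs_le_abs_sub z.im l.im
      linarith [hzT.2]
    have hzn : z ∉ rootsAbove μ ϑ := fun h => by
      have := hzr z h
      norm_num at this
    have h1 := hAR z (by simpa using hzn)
    rw [← sub_eq_iff_eq_add] at h1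
    rw [← h1]
    refine (norm_sub_le _ _).trans (add_le_add (hTC z hz1 hz2 hzT.1.le i j) ?_)
    refine (norm_sum_le _ _).trans (Finset.sum_le_sum fun l hl => ?_)
    refine (norm_sum_le _ _).trans (Finset.sum_le_sum fun k _ => ?_)
    rw [norm_mul, norm_inv, norm_pow]
    exact mul_le_of_le_one_right (norm_nonneg _)
      (inv_le_one_of_one_le₀ (one_le_pow₀ (hzr l (hfin.mem_toFinset.1 hl))))

end Resolvent

end CMJ

/-! ### Laplace inversion for the integrated distribution function. -/

namespace CMJ

section Inversion

theorem integrableOn_pow_mul_exp_neg (k : ℕ) {r : ℝ} (hr : 0 < r) :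
    IntegrableOn (fun x : ℝ => x ^ k * Real.exp (-r * x)) (Set.Ioi 0) := by
  have := integrableOn_rpow_mul_exp_neg_mul_rpow (p := 1) (s := k) (b := r)
    (by have : (0 : ℝ) ≤ k := k.cast_nonneg
        linarith) one_pos hr
  simpa only [Real.rpow_natCast, Real.rpow_one] using this

theorem integrableOn_pow_mul_cexp_neg (k : ℕ) {w : ℂ} (hw : 0 < w.re) :
    IntegrableOn (fun x : ℝ => (x : ℂ) ^ k * Complex.exp (-w * x)) (Set.Ioi 0) := by
  refine Integrable.mono' (integrableOn_pow_mul_exp_neg k hw) (by fun_prop) ?_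
  refine (ae_restrict_iff' measurableSet_Ioi).2 (ae_of_all _ fun x hx => ?_)
  rw [norm_mul, norm_exp_neg_mul, norm_pow, Complex.norm_real, Real.norm_of_nonneg (le_of_lt hx)]

theorem tendsto_pow_mul_cexp_neg (k : ℕ) {w : ℂ} (hw : 0 < w.re) :
    Tendsto (fun x : ℝ => (x : ℂ) ^ k * Complex.exp (-w * x)) atTop (𝓝 0) := by
  rw [tendsto_zero_iff_norm_tendsto_zero]
  have h2 := (tendsto_rpow_mul_exp_neg_mul_atTop_nhds_zero (k : ℝ) w.re hw)
  refine h2.congr' ?_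
  filter_upwards [eventually_ge_atTop 0] with x hx
  rw [norm_mul, norm_exp_neg_mul, norm_pow, Complex.norm_real, Real.norm_of_nonneg hx,
    Real.rpow_natCast]

/-- The Laplace transform of `x ^ k`. -/
theorem integral_pow_mul_cexp_neg (k : ℕ) {w : ℂ} (hw : 0 < w.re) :
    ∫ x in Set.Ioi (0 : ℝ), (x : ℂ) ^ k * Complex.exp (-w * x) =
      k.factorial * (w ^ (k + 1))⁻¹ := by
  have hw0 : w ≠ 0 := fun h => by simp [h] at hw
  have hexp : ∀ x : ℝ, HasDerivAt (fun x : ℝ => Complex.exp (-w * x))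
      (Complex.exp (-w * x) * (-w)) x := fun x => by
    have h1 : HasDerivAt (fun x : ℝ => -w * (x : ℂ)) (-w) x := by
      simpa using (Complex.ofRealCLM.hasDerivAt (x := x)).const_mul (-w)
    exact h1.cexp
  induction k with
  | zero =>
    have h := integral_Ioi_of_hasDerivAt_of_tendsto' (a := (0 : ℝ)) (m := 0)
      (f := fun x : ℝ => Complex.exp (-w * x)) (fun x _ => hexp x)
      (by
        have := (integrableOn_pow_mul_cexp_neg 0 hw).mul_const (-w)
        simp only [pow_zero, one_mul] at this
        exact this)
      (by simpa using tendsto_pow_mul_cexp_neg 0 hw)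
    rw [integral_mul_const] at h
    simp only [pow_zero, one_mul, Nat.factorial_zero, Nat.cast_one, zero_add, pow_one]
    simp only [Complex.ofReal_zero, mul_zero, Complex.exp_zero] at h
    refine eq_inv_of_mul_eq_one_left ?_
    linear_combination -h
  | succ k ih =>
    have hd : ∀ x : ℝ, HasDerivAt (fun x : ℝ => (x : ℂ) ^ (k + 1) * Complex.exp (-w * x))
        ((k + 1 : ℂ) * ((x : ℂ) ^ k * Complex.exp (-w * x)) -
          w * ((x : ℂ) ^ (k + 1) * Complex.exp (-w * x))) x := fun x => by
      have h1 : HasDerivAt (fun x : ℝ => (x : ℂ) ^ (k + 1)) ((k + 1 : ℂ) * (x : ℂ) ^ k) x := by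
        exact ((Complex.ofRealCLM.hasDerivAt (x := x)).pow (k + 1)).congr_deriv (by simp)
      refine (h1.mul (hexp x)).congr_deriv ?_
      ring
    have i1 := (integrableOn_pow_mul_cexp_neg k hw).const_mul (k + 1 : ℂ)
    have i2 := (integrableOn_pow_mul_cexp_neg (k + 1) hw).const_mul w
    have h := integral_Ioi_of_hasDerivAt_of_tendsto' (a := (0 : ℝ)) (m := 0)
      (fun x _ => hd x) (i1.sub i2) (tendsto_pow_mul_cexp_neg (k + 1) hw)
    rw [integral_sub i1 i2, integral_const_mul, integral_const_mul, ih] at h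
    simp only [Complex.ofReal_zero, ne_eq, Nat.succ_ne_zero, not_false_eq_true, zero_pow, zero_mul,
      sub_zero] at h
    rw [Nat.factorial_succ]
    push_cast
    field_simp at h ⊢
    linear_combination -h

theorem norm_sq_vertical (σ η : ℝ) : ‖(σ : ℂ) + η * Complex.I‖ ^ 2 = σ ^ 2 + η ^ 2 := by
  rw [← Complex.normSq_eq_norm_sq, Complex.normSq_add_mul_I]

theorem vertical_ne_zero {σ : ℝ} (hσ : 0 < σ) (η : ℝ) : (σ : ℂ) + η * Complex.I ≠ 0 := by
  intro h
  have := congrArg Complex.re h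
  simp at this
  exact hσ.ne' this

theorem norm_inv_sq_vertical_le {σ : ℝ} (hσ : 0 < σ) (η : ℝ) :
    ‖(((σ : ℂ) + η * Complex.I) ^ 2)⁻¹‖ ≤ (min (σ ^ 2) 1)⁻¹ * (1 + η ^ 2)⁻¹ := by
  rw [norm_inv, norm_pow, norm_sq_vertical, ← mul_inv]
  have h1 : 0 < min (σ ^ 2) 1 := lt_min (by positivity) one_pos
  have h2 : min (σ ^ 2) 1 ≤ σ ^ 2 := min_le_left _ _
  have h3 : min (σ ^ 2) 1 ≤ 1 := min_le_right _ _
  refine inv_anti₀ (by positivity) ?_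
  nlinarith [sq_nonneg η]

theorem integrable_inv_sq_vertical {σ : ℝ} (hσ : 0 < σ) :
    Integrable fun η : ℝ => (((σ : ℂ) + η * Complex.I) ^ 2)⁻¹ := by
  refine Integrable.mono' (integrable_inv_one_add_sq.const_mul _) ?_
    (ae_of_all _ fun η => norm_inv_sq_vertical_le hσ η)
  refine Continuous.aestronglyMeasurable ?_
  exact Continuous.inv₀ (by fun_prop) fun η => pow_ne_zero _ (vertical_ne_zero hσ η)

/-- The ramp function as an inverse Laplace transform. -/
theorem ramp_eq_integral {s : ℝ} (hs : 0 < s) (x : ℝ) :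
    ((max x 0 : ℝ) : ℂ) = (2 * Real.pi : ℂ)⁻¹ * ∫ η : ℝ,
      Complex.exp (((s : ℂ) + η * Complex.I) * x) * (((s : ℂ) + η * Complex.I) ^ 2)⁻¹ := by
  -- The damped ramp is continuous and integrable, and its Fourier transform decays quadratically.
  -- Thus Fourier inversion holds at every point.
  let f : ℝ → ℂ := fun x => ((max x 0 : ℝ) : ℂ) * Complex.exp (-s * x)
  have hfc : Continuous f := by fun_prop
  have hf0 : ∀ x, x ∉ Set.Ioi (0 : ℝ) → f x = 0 := fun x hx => by
    simp [f, max_eq_right (not_lt.1 (Set.mem_Ioi.not.1 hx))]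
  have hfi : Integrable f := by
    rw [← integrableOn_iff_integrable_of_support_subset (s := Set.Ioi 0)
      (fun x hx => by_contra fun h => hx (hf0 x h))]
    refine (integrableOn_pow_mul_cexp_neg 1 (w := s) (by simpa using hs)).congr_fun
      (fun x hx => ?_) measurableSet_Ioi
    simp [f, max_eq_left (Set.mem_Ioi.1 hx).le]
  have hF : ∀ w : ℝ, FourierTransform.fourier f w =
      (((s : ℂ) + (2 * Real.pi * w : ℝ) * Complex.I) ^ 2)⁻¹ := by
    intro w
    rw [Real.fourier_real_eq_integral_exp_smul]
    rw [← setIntegral_eq_integral_of_forall_compl_eq_zero (s := Set.Ioi 0)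
      (fun x hx => by rw [hf0 x hx, smul_zero])]
    have := integral_pow_mul_cexp_neg 1 (w := (s : ℂ) + (2 * Real.pi * w : ℝ) * Complex.I)
      (by simpa using hs)
    simp only [Nat.factorial_one, Nat.cast_one, one_mul] at this
    rw [← this]
    refine setIntegral_congr_fun measurableSet_Ioi fun x hx => ?_
    simp only [f, max_eq_left (Set.mem_Ioi.1 hx).le, smul_eq_mul, pow_one]
    rw [mul_left_comm, ← Complex.exp_add]
    congr 2
    push_cast
    ring
  have hFi : Integrable (FourierTransform.fourier f) := by
    rw [funext hF]
    exact (integrable_inv_sq_vertical hs).comp_mul_left' (by positivity)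
  have hinv := congrFun (hfc.fourierInv_fourier_eq hfi hFi) x
  rw [Real.fourierInv_eq'] at hinv
  simp_rw [hF] at hinv
  have hsub := Measure.integral_comp_mul_left (fun η : ℝ => Complex.exp ((η * x : ℝ) * Complex.I) •
    (((s : ℂ) + (η : ℝ) * Complex.I) ^ 2)⁻¹) (2 * Real.pi)
  have hfx : f x = (2 * Real.pi : ℂ)⁻¹ * ∫ η : ℝ, Complex.exp ((η * x : ℝ) * Complex.I) *
    (((s : ℂ) + (η : ℝ) * Complex.I) ^ 2)⁻¹ := by
    rw [← hinv]
    refine Eq.trans ?_ (hsub.trans ?_)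
    · refine integral_congr_ae (ae_of_all _ fun v => ?_)
      simp only [RCLike.inner_apply, conj_trivial]
      congr 4
      ring
    · rw [abs_of_pos (by positivity), Complex.real_smul]
      push_cast
      rfl
  have hfx2 : ((max x 0 : ℝ) : ℂ) = Complex.exp (s * x) * f x := by
    simp only [f]
    rw [mul_left_comm, ← Complex.exp_add]
    simp
  rw [hfx2, hfx, mul_left_comm, ← integral_const_mul]
  congr 2
  ext η
  rw [← mul_assoc, ← Complex.exp_add]
  congr 2
  push_cast
  ring

/-- Laplace inversion for the integrated mass of a weighted measure. -/
theorem integral_ramp_eq {m : Measure ℝ} [SFinite m] {w : ℝ → ℂ} {s : ℝ} (hs : 0 < s)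
    (hw : Integrable (fun x : ℝ => Complex.exp (-(s : ℂ) * x) * w x) m) (t : ℝ) :
    ∫ x, ((max (t - x) 0 : ℝ) : ℂ) * w x ∂m = (2 * Real.pi : ℂ)⁻¹ * ∫ η : ℝ,
      Complex.exp (((s : ℂ) + η * Complex.I) * t) * (((s : ℂ) + η * Complex.I) ^ 2)⁻¹ *
        ∫ x, Complex.exp (-((s : ℂ) + η * Complex.I) * x) * w x ∂m := by
  -- For Fubini: up to a factor of modulus one, the integrand is a product of a function of `x` and
  -- a function of `η`.
  have hint : Integrable (Function.uncurry fun (x η : ℝ) =>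
      Complex.exp (((s : ℂ) + η * Complex.I) * ((t - x : ℝ) : ℂ)) *
        (((s : ℂ) + η * Complex.I) ^ 2)⁻¹ * w x) (m.prod volume) := by
    have h1 := hw.mul_prod ((integrable_inv_sq_vertical hs).const_mul (Complex.exp (s * t)))
    have h2 := h1.bdd_mul (c := 1)
      (f := fun q : ℝ × ℝ => Complex.exp ((q.2 * (t - q.1) : ℝ) * Complex.I))
      (by fun_prop) (ae_of_all _ fun q => by rw [Complex.norm_exp_ofReal_mul_I])
    refine h2.congr (ae_of_all _ fun q => ?_)
    simp only [Function.uncurry]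
    have : Complex.exp (((s : ℂ) + q.2 * Complex.I) * ((t - q.1 : ℝ) : ℂ)) =
        Complex.exp ((q.2 * (t - q.1) : ℝ) * Complex.I) * Complex.exp (-(s : ℂ) * q.1) *
          Complex.exp (s * t) := by
      rw [← Complex.exp_add, ← Complex.exp_add]
      congr 1
      push_cast
      ring
    rw [this]
    ring
  calc ∫ x, ((max (t - x) 0 : ℝ) : ℂ) * w x ∂m
      = ∫ x, (2 * Real.pi : ℂ)⁻¹ * (∫ η : ℝ,
          Complex.exp (((s : ℂ) + η * Complex.I) * ((t - x : ℝ) : ℂ)) *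
          (((s : ℂ) + η * Complex.I) ^ 2)⁻¹ * w x) ∂m := by
        refine integral_congr_ae (ae_of_all _ fun x => ?_)
        simp only
        rw [ramp_eq_integral hs, integral_mul_const, mul_assoc]
    _ = (2 * Real.pi : ℂ)⁻¹ * ∫ η : ℝ, ∫ x,
          Complex.exp (((s : ℂ) + η * Complex.I) * ((t - x : ℝ) : ℂ)) *
          (((s : ℂ) + η * Complex.I) ^ 2)⁻¹ * w x ∂m := by
        rw [integral_const_mul, integral_integral_swap hint]
    _ = _ := by
        congr 2
        ext η
        rw [← integral_const_mul]
        refine integral_congr_ae (ae_of_all _ fun x => ?_)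
        simp only
        have : Complex.exp (((s : ℂ) + η * Complex.I) * ((t - x : ℝ) : ℂ)) =
          Complex.exp (((s : ℂ) + η * Complex.I) * t) *
            Complex.exp (-((s : ℂ) + η * Complex.I) * x) := by
          rw [← Complex.exp_add]
          congr 1
          push_cast
          ring
        rw [this]
        ring

end Inversion

end CMJ

/-! ### Moving the contour and taking difference quotients. -/

namespace CMJ

section Contour

/-- Shifting a vertical line of integration through a strip in which the integrand is holomorphic
and decays quadratically. -/
theorem integral_vertical_eq {Q : ℂ → ℂ} {σ s C : ℝ} (hσs : σ ≤ s)
    (hQ : DifferentiableOn ℂ Q {z | σ ≤ z.re ∧ z.re ≤ s})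
    (hC : ∀ z : ℂ, σ ≤ z.re → z.re ≤ s → ‖Q z‖ ≤ C * (1 + z.im ^ 2)⁻¹) :
    ∫ η : ℝ, Q (s + η * Complex.I) = ∫ η : ℝ, Q (σ + η * Complex.I) := by
  have hint : ∀ r, σ ≤ r → r ≤ s → Integrable fun η : ℝ => Q (r + η * Complex.I) := by
    intro r h1 h2
    refine Integrable.mono' (integrable_inv_one_add_sq.const_mul C) ?_
      (ae_of_all _ fun η : ℝ => by
        simpa using hC ((r : ℂ) + η * Complex.I) (by simpa using h1) (by simpa using h2))
    refine Continuous.aestronglyMeasurable ?_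
    exact hQ.continuousOn.comp_continuous (by fun_prop) fun η => by simpa using ⟨h1, h2⟩
  have hlim : ∀ r, σ ≤ r → r ≤ s → Tendsto (fun T : ℝ => ∫ η in (-T)..T, Q (r + η * Complex.I))
      atTop (𝓝 (∫ η : ℝ, Q (r + η * Complex.I))) := fun r h1 h2 =>
    intervalIntegral_tendsto_integral (hint r h1 h2) tendsto_neg_atTop_atBot tendsto_id
  -- With `e T = T` and `e T = -T` this covers both horizontal sides of the rectangle, which vanish
  -- in the limit by the quadratic decay.
  have hhor : ∀ e : ℝ → ℝ, (∀ T, e T ^ 2 = T ^ 2) →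
      Tendsto (fun T : ℝ => ∫ x in σ..s, Q (x + e T * Complex.I)) atTop (𝓝 0) := by
    intro e he
    have hb : ∀ T : ℝ, ‖∫ x in σ..s, Q (x + e T * Complex.I)‖ ≤ C * (1 + T ^ 2)⁻¹ * |s - σ| := by
      intro T
      refine intervalIntegral.norm_integral_le_of_norm_le_const fun x hx => ?_
      rw [Set.uIoc_of_le hσs] at hx
      have := hC (x + e T * Complex.I) (by simpa using hx.1.le) (by simpa using hx.2)
      simpa [he] using this
    refine squeeze_zero_norm hb ?_
    have h1 : Tendsto (fun T : ℝ => 1 + T ^ 2) atTop atTop :=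
      tendsto_atTop_add_const_left _ _ (tendsto_pow_atTop two_ne_zero)
    have h2 := (h1.inv_tendsto_atTop.const_mul C).mul_const |s - σ|
    simpa using h2
  have hrect : ∀ T : ℝ, (∫ x in σ..s, Q (x + (-T : ℝ) * Complex.I)) -
      (∫ x in σ..s, Q (x + (T : ℝ) * Complex.I)) +
      Complex.I * (∫ η in (-T)..T, Q (s + η * Complex.I)) -
      Complex.I * (∫ η in (-T)..T, Q (σ + η * Complex.I)) = 0 := by
    intro T
    have := Complex.integral_boundary_rect_eq_zero_of_differentiableOn Q ⟨σ, -T⟩ ⟨s, T⟩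
      (hQ.mono fun z hz => by
        have h := hz.1
        simp only [Set.uIcc_of_le hσs] at h
        exact h)
    exact this
  have h1 := (((hhor (fun T => -T) fun T => by ring).sub (hhor (fun T => T) fun T => rfl)).add
    ((hlim s hσs le_rfl).const_mul Complex.I)).sub ((hlim σ le_rfl hσs).const_mul Complex.I)
  have h2 := tendsto_nhds_unique (h1.congr hrect) tendsto_const_nhds
  have h3 : Complex.I * ((∫ η : ℝ, Q (s + η * Complex.I)) - ∫ η : ℝ, Q (σ + η * Complex.I)) = 0 := by
    linear_combination h2
  exact sub_eq_zero.1 ((mul_eq_zero.1 h3).resolve_left Complex.I_ne_zero)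

/-- Interpolation between the bounds `2 * ‖w‖` for small and `2` for large `w`. An exponent strictly
below one is what later leaves an integrable weight on vertical lines. -/
theorem norm_one_sub_exp_neg_le {w : ℂ} (hw : 0 ≤ w.re) {e : ℝ} (he0 : 0 ≤ e) (he1 : e ≤ 1) :
    ‖1 - Complex.exp (-w)‖ ≤ 2 * ‖w‖ ^ e := by
  rcases le_total ‖w‖ 1 with h | h
  · have h1 : ‖1 - Complex.exp (-w)‖ ≤ 2 * ‖w‖ := by
      rw [norm_sub_rev]
      simpa using Complex.norm_exp_sub_one_le (x := -w) (by simpa using h)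
    have h2 : ‖w‖ ≤ ‖w‖ ^ e := by
      rcases (norm_nonneg w).eq_or_lt with h0 | h0
      · rw [← h0]
        exact Real.rpow_nonneg le_rfl _
      · simpa using Real.rpow_le_rpow_of_exponent_ge h0 h he1
    linarith
  · have h1 : ‖1 - Complex.exp (-w)‖ ≤ 1 + 1 := by
      refine (norm_sub_le _ _).trans (add_le_add (by simp) ?_)
      rw [Complex.norm_exp]
      simpa using hw
    have h2 := Real.one_le_rpow h he0
    linarith

theorem integrable_norm_vertical_rpow {σ e : ℝ} (hσ : 0 < σ) (he : 0 < e) :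
    Integrable fun η : ℝ => ‖(σ : ℂ) + η * Complex.I‖ ^ (-(1 + e)) := by
  have h0 : Integrable fun η : ℝ => (1 + ‖η‖ ^ 2) ^ (-(1 + e) / 2) :=
    integrable_rpow_neg_one_add_norm_sq (by simpa using he)
  have hc : 0 < min (σ ^ 2) 1 := lt_min (by positivity) one_pos
  refine Integrable.mono' (h0.const_mul ((min (σ ^ 2) 1) ^ (-(1 + e) / 2))) ?_
    (ae_of_all _ fun η => ?_)
  · refine Continuous.aestronglyMeasurable ?_
    exact Continuous.rpow_const (by fun_prop) fun η => Or.inl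
      (norm_ne_zero_iff.2 (vertical_ne_zero hσ η))
  · rw [Real.norm_of_nonneg (Real.rpow_nonneg (norm_nonneg _) _),
      ← Real.mul_rpow hc.le (by positivity)]
    have h1 : ‖(σ : ℂ) + η * Complex.I‖ = (σ ^ 2 + η ^ 2) ^ ((1 : ℝ) / 2) := by
      rw [← norm_sq_vertical, ← Real.sqrt_eq_rpow, Real.sqrt_sq (norm_nonneg _)]
    rw [h1, ← Real.rpow_mul (by positivity)]
    have h2 : (1 : ℝ) / 2 * -(1 + e) = -(1 + e) / 2 := by ring
    rw [h2]
    refine Real.rpow_le_rpow_of_nonpos (by positivity) ?_ (by linarith)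
    have h3 : min (σ ^ 2) 1 ≤ σ ^ 2 := min_le_left _ _
    have h4 : min (σ ^ 2) 1 ≤ 1 := min_le_right _ _
    rw [Real.norm_eq_abs, sq_abs]
    nlinarith [sq_nonneg η]

theorem integrable_line {σ C : ℝ} {B : ℝ → ℂ} (hσ : 0 < σ) (hB : Continuous B) (hC : ∀ η, ‖B η‖ ≤ C)
    (t : ℝ) : Integrable fun η : ℝ => Complex.exp (((σ : ℂ) + η * Complex.I) * t) *
      (((σ : ℂ) + η * Complex.I) ^ 2)⁻¹ * B η := by
  have h1 := (integrable_inv_sq_vertical hσ).bdd_mul (c := Real.exp (σ * t) * C)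
    (f := fun η : ℝ => Complex.exp (((σ : ℂ) + η * Complex.I) * t) * B η)
    ((Continuous.mul (by fun_prop) hB).aestronglyMeasurable) (ae_of_all _ fun η => by
      rw [norm_mul, Complex.norm_exp]
      gcongr
      · simp
      · exact hC η)
  refine h1.congr (ae_of_all _ fun η => ?_)
  simp only
  ring

/-- Difference quotients of the inverse Laplace transform of `R z / z ^ 2`, for bounded `R`. -/
theorem exists_norm_difference_le {R : ℂ → ℂ} {σ C e : ℝ} (hσ : 0 < σ) (he0 : 0 < e) (he1 : e ≤ 1)
    (hRc : Continuous fun η : ℝ => R (σ + η * Complex.I))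
    (hC : ∀ η : ℝ, ‖R (σ + η * Complex.I)‖ ≤ C) :
    ∃ K, 0 ≤ K ∧ ∀ t h : ℝ, 0 < h →
      ‖(∫ η : ℝ, Complex.exp (((σ : ℂ) + η * Complex.I) * t) *
          (((σ : ℂ) + η * Complex.I) ^ 2)⁻¹ * R (σ + η * Complex.I)) -
        ∫ η : ℝ, Complex.exp (((σ : ℂ) + η * Complex.I) * (t - h : ℝ)) *
          (((σ : ℂ) + η * Complex.I) ^ 2)⁻¹ * R (σ + η * Complex.I)‖ ≤
        h * (K * (h ^ (-e) * Real.exp (σ * t))) := by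
  have hC0 : 0 ≤ C := (norm_nonneg _).trans (hC 0)
  have hint : ∀ t : ℝ, Integrable fun η : ℝ => Complex.exp (((σ : ℂ) + η * Complex.I) * t) *
      (((σ : ℂ) + η * Complex.I) ^ 2)⁻¹ * R (σ + η * Complex.I) := integrable_line hσ hRc hC
  refine ⟨2 * C * ∫ η : ℝ, ‖(σ : ℂ) + η * Complex.I‖ ^ (-(1 + e)), ?_, fun t h hh => ?_⟩
  · exact mul_nonneg (by positivity) (integral_nonneg fun η => Real.rpow_nonneg (norm_nonneg _) _)
  rw [← integral_sub (hint t) (hint (t - h))]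
  -- The factor `1 - e^{-zh}` is bounded by `2 (‖z‖ h)^{1-e}`. Against `‖z‖^{-2}` this leaves the
  -- integrable weight `‖z‖^{-(1+e)}`, and dividing by `h` loses only `h^{-e}`.
  have hbound : ∀ η : ℝ, ‖Complex.exp (((σ : ℂ) + η * Complex.I) * t) *
          (((σ : ℂ) + η * Complex.I) ^ 2)⁻¹ * R (σ + η * Complex.I) -
        Complex.exp (((σ : ℂ) + η * Complex.I) * (t - h : ℝ)) *
          (((σ : ℂ) + η * Complex.I) ^ 2)⁻¹ * R (σ + η * Complex.I)‖ ≤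
      (2 * C * (h ^ (1 - e) * Real.exp (σ * t))) * ‖(σ : ℂ) + η * Complex.I‖ ^ (-(1 + e)) := by
    intro η
    set z : ℂ := (σ : ℂ) + η * Complex.I with hz
    have hzre : z.re = σ := by simp [hz]
    have hz0 : 0 < ‖z‖ := norm_pos_iff.2 (vertical_ne_zero hσ η)
    have h1 : Complex.exp (z * t) * (z ^ 2)⁻¹ * R z -
        Complex.exp (z * (t - h : ℝ)) * (z ^ 2)⁻¹ * R z =
        Complex.exp (z * t) * (1 - Complex.exp (-(z * h))) * (z ^ 2)⁻¹ * R z := by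
      have : Complex.exp (z * (t - h : ℝ)) = Complex.exp (z * t) * Complex.exp (-(z * h)) := by
        rw [← Complex.exp_add]
        congr 1
        push_cast
        ring
      rw [this]
      ring
    have h2 := norm_one_sub_exp_neg_le (w := z * h) (by
      rw [Complex.re_mul_ofReal, hzre]
      positivity) (e := 1 - e) (by linarith) (by linarith)
    rw [norm_mul, Complex.norm_real, Real.norm_of_nonneg hh.le,
      Real.mul_rpow hz0.le hh.le] at h2
    have h3 : ‖z‖ ^ (1 - e) * (‖z‖ ^ 2)⁻¹ = ‖z‖ ^ (-(1 + e)) := by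
      rw [← Real.rpow_natCast, ← Real.rpow_neg hz0.le, ← Real.rpow_add hz0]
      congr 1
      push_cast
      ring
    rw [h1, norm_mul, norm_mul, norm_mul, Complex.norm_exp, Complex.re_mul_ofReal, hzre, norm_inv,
      norm_pow, ← h3]
    calc Real.exp (σ * t) * ‖1 - Complex.exp (-(z * h))‖ * (‖z‖ ^ 2)⁻¹ * ‖R z‖
        ≤ Real.exp (σ * t) * (2 * (‖z‖ ^ (1 - e) * h ^ (1 - e))) * (‖z‖ ^ 2)⁻¹ * C := by
          gcongr
          exact hC η
      _ = _ := by ring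
  have hI := (integrable_norm_vertical_rpow hσ he0).const_mul
    (2 * C * (h ^ (1 - e) * Real.exp (σ * t)))
  refine (norm_integral_le_of_norm_le hI (ae_of_all _ hbound)).trans (le_of_eq ?_)
  rw [integral_const_mul]
  have h4 : h ^ (1 - e) = h * h ^ (-e) := by
    rw [sub_eq_add_neg, Real.rpow_add hh, Real.rpow_one]
  rw [h4]
  ring

end Contour

end CMJ

/-! ### Exponential polynomials and ramps. -/

namespace CMJ

section ExponentialPolynomial

/-- The exponential polynomial with Laplace transform `∑ A l k / (z - l) ^ (k + 1)`. -/
noncomputable def expPoly (S : Finset ℂ) (n : ℂ → ℕ) (A : ℂ → ℕ → ℂ) (x : ℝ) : ℂ :=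
  ∑ l ∈ S, ∑ k ∈ Finset.range (n l), A l k / k.factorial * ((x : ℂ) ^ k * Complex.exp (l * x))

variable {S : Finset ℂ} {n : ℂ → ℕ} {A : ℂ → ℕ → ℂ}

theorem continuous_expPoly : Continuous (expPoly S n A) := by
  unfold expPoly
  fun_prop

/-- The inequality `x^k / k! ≤ e^x` absorbs all powers at the price of one unit in the exponent. -/
theorem norm_expPoly_le {s x : ℝ} (hS : ∀ l ∈ S, l.re < s) (hx : 0 ≤ x) :
    ‖expPoly S n A x‖ ≤
      (∑ l ∈ S, ∑ k ∈ Finset.range (n l), ‖A l k‖) * Real.exp ((s + 1) * x) := by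
  unfold expPoly
  rw [Finset.sum_mul]
  refine (norm_sum_le _ _).trans (Finset.sum_le_sum fun l hl => ?_)
  rw [Finset.sum_mul]
  refine (norm_sum_le _ _).trans (Finset.sum_le_sum fun k _ => ?_)
  rw [norm_mul, norm_div, norm_mul, norm_pow, Complex.norm_real, Real.norm_of_nonneg hx,
    Complex.norm_exp, Complex.norm_natCast, Complex.re_mul_ofReal]
  have h1 := Real.pow_div_factorial_le_exp x hx k
  have h2 : Real.exp (l.re * x) ≤ Real.exp (s * x) :=
    Real.exp_le_exp.2 (mul_le_mul_of_nonneg_right (hS l hl).le hx)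
  have h3 : Real.exp ((s + 1) * x) = Real.exp x * Real.exp (s * x) := by
    rw [← Real.exp_add]
    congr 1
    ring
  rw [h3]
  calc ‖A l k‖ / k.factorial * (x ^ k * Real.exp (l.re * x))
      = ‖A l k‖ * (x ^ k / k.factorial * Real.exp (l.re * x)) := by ring
    _ ≤ _ := by gcongr

theorem laplace_expPoly {z : ℂ} (hz : ∀ l ∈ S, l.re < z.re) :
    IntegrableOn (fun x : ℝ => Complex.exp (-z * x) * expPoly S n A x) (Set.Ioi 0) ∧
    ∫ x in Set.Ioi (0 : ℝ), Complex.exp (-z * x) * expPoly S n A x =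
      ∑ l ∈ S, ∑ k ∈ Finset.range (n l), A l k * ((z - l) ^ (k + 1))⁻¹ := by
  have hfun : (fun x : ℝ => Complex.exp (-z * x) * expPoly S n A x) = fun x : ℝ =>
      ∑ l ∈ S, ∑ k ∈ Finset.range (n l), A l k / k.factorial *
        ((x : ℂ) ^ k * Complex.exp (-(z - l) * x)) := by
    ext x
    rw [expPoly, Finset.mul_sum]
    refine Finset.sum_congr rfl fun l _ => ?_
    rw [Finset.mul_sum]
    refine Finset.sum_congr rfl fun k _ => ?_
    have : Complex.exp (-(z - l) * x) = Complex.exp (-z * x) * Complex.exp (l * x) := by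
      rw [← Complex.exp_add]
      congr 1
      ring
    rw [this]
    ring
  have hre : ∀ l ∈ S, 0 < (z - l).re := fun l hl => by
    rw [Complex.sub_re]
    exact sub_pos.2 (hz l hl)
  have hI : ∀ l ∈ S, ∀ k, IntegrableOn (fun x : ℝ => A l k / k.factorial *
      ((x : ℂ) ^ k * Complex.exp (-(z - l) * x))) (Set.Ioi 0) := fun l hl k =>
    (integrableOn_pow_mul_cexp_neg k (hre l hl)).const_mul _
  rw [hfun]
  refine ⟨integrable_finsetSum _ fun l hl => integrable_finsetSum _ fun k _ => hI l hl k, ?_⟩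
  rw [integral_finsetSum _ fun l hl => integrable_finsetSum _ fun k _ => hI l hl k]
  refine Finset.sum_congr rfl fun l hl => ?_
  rw [integral_finsetSum _ fun k _ => hI l hl k]
  refine Finset.sum_congr rfl fun k _ => ?_
  rw [integral_const_mul, integral_pow_mul_cexp_neg k (hre l hl)]
  have : (k.factorial : ℂ) ≠ 0 := by exact_mod_cast k.factorial_ne_zero
  field_simp

end ExponentialPolynomial

section Ramp

/-- The ramp of width `h`: it vanishes on `(-∞, 0]` and equals `1` on `[h, ∞)`. -/
noncomputable def ramp (h y : ℝ) : ℝ := (max y 0 - max (y - h) 0) / h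

theorem ramp_nonneg {h : ℝ} (hh : 0 < h) (y : ℝ) : 0 ≤ ramp h y := by
  refine div_nonneg (sub_nonneg.2 (max_le_max_right 0 ?_)) hh.le
  linarith

theorem ramp_le_one {h : ℝ} (hh : 0 < h) (y : ℝ) : ramp h y ≤ 1 := by
  rw [ramp, div_le_one hh, sub_le_iff_le_add]
  refine max_le ?_ ?_
  · linarith [le_max_left (y - h) 0]
  · linarith [le_max_right (y - h) 0]

theorem ramp_of_nonpos {h y : ℝ} (hh : 0 < h) (hy : y ≤ 0) : ramp h y = 0 := by
  rw [ramp, max_eq_right hy, max_eq_right (by linarith)]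
  simp

theorem ramp_of_le {h y : ℝ} (hh : 0 < h) (hy : h ≤ y) : ramp h y = 1 := by
  rw [ramp, max_eq_left (by linarith), max_eq_left (by linarith)]
  field_simp
  ring

theorem continuous_ramp (h : ℝ) : Continuous (ramp h) := by
  unfold ramp
  fun_prop

end Ramp

/-! ### From the smoothed distribution function to the distribution function. -/

section Renewal

theorem integrable_max_sub {U : Measure ℝ} (hU0 : U (Set.Iio 0) = 0)
    (hU : ∀ t, U (Set.Iic t) < ∞) (t : ℝ) : Integrable (fun x => max (t - x) 0) U := by
  have h1 : Integrable (Set.indicator (Set.Iic t) fun _ => |t|) U :=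
    (integrable_indicator_iff measurableSet_Iic).2 (integrableOn_const (hU t).ne)
  refine h1.mono' (by fun_prop) ?_
  filter_upwards [ae_nonneg_of_Iio hU0] with x hx
  rw [Real.norm_of_nonneg (le_max_right _ _)]
  by_cases hxt : x ≤ t
  · rw [Set.indicator_of_mem (show x ∈ Set.Iic t from hxt)]
    refine max_le ?_ (abs_nonneg _)
    linarith [le_abs_self t]
  · rw [Set.indicator_of_notMem (show x ∉ Set.Iic t from hxt), max_eq_right (by linarith)]

theorem integrable_ramp_sub {U : Measure ℝ} (hU0 : U (Set.Iio 0) = 0)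
    (hU : ∀ t, U (Set.Iic t) < ∞) (h t : ℝ) : Integrable (fun x => ramp h (t - x)) U := by
  have := ((integrable_max_sub hU0 hU t).sub (integrable_max_sub hU0 hU (t - h))).div_const h
  refine this.congr (ae_of_all _ fun x => ?_)
  simp only [ramp, Pi.sub_apply]
  rw [sub_right_comm]

/-- The ramps starting at `0` and shifted by `h` enclose the indicators of `x < t` and `x ≤ t`.
Having both the open and the closed half-line takes care of atoms. -/
theorem integral_ramp_le {U : Measure ℝ} (hU0 : U (Set.Iio 0) = 0)
    (hU : ∀ t, U (Set.Iic t) < ∞) {h : ℝ} (hh : 0 < h) (t : ℝ) :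
    ∫ x, ramp h (t - x) ∂U ≤ (U (Set.Iio t)).toReal ∧
      (U (Set.Iic t)).toReal ≤ ∫ x, ramp h (t + h - x) ∂U := by
  have hlt : U (Set.Iio t) ≠ ∞ := ((measure_mono Set.Iio_subset_Iic_self).trans_lt (hU t)).ne
  constructor
  · have h1 : ∫ x, Set.indicator (Set.Iio t) (fun _ => (1 : ℝ)) x ∂U = (U (Set.Iio t)).toReal := by
      rw [integral_indicator_const _ measurableSet_Iio]
      simp [Measure.real]
    rw [← h1]
    refine integral_mono (integrable_ramp_sub hU0 hU h t)
      ((integrable_indicator_iff measurableSet_Iio).2 (integrableOn_const hlt)) fun x => ?_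
    by_cases hx : x < t
    · rw [Set.indicator_of_mem (show x ∈ Set.Iio t from hx)]
      exact ramp_le_one hh _
    · rw [Set.indicator_of_notMem (show x ∉ Set.Iio t from hx), ramp_of_nonpos hh (by linarith)]
  · have h1 : ∫ x, Set.indicator (Set.Iic t) (fun _ => (1 : ℝ)) x ∂U = (U (Set.Iic t)).toReal := by
      rw [integral_indicator_const _ measurableSet_Iic]
      simp [Measure.real]
    rw [← h1]
    refine integral_mono ((integrable_indicator_iff measurableSet_Iic).2
      (integrableOn_const (hU t).ne)) (integrable_ramp_sub hU0 hU h (t + h)) fun x => ?_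
    by_cases hx : x ≤ t
    · rw [Set.indicator_of_mem (show x ∈ Set.Iic t from hx), ramp_of_le hh (by linarith)]
    · rw [Set.indicator_of_notMem (show x ∉ Set.Iic t from hx)]
      exact ramp_nonneg hh _

variable {U : Measure ℝ} {S : Finset ℂ} {n : ℂ → ℕ} {A : ℂ → ℕ → ℂ} {R : ℂ → ℂ} {σ s ϑ C : ℝ}

/-- The integrated difference between a measure and the exponential polynomial given by the
principal parts of its Laplace transform is an integral along a vertical line. -/
theorem integral_max_sub_expPoly [SFinite U] (hσ : 0 < σ) (hσs : σ ≤ s) (hϑσ : ϑ < σ)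
    (hU : Integrable (fun x : ℝ => Complex.exp (-(s : ℂ) * x)) U)
    (hS : ∀ l ∈ S, l.re < s) (hR : DifferentiableOn ℂ R {z | ϑ < z.re})
    (hC : ∀ z : ℂ, σ ≤ z.re → z.re ≤ s → ‖R z‖ ≤ C)
    (hdec : ∀ z : ℂ, z.re = s → ∫ x, Complex.exp (-z * (x : ℂ)) ∂U =
      R z + ∑ l ∈ S, ∑ k ∈ Finset.range (n l), A l k * ((z - l) ^ (k + 1))⁻¹) (t : ℝ) :
    ∫ x, ((max (t - x) 0 : ℝ) : ℂ) ∂U -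
      ∫ x in Set.Ioi (0 : ℝ), ((max (t - x) 0 : ℝ) : ℂ) * expPoly S n A x =
    (2 * Real.pi : ℂ)⁻¹ * ∫ η : ℝ, Complex.exp (((σ : ℂ) + η * Complex.I) * t) *
      (((σ : ℂ) + η * Complex.I) ^ 2)⁻¹ * R (σ + η * Complex.I) := by
  have hs : 0 < s := hσ.trans_le hσs
  have h1 := integral_ramp_eq (m := U) (w := fun _ => 1) hs (by simpa using hU) t
  have h2 := integral_ramp_eq (m := volume.restrict (Set.Ioi 0)) (w := expPoly S n A) hs
    (laplace_expPoly (z := s) (by simpa using hS)).1 t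
  simp only [mul_one] at h1
  have hre : ∀ η : ℝ, ((s : ℂ) + η * Complex.I).re = s := fun η => by simp
  have hlap : ∀ η : ℝ, ∫ x in Set.Ioi (0 : ℝ), Complex.exp (-((s : ℂ) + η * Complex.I) * x) *
      expPoly S n A x = ∑ l ∈ S, ∑ k ∈ Finset.range (n l),
        A l k * (((s : ℂ) + η * Complex.I - l) ^ (k + 1))⁻¹ := fun η =>
    (laplace_expPoly (by simpa [hre] using hS)).2
  simp_rw [hdec _ (hre _), mul_add] at h1
  simp_rw [hlap] at h2
  have hRc : ∀ r : ℝ, ϑ < r → Continuous fun η : ℝ => R (r + η * Complex.I) := fun r hr =>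
    hR.continuousOn.comp_continuous (by fun_prop) fun η => by simpa using hr
  have hne : ∀ l ∈ S, ∀ η : ℝ, (s : ℂ) + η * Complex.I - l ≠ 0 := by
    intro l hl η h0
    have := congrArg Complex.re h0
    simp only [Complex.sub_re, hre, Complex.zero_re] at this
    linarith [hS l hl]
  have hPc : Continuous fun η : ℝ => ∑ l ∈ S, ∑ k ∈ Finset.range (n l),
        A l k * (((s : ℂ) + η * Complex.I - l) ^ (k + 1))⁻¹ := by
    refine continuous_finsetSum _ fun l hl => continuous_finsetSum _ fun k _ => ?_
    exact continuous_const.mul (Continuous.inv₀ (by fun_prop) fun η => pow_ne_zero _ (hne l hl η))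
  have hPb : ∀ η : ℝ, ‖∑ l ∈ S, ∑ k ∈ Finset.range (n l),
        A l k * (((s : ℂ) + η * Complex.I - l) ^ (k + 1))⁻¹‖ ≤
        ∑ l ∈ S, ∑ k ∈ Finset.range (n l), ‖A l k‖ * ((s - l.re) ^ (k + 1))⁻¹ := by
    intro η
    refine (norm_sum_le _ _).trans (Finset.sum_le_sum fun l hl => ?_)
    refine (norm_sum_le _ _).trans (Finset.sum_le_sum fun k _ => ?_)
    rw [norm_mul, norm_inv, norm_pow]
    have h3 : 0 < s - l.re := sub_pos.2 (hS l hl)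
    have h4 : s - l.re ≤ ‖(s : ℂ) + η * Complex.I - l‖ := by
      refine le_trans ?_ (Complex.re_le_norm _)
      rw [Complex.sub_re, hre]
    gcongr
  have hi1 := integrable_line hs (hRc s (hϑσ.trans_le hσs))
    (fun η => hC _ (by rw [hre]; exact hσs) (hre η).le) t
  have hi2 := integrable_line hs hPc hPb t
  rw [integral_add hi1 hi2] at h1
  -- On `Re z = s` the principal parts cancel and only `R` is left, so the line can be moved to `Re
  -- z = σ`. As `0 < σ`, the double pole of `z⁻²` stays to its left.
  rw [h1, h2, mul_add, add_sub_cancel_right]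
  congr 1
  have hsub : {z : ℂ | σ ≤ z.re ∧ z.re ≤ s} ⊆ {z | ϑ < z.re} := fun z hz => hϑσ.trans_le hz.1
  have hC0 : 0 ≤ C := (norm_nonneg _).trans (hC s (by simpa using hσs) (by simp))
  refine integral_vertical_eq (Q := fun z => Complex.exp (z * t) * (z ^ 2)⁻¹ * R z)
    (C := Real.exp (s * |t|) * (min (σ ^ 2) 1)⁻¹ * C) hσs ?_ ?_
  · refine DifferentiableOn.mul (DifferentiableOn.mul (by fun_prop) ?_) (hR.mono hsub)
    refine DifferentiableOn.inv (by fun_prop) fun z hz => pow_ne_zero _ fun h0 => ?_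
    rw [h0] at hz
    exact absurd hz.1 (not_le.2 (by simpa using hσ))
  · intro z hz1 hz2
    have hz : z = (z.re : ℂ) + z.im * Complex.I := (Complex.re_add_im z).symm
    have hz0 : 0 < z.re := hσ.trans_le hz1
    have h3 := norm_inv_sq_vertical_le hz0 z.im
    rw [← hz] at h3
    have h4 : min (σ ^ 2) 1 ≤ min (z.re ^ 2) 1 := by gcongr
    have h5 : 0 < min (σ ^ 2) 1 := lt_min (by positivity) one_pos
    rw [norm_mul, norm_mul, Complex.norm_exp, Complex.re_mul_ofReal]
    have h6 : Real.exp (z.re * t) ≤ Real.exp (s * |t|) := by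
      refine Real.exp_le_exp.2 ?_
      calc z.re * t ≤ z.re * |t| := by gcongr; exact le_abs_self t
        _ ≤ s * |t| := by gcongr
    calc Real.exp (z.re * t) * ‖(z ^ 2)⁻¹‖ * ‖R z‖
        ≤ Real.exp (s * |t|) * ((min (σ ^ 2) 1)⁻¹ * (1 + z.im ^ 2)⁻¹) * C := by
          gcongr
          · exact h3.trans (by gcongr)
          · exact hC z hz1 hz2
      _ = _ := by ring

/-- The ramp and the indicator of `(0, t]` differ only within `[t - h, t + h]`. Both ends `τ = t`
and `τ = t + h` of the sandwich are covered. -/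
theorem norm_integral_ramp_expPoly_sub_le (hs : 0 ≤ s) (hS : ∀ l ∈ S, l.re < s) {t τ h : ℝ}
    (hh : 0 < h) (ht : 0 ≤ t) (h1 : t ≤ τ) (h2 : τ ≤ t + h) :
    ‖(∫ x in Set.Ioi (0 : ℝ), (ramp h (τ - x) : ℂ) * expPoly S n A x) -
      ∫ x in (0 : ℝ)..t, expPoly S n A x‖ ≤
    (∑ l ∈ S, ∑ k ∈ Finset.range (n l), ‖A l k‖) * Real.exp ((s + 1) * (t + h)) * (2 * h) := by
  set D := ∑ l ∈ S, ∑ k ∈ Finset.range (n l), ‖A l k‖ with hD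
  have hD0 : 0 ≤ D := Finset.sum_nonneg fun l _ => Finset.sum_nonneg fun k _ => norm_nonneg _
  have hc := continuous_expPoly (S := S) (n := n) (A := A)
  have e1 : ∫ x in Set.Ioi (0 : ℝ), (ramp h (τ - x) : ℂ) * expPoly S n A x =
      ∫ x in Set.Ioc (0 : ℝ) (t + h), (ramp h (τ - x) : ℂ) * expPoly S n A x := by
    refine setIntegral_eq_of_subset_of_forall_sdiff_eq_zero measurableSet_Ioi
      Set.Ioc_subset_Ioi_self fun x hx => ?_
    have : t + h < x := by
      by_contra h3
      exact hx.2 ⟨hx.1, not_lt.1 h3⟩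
    rw [ramp_of_nonpos hh (by linarith)]
    simp
  have e2 : ∫ x in (0 : ℝ)..t, expPoly S n A x = ∫ x in Set.Ioc (0 : ℝ) (t + h),
      Set.indicator (Set.Ioc 0 t) (expPoly S n A) x := by
    rw [intervalIntegral.integral_of_le ht, setIntegral_indicator measurableSet_Ioc]
    congr 2
    rw [eq_comm, Set.inter_eq_right]
    exact Set.Ioc_subset_Ioc_right (by linarith)
  have i1 : IntegrableOn (fun x => (ramp h (τ - x) : ℂ) * expPoly S n A x) (Set.Ioc 0 (t + h)) := by
    have : Continuous fun x => (ramp h (τ - x) : ℂ) * expPoly S n A x :=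
      (Complex.continuous_ofReal.comp ((continuous_ramp h).comp (by fun_prop))).mul hc
    exact this.integrableOn_Ioc
  have i2 : IntegrableOn (Set.indicator (Set.Ioc 0 t) (expPoly S n A)) (Set.Ioc 0 (t + h)) :=
    (hc.integrableOn_Ioc).indicator measurableSet_Ioc
  rw [e1, e2, ← integral_sub i1 i2]
  have hb : ∀ x ∈ Set.Ioc (0 : ℝ) (t + h), ‖(ramp h (τ - x) : ℂ) * expPoly S n A x -
      Set.indicator (Set.Ioc 0 t) (expPoly S n A) x‖ ≤
      Set.indicator (Set.Icc (t - h) (t + h)) (fun _ => D * Real.exp ((s + 1) * (t + h))) x := by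
    intro x hx
    have hle : ‖expPoly S n A x‖ ≤ D * Real.exp ((s + 1) * (t + h)) := by
      refine (norm_expPoly_le hS hx.1.le).trans ?_
      gcongr
      exact hx.2
    by_cases hxt : x < t - h
    · rw [Set.indicator_of_mem (show x ∈ Set.Ioc 0 t from ⟨hx.1, by linarith⟩),
        ramp_of_le hh (by linarith), Set.indicator_of_notMem (fun h3 => absurd h3.1 (not_le.2 hxt))]
      simp
    · rw [Set.indicator_of_mem (show x ∈ Set.Icc (t - h) (t + h) from ⟨not_lt.1 hxt, hx.2⟩)]
      refine le_trans ?_ hle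
      have h3 := ramp_nonneg hh (τ - x)
      have h4 := ramp_le_one hh (τ - x)
      by_cases h5 : x ∈ Set.Ioc 0 t
      · rw [Set.indicator_of_mem h5, ← sub_one_mul, norm_mul]
        refine mul_le_of_le_one_left (norm_nonneg _) ?_
        rw [← Complex.ofReal_one, ← Complex.ofReal_sub, Complex.norm_real, Real.norm_eq_abs, abs_le]
        constructor <;> linarith
      · rw [Set.indicator_of_notMem h5, sub_zero, norm_mul]
        refine mul_le_of_le_one_left (norm_nonneg _) ?_
        rw [Complex.norm_real, Real.norm_of_nonneg h3]
        exact h4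
  have hI : Integrable (Set.indicator (Set.Icc (t - h) (t + h))
      fun _ => D * Real.exp ((s + 1) * (t + h))) :=
    (integrable_indicator_iff measurableSet_Icc).2 (integrableOn_const (by simp))
  refine (norm_integral_le_of_norm_le hI.integrableOn
    ((ae_restrict_iff' measurableSet_Ioc).2 (ae_of_all _ hb))).trans ?_
  refine (setIntegral_le_integral hI (ae_of_all _ fun x => ?_)).trans ?_
  · exact Set.indicator_nonneg (fun _ _ => by positivity) x
  · rw [integral_indicator_const _ measurableSet_Icc, Measure.real, Real.volume_Icc,
      ENNReal.toReal_ofReal (by linarith), smul_eq_mul]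
    apply le_of_eq
    ring

/-- The distribution function of a measure whose Laplace transform has a meromorphic extension that
is bounded in a strip, up to its principal parts. -/
theorem exists_distribution_estimate [SFinite U] {θ : ℝ} (hσ : 0 < σ) (hσs : σ ≤ s) (hϑσ : ϑ < σ)
    (hσθ : σ < θ) (hU0 : U (Set.Iio 0) = 0)
    (hU : Integrable (fun x : ℝ => Complex.exp (-(s : ℂ) * x)) U)
    (hS : ∀ l ∈ S, l.re < s) (hR : DifferentiableOn ℂ R {z | ϑ < z.re})
    (hC : ∀ z : ℂ, σ ≤ z.re → z.re ≤ s → ‖R z‖ ≤ C)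
    (hdec : ∀ z : ℂ, z.re = s → ∫ x, Complex.exp (-z * (x : ℂ)) ∂U =
      R z + ∑ l ∈ S, ∑ k ∈ Finset.range (n l), A l k * ((z - l) ^ (k + 1))⁻¹) :
    ∃ K, 0 ≤ K ∧ ∀ t, 0 ≤ t → ∀ w : ℝ, (U (Set.Iio t)).toReal ≤ w → w ≤ (U (Set.Iic t)).toReal →
      ‖(w : ℂ) - ∫ x in (0 : ℝ)..t, expPoly S n A x‖ ≤ K * Real.exp (θ * t) := by
  have hs : 0 < s := hσ.trans_le hσs
  have hUf : ∀ t, U (Set.Iic t) < ∞ := measure_Iic_lt_top_of_lintegral_exp hs.le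
    (by simpa using integrable_exp_neg_mul_iff.1 hU)
  -- With `h = e^{-αt}` this choice gives `h^{-e} e^{σt} = e^{θt}`, while `h` compensates the growth
  -- `e^{(s+1)t}` of the exponential polynomial.
  set α := s + 1 + (θ - σ) with hα
  have hα0 : 0 < α := by linarith
  set e := (θ - σ) / α with he
  have he0 : 0 < e := div_pos (by linarith) hα0
  have he1 : e ≤ 1 := (div_le_one hα0).2 (by linarith)
  obtain ⟨K, hK0, hK⟩ := exists_norm_difference_le (R := R) hσ he0 he1
    (hR.continuousOn.comp_continuous (by fun_prop) fun η => by simpa using hϑσ)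
    (fun η => hC (σ + η * Complex.I) (by simp) (by simpa using hσs))
  set D := ∑ l ∈ S, ∑ k ∈ Finset.range (n l), ‖A l k‖ with hD
  have hD0 : 0 ≤ D := Finset.sum_nonneg fun l _ => Finset.sum_nonneg fun k _ => norm_nonneg _
  set E := (2 * Real.pi)⁻¹ * (K * Real.exp σ) + 2 * D * Real.exp (s + 1) with hE
  have hE0 : 0 ≤ E := by positivity
  refine ⟨3 * E, by positivity, fun t ht w hw1 hw2 => ?_⟩
  set h := Real.exp (-(α * t)) with hh
  have hh0 : 0 < h := Real.exp_pos _
  have hh1 : h ≤ 1 := Real.exp_le_one_iff.2 (by nlinarith)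
  have key : ∀ τ, t ≤ τ → τ ≤ t + h →
      ‖((∫ x, ramp h (τ - x) ∂U : ℝ) : ℂ) - ∫ x in (0 : ℝ)..t, expPoly S n A x‖ ≤
        E * Real.exp (θ * t) := by
    intro τ hτ1 hτ2
    have hdiff := hK τ h hh0
    have r1 := integral_max_sub_expPoly hσ hσs hϑσ hU hS hR hC hdec τ
    have r2 := integral_max_sub_expPoly hσ hσs hϑσ hU hS hR hC hdec (τ - h)
    have c1 : ((∫ x, ramp h (τ - x) ∂U : ℝ) : ℂ) = (∫ x, ((max (τ - x) 0 : ℝ) : ℂ) ∂U -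
        ∫ x, ((max (τ - h - x) 0 : ℝ) : ℂ) ∂U) / h := by
      rw [integral_complex_ofReal, integral_complex_ofReal, ← Complex.ofReal_sub,
        ← Complex.ofReal_div, ← integral_sub (integrable_max_sub hU0 hUf τ)
          (integrable_max_sub hU0 hUf (τ - h)), ← integral_div]
      simp only [ramp, sub_right_comm τ h]
    have hmax : ∀ τ : ℝ, IntegrableOn (fun x : ℝ => ((max (τ - x) 0 : ℝ) : ℂ) * expPoly S n A x)
        (Set.Ioi 0) := by
      intro τ
      have hcont : Continuous fun x : ℝ => ((max (τ - x) 0 : ℝ) : ℂ) * expPoly S n A x :=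
        Continuous.mul (by fun_prop) continuous_expPoly
      have h3 : IntegrableOn (fun x : ℝ => ((max (τ - x) 0 : ℝ) : ℂ) * expPoly S n A x)
        (Set.Ioc 0 |τ|) := hcont.integrableOn_Ioc
      refine h3.of_forall_sdiff_eq_zero measurableSet_Ioi fun x hx => ?_
      have : |τ| < x := by
        by_contra h4
        exact hx.2 ⟨hx.1, not_lt.1 h4⟩
      rw [max_eq_right (by linarith [le_abs_self τ])]
      simp
    have c2 : ∫ x in Set.Ioi (0 : ℝ), (ramp h (τ - x) : ℂ) * expPoly S n A x =
        ((∫ x in Set.Ioi (0 : ℝ), ((max (τ - x) 0 : ℝ) : ℂ) * expPoly S n A x) -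
        ∫ x in Set.Ioi (0 : ℝ), ((max (τ - h - x) 0 : ℝ) : ℂ) * expPoly S n A x) / h := by
      rw [← integral_sub (hmax τ) (hmax (τ - h)), ← integral_div]
      congr 1
      ext x
      simp only [ramp, sub_right_comm τ h]
      push_cast
      ring
    have hhC : (h : ℂ) ≠ 0 := by exact_mod_cast hh0.ne'
    have hA : ‖((∫ x, ramp h (τ - x) ∂U : ℝ) : ℂ) -
        ∫ x in Set.Ioi (0 : ℝ), (ramp h (τ - x) : ℂ) * expPoly S n A x‖ ≤
        (2 * Real.pi)⁻¹ * (K * (h ^ (-e) * Real.exp (σ * τ))) := by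
      have h3 : ((∫ x, ramp h (τ - x) ∂U : ℝ) : ℂ) -
        ∫ x in Set.Ioi (0 : ℝ), (ramp h (τ - x) : ℂ) * expPoly S n A x =
        (2 * Real.pi : ℂ)⁻¹ * ((∫ η : ℝ, Complex.exp (((σ : ℂ) + η * Complex.I) * τ) *
          (((σ : ℂ) + η * Complex.I) ^ 2)⁻¹ * R (σ + η * Complex.I)) -
        ∫ η : ℝ, Complex.exp (((σ : ℂ) + η * Complex.I) * (τ - h : ℝ)) *
          (((σ : ℂ) + η * Complex.I) ^ 2)⁻¹ * R (σ + η * Complex.I)) / h := by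
        rw [c1, c2, mul_sub, ← r1, ← r2]
        ring
      have h4 : ‖(2 * Real.pi : ℂ)⁻¹‖ = (2 * Real.pi)⁻¹ := by
        rw [norm_inv, norm_mul, Complex.norm_real, Real.norm_of_nonneg Real.pi_pos.le]
        simp
      rw [h3, norm_div, norm_mul, h4, Complex.norm_real, Real.norm_of_nonneg hh0.le,
        div_le_iff₀ hh0]
      calc _ ≤ (2 * Real.pi)⁻¹ * (h * (K * (h ^ (-e) * Real.exp (σ * τ)))) := by gcongr
        _ = _ := by ring
    have hB := norm_integral_ramp_expPoly_sub_le (n := n) (A := A) hs.le hS hh0 ht hτ1 hτ2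
    have b1 : h ^ (-e) * Real.exp (σ * τ) ≤ Real.exp σ * Real.exp (θ * t) := by
      rw [hh, ← Real.exp_mul, ← Real.exp_add, ← Real.exp_add]
      refine Real.exp_le_exp.2 ?_
      have h5 : α * e = θ - σ := mul_div_cancel₀ _ hα0.ne'
      have h6 : -(α * t) * -e = (θ - σ) * t := by rw [← h5]; ring
      rw [h6]
      nlinarith
    have b2 : Real.exp ((s + 1) * (t + h)) * h ≤ Real.exp (s + 1) * Real.exp (θ * t) := by
      rw [hh, ← Real.exp_add, ← Real.exp_add, ← hh]
      refine Real.exp_le_exp.2 ?_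
      rw [hα]
      nlinarith
    calc _ ≤ ‖((∫ x, ramp h (τ - x) ∂U : ℝ) : ℂ) -
          ∫ x in Set.Ioi (0 : ℝ), (ramp h (τ - x) : ℂ) * expPoly S n A x‖ +
          ‖(∫ x in Set.Ioi (0 : ℝ), (ramp h (τ - x) : ℂ) * expPoly S n A x) -
            ∫ x in (0 : ℝ)..t, expPoly S n A x‖ := norm_sub_le_norm_sub_add_norm_sub _ _ _
      _ ≤ (2 * Real.pi)⁻¹ * (K * (Real.exp σ * Real.exp (θ * t))) +
          2 * D * (Real.exp (s + 1) * Real.exp (θ * t)) := by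
        refine add_le_add (hA.trans (by gcongr)) (hB.trans ?_)
        calc _ = 2 * D * (Real.exp ((s + 1) * (t + h)) * h) := by ring
          _ ≤ _ := by gcongr
      _ = _ := by rw [hE]; ring
  -- The smoothed values at `t` and `t + h` enclose `w`, and both are close to the same integral of
  -- the exponential polynomial.
  have ka := key t le_rfl (by linarith)
  have kb := key (t + h) (by linarith) le_rfl
  obtain ⟨l1, -⟩ := integral_ramp_le hU0 hUf hh0 t
  obtain ⟨-, l2⟩ := integral_ramp_le hU0 hUf hh0 t
  set a := ∫ x, ramp h (t - x) ∂U with ha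
  set b := ∫ x, ramp h (t + h - x) ∂U with hb
  set G := ∫ x in (0 : ℝ)..t, expPoly S n A x with hG
  have hab : b - a ≤ E * Real.exp (θ * t) + E * Real.exp (θ * t) := by
    have h3 : ‖((b : ℝ) : ℂ) - (a : ℂ)‖ ≤ ‖(b : ℂ) - G‖ + ‖(a : ℂ) - G‖ := by
      rw [norm_sub_rev (a : ℂ) G]
      exact norm_sub_le_norm_sub_add_norm_sub _ _ _
    rw [← Complex.ofReal_sub, Complex.norm_real] at h3
    linarith [le_abs_self (b - a), Real.norm_eq_abs (b - a)]
  have hwa : ‖((w : ℝ) : ℂ) - (a : ℂ)‖ ≤ b - a := by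
    rw [← Complex.ofReal_sub, Complex.norm_real, Real.norm_of_nonneg (by linarith)]
    linarith
  have := norm_sub_le_norm_sub_add_norm_sub (w : ℂ) (a : ℂ) G
  linarith

end Renewal

end CMJ

/-! ### Convolution of the renewal measure with monotone functions. -/

namespace CMJ

section Monotone

variable {U : Measure ℝ} {G : ℝ → ℂ} {K θ : ℝ}

theorem integral_exp_neg_mul_Ioi (hθ : 0 < θ) (a : ℝ) :
    θ * ∫ x in Set.Ioi a, Real.exp (-θ * x) = Real.exp (-θ * a) := by
  rw [integral_exp_mul_Ioi (neg_lt_zero.2 hθ)]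
  field_simp

/-- An estimate for the distribution function carries over to all translated up-sets. -/
theorem norm_measure_upperSet_sub_le (hU0 : U (Set.Iio 0) = 0) (hUf : ∀ t, U (Set.Iic t) < ∞)
    (hθ : 0 < θ) (hK : ∀ t, 0 ≤ t → ∀ w : ℝ, (U (Set.Iio t)).toReal ≤ w →
      w ≤ (U (Set.Iic t)).toReal → ‖(w : ℂ) - ∫ x in (0 : ℝ)..t, G x‖ ≤ K * Real.exp (θ * t))
    {B : Set ℝ} (hB : IsUpperSet B) (hB0 : B ⊆ Set.Ici 0) (t : ℝ) :
    ‖((U {x | t - x ∈ B}).toReal : ℂ) - ∫ x in Set.Ioc 0 t, B.indicator (fun x => G (t - x)) x‖ ≤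
      K * Real.exp (θ * t) * (θ * ∫ x in B, Real.exp (-θ * x)) := by
  rcases B.eq_empty_or_nonempty with rfl | hne
  · simp
  -- An up-set is an open or closed half-line from `a`, so the measure in question lies between
  -- those of `Iio (t - a)` and `Iic (t - a)`; this is why the estimate is assumed for every
  -- intermediate `w`. At `t - a` it gains `e^{-θa}`, which is `θ` times the integral of `e^{-θx}`
  -- over `B`.
  set a := sInf B with ha
  have hbdd : BddBelow B := ⟨0, fun x hx => hB0 hx⟩
  have ha0 : 0 ≤ a := le_csInf hne fun x hx => hB0 hx
  have h1 : Set.Ioi a ⊆ B := fun x hx => by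
    obtain ⟨y, hy, hyx⟩ := exists_lt_of_csInf_lt hne hx
    exact hB hyx.le hy
  have h2 : B ⊆ Set.Ici a := fun x hx => csInf_le hbdd hx
  have hae : B =ᵐ[volume] Set.Ioi a :=
    (h2.eventuallyLE.trans Ioi_ae_eq_Ici.symm.le).antisymm h1.eventuallyLE
  rw [setIntegral_congr_set hae, integral_exp_neg_mul_Ioi hθ, mul_assoc, ← Real.exp_add]
  have hexp : θ * t + -θ * a = θ * (t - a) := by ring
  rw [hexp]
  have s1 : Set.Iio (t - a) ⊆ {x | t - x ∈ B} := fun x hx => h1 (by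
    have : x < t - a := hx
    show a < t - x
    linarith)
  have s2 : {x | t - x ∈ B} ⊆ Set.Iic (t - a) := fun x hx => by
    have h3 : a ≤ t - x := h2 hx
    show x ≤ t - a
    linarith
  have hind : ∫ x in Set.Ioc 0 t, B.indicator (fun x => G (t - x)) x =
      ∫ x in Set.Ioc 0 t, (Set.Ioi a).indicator (fun x => G (t - x)) x :=
    integral_congr_ae (ae_restrict_of_ae (indicator_ae_eq_of_ae_eq_set hae))
  rw [hind, setIntegral_indicator measurableSet_Ioi]
  rcases lt_or_ge t a with hta | hta
  · have h3 : U {x | t - x ∈ B} = 0 :=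
      measure_mono_null (s2.trans (Set.Iic_subset_Iio.2 (by linarith))) hU0
    have h4 : Set.Ioc 0 t ∩ Set.Ioi a = ∅ := by
      ext x
      simp only [Set.mem_inter_iff, Set.mem_Ioc, Set.mem_Ioi, Set.mem_empty_iff_false, iff_false]
      rintro ⟨⟨-, h5⟩, h6⟩
      linarith
    have hK0 : 0 ≤ K := by
      have h5 := (norm_nonneg _).trans (hK 0 le_rfl (U (Set.Iio 0)).toReal le_rfl
        (ENNReal.toReal_mono (hUf 0).ne (measure_mono Set.Iio_subset_Iic_self)))
      simpa using h5
    rw [h3, h4]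
    simp only [ENNReal.toReal_zero, Complex.ofReal_zero, Measure.restrict_empty,
      integral_zero_measure, sub_zero, norm_zero]
    positivity
  · have h4 : Set.Ioc 0 t ∩ Set.Ioi a = Set.Ioc a t := by
      ext x
      simp only [Set.mem_inter_iff, Set.mem_Ioc, Set.mem_Ioi]
      constructor
      · rintro ⟨⟨-, h5⟩, h6⟩
        exact ⟨h6, h5⟩
      · rintro ⟨h5, h6⟩
        exact ⟨⟨ha0.trans_lt h5, h6⟩, h5⟩
    have h5 : ∫ x in Set.Ioc a t, G (t - x) = ∫ x in (0 : ℝ)..(t - a), G x := by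
      rw [← intervalIntegral.integral_of_le hta, intervalIntegral.integral_comp_sub_left]
      simp
    rw [h4, h5]
    have hle := (hUf (t - a)).ne
    exact hK (t - a) (sub_nonneg.2 hta) _
      (ENNReal.toReal_mono (ne_top_of_le_ne_top hle (measure_mono s2)) (measure_mono s1))
      (ENNReal.toReal_mono hle (measure_mono s2))

theorem integrable_comp_sub_of_bounded (hU0 : U (Set.Iio 0) = 0) (hUf : ∀ t, U (Set.Iic t) < ∞)
    {g : ℝ → ℝ} (hg : Measurable g) (hg0 : ∀ x < 0, g x = 0) {t c : ℝ} (hc : ∀ x ≤ t, |g x| ≤ c) :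
    Integrable (fun x => g (t - x)) U := by
  have hc0 : 0 ≤ c := (abs_nonneg _).trans (hc t le_rfl)
  have h1 : Integrable (Set.indicator (Set.Iic t) fun _ => c) U :=
    (integrable_indicator_iff measurableSet_Iic).2 (integrableOn_const (hUf t).ne)
  refine h1.mono' (hg.comp (by fun_prop)).aestronglyMeasurable ?_
  filter_upwards [ae_nonneg_of_Iio hU0] with x hx
  by_cases hxt : x ≤ t
  · rw [Set.indicator_of_mem (show x ∈ Set.Iic t from hxt)]
    exact hc _ (by linarith)
  · rw [Set.indicator_of_notMem (show x ∉ Set.Iic t from hxt), hg0 _ (by linarith), norm_zero]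

theorem nonneg_of_monotone_of_eq_zero {g : ℝ → ℝ} (hg : Monotone g) (hg0 : ∀ x < 0, g x = 0)
    (x : ℝ) : 0 ≤ g x := by
  rw [← hg0 (min x 0 - 1) (by linarith [min_le_right x 0])]
  exact hg (by linarith [min_le_left x 0])

/-- An estimate for the distribution function carries over to convolutions with monotone
functions. -/
theorem norm_conv_monotone_sub_le (hU0 : U (Set.Iio 0) = 0) (hUf : ∀ t, U (Set.Iic t) < ∞)
    (hθ : 0 < θ) (hG : Continuous G) (hK : ∀ t, 0 ≤ t → ∀ w : ℝ, (U (Set.Iio t)).toReal ≤ w →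
      w ≤ (U (Set.Iic t)).toReal → ‖(w : ℂ) - ∫ x in (0 : ℝ)..t, G x‖ ≤ K * Real.exp (θ * t))
    {g : ℝ → ℝ} (hg : Monotone g) (hg0 : ∀ x < 0, g x = 0)
    (hgi : IntegrableOn (fun x => Real.exp (-θ * x) * g x) (Set.Ioi 0)) {t : ℝ} (ht : 0 ≤ t) :
    ‖((∫ x, g (t - x) ∂U : ℝ) : ℂ) - ∫ x in (0 : ℝ)..t, (g x : ℂ) * G (t - x)‖ ≤
      K * (θ * ∫ x in Set.Ioi 0, Real.exp (-θ * x) * g x) * Real.exp (θ * t) := by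
  have hgn := nonneg_of_monotone_of_eq_zero hg hg0
  have hgm : Measurable g := hg.measurable
  have hKe : 0 ≤ K * Real.exp (θ * t) := (norm_nonneg _).trans (hK t ht (U (Set.Iio t)).toReal le_rfl
        (ENNReal.toReal_mono (hUf t).ne (measure_mono Set.Iio_subset_Iic_self)))
  have hint : Integrable (fun x => g (t - x)) U :=
    integrable_comp_sub_of_bounded hU0 hUf hgm hg0 (c := g t) fun x hx => by
      rw [abs_of_nonneg (hgn x)]
      exact hg hx
  have hset : MeasurableSet {q : ℝ × ℝ | q.2 < g q.1} :=
    measurableSet_lt measurable_snd (hgm.comp measurable_fst)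
  -- Layer-cake formula. Levels above `g t` do not contribute, as `g` is monotone and `U` lives on
  -- the nonnegative half-line.
  have e1 : ((∫ x, g (t - x) ∂U : ℝ) : ℂ) =
      ∫ y in Set.Ioc 0 (g t), ((U {x | y < g (t - x)}).toReal : ℂ) := by
    rw [hint.integral_eq_integral_meas_lt (ae_of_all _ fun x => hgn _), integral_complex_ofReal]
    congr 1
    refine setIntegral_eq_of_subset_of_forall_sdiff_eq_zero measurableSet_Ioi
      Set.Ioc_subset_Ioi_self fun y hy => ?_
    have h1 : g t < y := by
      by_contra h3
      exact hy.2 ⟨hy.1, not_lt.1 h3⟩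
    have h2 : U {x | y < g (t - x)} = 0 := by
      refine measure_mono_null (fun x hx => ?_) hU0
      by_contra h3
      have h4 : 0 ≤ x := not_lt.1 h3
      have h5 : y < g (t - x) := hx
      linarith [hg (show t - x ≤ t by linarith)]
    rw [Measure.real, h2, ENNReal.toReal_zero]
  have hlayer : ∀ x ≤ t, ∀ c : ℂ, (g x : ℂ) * c =
      ∫ y in Set.Ioc 0 (g t), {q : ℝ × ℝ | q.2 < g q.1}.indicator (fun _ => c) (x, y) := by
    intro x hx c
    have h1 : ∀ y, {q : ℝ × ℝ | q.2 < g q.1}.indicator (fun _ => c) (x, y) =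
        (Set.Iio (g x)).indicator (fun _ => c) y := fun y => rfl
    simp_rw [h1]
    rw [setIntegral_indicator measurableSet_Iio, setIntegral_const]
    have h2 : volume.real (Set.Ioc 0 (g t) ∩ Set.Iio (g x)) = g x := by
      have h3 : Set.Ioo 0 (g x) = Set.Ioc 0 (g t) ∩ Set.Iio (g x) := by
        ext y
        simp only [Set.mem_Ioo, Set.mem_inter_iff, Set.mem_Ioc, Set.mem_Iio]
        constructor
        · rintro ⟨h4, h5⟩
          exact ⟨⟨h4, h5.le.trans (hg hx)⟩, h5⟩
        · rintro ⟨⟨h4, -⟩, h5⟩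
          exact ⟨h4, h5⟩
      rw [← h3, Measure.real, Real.volume_Ioo, sub_zero, ENNReal.toReal_ofReal (hgn x)]
    rw [h2, Complex.real_smul]
  have hGc : Continuous fun x => G (t - x) := hG.comp (by fun_prop)
  have hGi : IntegrableOn (fun x => G (t - x)) (Set.Ioc 0 t) := hGc.integrableOn_Ioc
  have hone : Integrable (fun _ : ℝ => (1 : ℂ)) (volume.restrict (Set.Ioc 0 (g t))) :=
    integrableOn_const (by simp)
  have hprod : Integrable (Function.uncurry fun x y : ℝ =>
      {q : ℝ × ℝ | q.2 < g q.1}.indicator (fun q => G (t - q.1)) (x, y))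
      ((volume.restrict (Set.Ioc 0 t)).prod (volume.restrict (Set.Ioc 0 (g t)))) := by
    have h1 := (hGi.mul_prod hone).indicator hset
    refine h1.congr (ae_of_all _ fun q => ?_)
    simp only [mul_one]
    rfl
  have e2 : ∫ x in (0 : ℝ)..t, (g x : ℂ) * G (t - x) = ∫ y in Set.Ioc 0 (g t),
      ∫ x in Set.Ioc 0 t, {x | y < g x}.indicator (fun x => G (t - x)) x := by
    rw [intervalIntegral.integral_of_le ht]
    have h1 : ∫ x in Set.Ioc 0 t, (g x : ℂ) * G (t - x) =
        ∫ x in Set.Ioc 0 t, ∫ y in Set.Ioc 0 (g t),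
          {q : ℝ × ℝ | q.2 < g q.1}.indicator (fun q => G (t - q.1)) (x, y) := by
      refine setIntegral_congr_fun measurableSet_Ioc fun x hx => ?_
      exact hlayer x hx.2 (G (t - x))
    rw [h1, integral_integral_swap hprod]
    rfl
  have hEi : Integrable (fun x => Real.exp (-θ * x)) (volume.restrict (Set.Ioi 0)) :=
    integrableOn_exp_mul_Ioi (neg_lt_zero.2 hθ) 0
  have hprod2 : Integrable (Function.uncurry fun x y : ℝ =>
      {q : ℝ × ℝ | q.2 < g q.1}.indicator (fun q => Real.exp (-θ * q.1)) (x, y))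
      ((volume.restrict (Set.Ioi 0)).prod (volume.restrict (Set.Ioc 0 (g t)))) := by
    have hone' : Integrable (fun _ : ℝ => (1 : ℝ)) (volume.restrict (Set.Ioc 0 (g t))) :=
      integrableOn_const (by simp)
    have h1 := (hEi.mul_prod hone').indicator hset
    refine h1.congr (ae_of_all _ fun q => ?_)
    simp only [mul_one]
    rfl
  have i2 : IntegrableOn (fun y => ∫ x in Set.Ioc 0 t, {x | y < g x}.indicator
      (fun x => G (t - x)) x) (Set.Ioc 0 (g t)) := hprod.integral_prod_right
  have i1 : IntegrableOn (fun y => ((U {x | y < g (t - x)}).toReal : ℂ)) (Set.Ioc 0 (g t)) := by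
    have hanti : AntitoneOn (fun y => (U {x | y < g (t - x)}).toReal) (Set.Ioi 0) := by
      intro y hy z hz hyz
      refine ENNReal.toReal_mono ?_ (measure_mono fun x hx => lt_of_le_of_lt hyz hx)
      refine ne_top_of_le_ne_top (hUf t).ne (measure_mono fun x hx => ?_)
      by_contra h3
      have h4 : t < x := not_le.1 h3
      have h5 : y < g (t - x) := hx
      rw [hg0 _ (by linarith)] at h5
      exact absurd hy (not_lt.2 h5.le)
    have hb : ∀ y ∈ Set.Ioc 0 (g t), ‖((U {x | y < g (t - x)}).toReal : ℂ)‖ ≤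
        (U (Set.Iic t)).toReal := by
      intro y hy
      rw [Complex.norm_real, Real.norm_of_nonneg ENNReal.toReal_nonneg]
      refine ENNReal.toReal_mono (hUf t).ne (measure_mono fun x hx => ?_)
      by_contra h3
      have h4 : t < x := not_le.1 h3
      have h5 : y < g (t - x) := hx
      rw [hg0 _ (by linarith)] at h5
      linarith [hy.1]
    have hm : AEMeasurable (fun y => (U {x | y < g (t - x)}).toReal)
        (volume.restrict (Set.Ioc 0 (g t))) :=
      aemeasurable_restrict_of_antitoneOn measurableSet_Ioc (hanti.mono Set.Ioc_subset_Ioi_self)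
    refine Integrable.mono' (integrableOn_const (C := (U (Set.Iic t)).toReal) (by simp))
      (Complex.measurable_ofReal.comp_aemeasurable hm).aestronglyMeasurable ?_
    exact (ae_restrict_iff' measurableSet_Ioc).2 (ae_of_all _ hb)
  rw [e1, e2, ← integral_sub i1 i2]
  -- Every superlevel set of `g` at a positive level is an up-set of nonnegative numbers.
  -- Integrating the bounds over the levels gives back at most the weighted integral of `g`.
  have hBy : ∀ y ∈ Set.Ioc 0 (g t), ‖((U {x | y < g (t - x)}).toReal : ℂ) -
      ∫ x in Set.Ioc 0 t, {x | y < g x}.indicator (fun x => G (t - x)) x‖ ≤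
      K * Real.exp (θ * t) * (θ * ∫ x in Set.Ioi 0,
        {q : ℝ × ℝ | q.2 < g q.1}.indicator (fun q => Real.exp (-θ * q.1)) (x, y)) := by
    intro y hy
    have hsub : {x | y < g x} ⊆ Set.Ici 0 := fun x hx => by
      by_contra h3
      have h5 : y < g x := hx
      rw [hg0 x (not_le.1 h3)] at h5
      linarith [hy.1]
    refine (norm_measure_upperSet_sub_le hU0 hUf hθ hK (B := {x | y < g x})
      (fun a b hab ha => lt_of_lt_of_le ha (hg hab)) hsub t).trans (le_of_eq ?_)
    congr 2
    have hms : MeasurableSet {x | y < g x} := measurableSet_lt measurable_const hgm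
    have h1 : ∫ x in Set.Ioi 0, {q : ℝ × ℝ | q.2 < g q.1}.indicator
        (fun q => Real.exp (-θ * q.1)) (x, y) =
        ∫ x in Set.Ioi 0, {x | y < g x}.indicator (fun x => Real.exp (-θ * x)) x := rfl
    rw [h1, ← setIntegral_congr_set Ioi_ae_eq_Ici.symm, setIntegral_indicator hms,
      Set.inter_eq_right.2 hsub]
  have i3 : IntegrableOn (fun y => ∫ x in Set.Ioi 0,
      {q : ℝ × ℝ | q.2 < g q.1}.indicator (fun q => Real.exp (-θ * q.1)) (x, y))
      (Set.Ioc 0 (g t)) := hprod2.integral_prod_right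
  refine (norm_integral_le_of_norm_le ((i3.const_mul θ).const_mul (K * Real.exp (θ * t)))
    ((ae_restrict_iff' measurableSet_Ioc).2 (ae_of_all _ hBy))).trans ?_
  rw [integral_const_mul, integral_const_mul, ← integral_integral_swap hprod2]
  have h6 : ∫ x in Set.Ioi 0, ∫ y in Set.Ioc 0 (g t), {q : ℝ × ℝ | q.2 < g q.1}.indicator
      (fun q => Real.exp (-θ * q.1)) (x, y) ≤ ∫ x in Set.Ioi 0, Real.exp (-θ * x) * g x := by
    refine integral_mono_ae hprod2.integral_prod_left hgi (ae_of_all _ fun x => ?_)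
    have h1 : ∀ y, {q : ℝ × ℝ | q.2 < g q.1}.indicator (fun q => Real.exp (-θ * q.1)) (x, y) =
        (Set.Iio (g x)).indicator (fun _ => Real.exp (-θ * x)) y := fun y => rfl
    simp only [h1]
    rw [setIntegral_indicator measurableSet_Iio, setIntegral_const, smul_eq_mul, mul_comm]
    refine mul_le_mul_of_nonneg_left ?_ (Real.exp_nonneg _)
    calc volume.real (Set.Ioc 0 (g t) ∩ Set.Iio (g x)) ≤ volume.real (Set.Ioo 0 (g x)) :=
          measureReal_mono (fun y hy => ⟨hy.1.1, hy.2⟩) (by simp)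
      _ = g x := by rw [Measure.real, Real.volume_Ioo, sub_zero, ENNReal.toReal_ofReal (hgn x)]
  calc _ ≤ K * Real.exp (θ * t) * (θ * ∫ x in Set.Ioi 0, Real.exp (-θ * x) * g x) := by gcongr
    _ = _ := by ring

end Monotone

end CMJ

/-! ### Functions of bounded variation as differences of monotone functions. -/

namespace CMJ

section BoundedVariation

variable {f : ℝ → ℝ} {θ : ℝ}

theorem eVariationOn_Iic_mono (f : ℝ → ℝ) : Monotone fun x => eVariationOn f (Set.Iic x) :=
  fun _ _ h => eVariationOn.mono f (Set.Iic_subset_Iic.2 h)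

/-- This increment bound is what makes the variation minus `f` monotone. -/
theorem eVariationOn_Iic_add_edist_le (f : ℝ → ℝ) {x y : ℝ} (h : x ≤ y) :
    eVariationOn f (Set.Iic x) + edist (f y) (f x) ≤ eVariationOn f (Set.Iic y) := by
  have h1 := eVariationOn.add_le_union f (s := Set.Iic x) (t := Set.Icc x y)
    fun a ha b hb => (show a ≤ x from ha).trans hb.1
  rw [Set.Iic_union_Icc_eq_Iic h] at h1
  refine le_trans (add_le_add_right ?_ _) h1
  exact eVariationOn.edist_le f ⟨h, le_rfl⟩ ⟨le_rfl, h⟩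

theorem eVariationOn_Iic_of_neg (hf0 : ∀ t < 0, f t = 0) {x : ℝ} (hx : x < 0) :
    eVariationOn f (Set.Iic x) = 0 := by
  refine eVariationOn.constant_on ?_
  rintro _ ⟨a, ha, rfl⟩ _ ⟨b, hb, rfl⟩
  rw [hf0 a (lt_of_le_of_lt ha hx), hf0 b (lt_of_le_of_lt hb hx)]

theorem lintegral_exp_mul_const_Ioi_eq_top (hθ : θ ≤ 0) {c : ℝ≥0∞} (hc : c ≠ 0) (a : ℝ) :
    ∫⁻ x in Set.Ioi (max a 0), ENNReal.ofReal (Real.exp (-θ * x)) * c = ∞ := by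
  refine top_le_iff.1 ?_
  calc (∞ : ℝ≥0∞) = ∫⁻ _ in Set.Ioi (max a 0), c := by
        rw [setLIntegral_const, Real.volume_Ioi, ENNReal.mul_top hc]
    _ ≤ _ := by
        refine setLIntegral_mono' measurableSet_Ioi fun x hx => ?_
        have hx0 : 0 < x := lt_of_le_of_lt (le_max_right _ _) hx
        refine le_mul_of_one_le_left zero_le ?_
        rw [← ENNReal.ofReal_one]
        exact ENNReal.ofReal_le_ofReal (Real.one_le_exp (by nlinarith))

/-- An infinite variation at `a` would persist at all larger points and make the integral infinite.
-/
theorem eVariationOn_Iic_lt_top (hvar : ∫⁻ x in Set.Ioi (0 : ℝ),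
      ENNReal.ofReal (Real.exp (-θ * x)) * eVariationOn f (Set.Iic x) < ∞) (a : ℝ) :
    eVariationOn f (Set.Iic a) < ∞ := by
  by_contra h
  rw [not_lt, top_le_iff] at h
  have h1 : ∫⁻ x in Set.Ioi (max a 0),
      ENNReal.ofReal (Real.exp (-θ * x)) * eVariationOn f (Set.Iic x) = ∞ := by
    have h2 : ∫⁻ x in Set.Ioi (max a 0),
        ENNReal.ofReal (Real.exp (-θ * x)) * eVariationOn f (Set.Iic x) =
        ∫⁻ _ in Set.Ioi (max a 0), ∞ := by
      refine setLIntegral_congr_fun measurableSet_Ioi fun x hx => ?_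
      have hax : a ≤ x := (le_max_left a 0).trans (le_of_lt hx)
      have h3 := eVariationOn_Iic_mono f hax
      simp only [h, top_le_iff] at h3
      simp only [h3]
      exact ENNReal.mul_top (by simp [Real.exp_pos])
    rw [h2, setLIntegral_const, Real.volume_Ioi]
    simp
  have h4 := lintegral_mono_set (μ := volume)
    (f := fun x => ENNReal.ofReal (Real.exp (-θ * x)) * eVariationOn f (Set.Iic x))
    (Set.Ioi_subset_Ioi (le_max_right a 0))
  rw [h1] at h4
  exact absurd (h4.trans_lt hvar) (lt_irrefl _)

theorem edist_le_eVariationOn_Iic (hf0 : ∀ t < 0, f t = 0) (x : ℝ) :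
    edist (f x) 0 ≤ eVariationOn f (Set.Iic x) := by
  have h1 : min x 0 - 1 < 0 := by linarith [min_le_right x 0]
  rw [← hf0 _ h1]
  refine eVariationOn.edist_le f Set.self_mem_Iic ?_
  show min x 0 - 1 ≤ x
  linarith [min_le_left x 0]

/-- For `θ ≤ 0` the weight is at least one on the half-line and the variation is nondecreasing, so a
single nonzero value of `f` would make the integral infinite. -/
theorem eq_zero_of_variation_of_nonpos (hf0 : ∀ t < 0, f t = 0) (hθ : θ ≤ 0)
    (hvar : ∫⁻ x in Set.Ioi (0 : ℝ),
      ENNReal.ofReal (Real.exp (-θ * x)) * eVariationOn f (Set.Iic x) < ∞) (a : ℝ) : f a = 0 := by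
  by_contra h
  have hc : eVariationOn f (Set.Iic a) ≠ 0 := fun h0 => by
    have := edist_le_eVariationOn_Iic hf0 a
    rw [h0] at this
    exact h (edist_le_zero.1 this)
  have h1 := lintegral_exp_mul_const_Ioi_eq_top hθ hc a
  have h2 : ∫⁻ x in Set.Ioi (max a 0), ENNReal.ofReal (Real.exp (-θ * x)) *
      eVariationOn f (Set.Iic a) ≤ ∫⁻ x in Set.Ioi (max a 0),
      ENNReal.ofReal (Real.exp (-θ * x)) * eVariationOn f (Set.Iic x) := by
    refine setLIntegral_mono' measurableSet_Ioi fun x hx => ?_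
    exact mul_le_mul_right (eVariationOn_Iic_mono f ((le_max_left a 0).trans (le_of_lt hx))) _
  have h4 := lintegral_mono_set (μ := volume)
    (f := fun x => ENNReal.ofReal (Real.exp (-θ * x)) * eVariationOn f (Set.Iic x))
    (Set.Ioi_subset_Ioi (le_max_right a 0))
  rw [h1] at h2
  exact absurd ((h2.trans h4).trans_lt hvar) (lt_irrefl _)

/-- A function of locally bounded variation is dominated by a monotone function such that the
difference is monotone as well. -/
theorem exists_monotone_majorant (hf0 : ∀ t < 0, f t = 0)
    (hvar : ∫⁻ x in Set.Ioi (0 : ℝ),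
      ENNReal.ofReal (Real.exp (-θ * x)) * eVariationOn f (Set.Iic x) < ∞) :
    ∃ v : ℝ → ℝ, Monotone v ∧ (∀ x < 0, v x = 0) ∧ (∀ x, |f x| ≤ v x) ∧
      (Monotone fun x => v x - f x) ∧
      IntegrableOn (fun x => Real.exp (-θ * x) * v x) (Set.Ioi 0) := by
  have hfin := eVariationOn_Iic_lt_top hvar
  have hmono : Monotone fun x => (eVariationOn f (Set.Iic x)).toReal := fun x y h =>
    ENNReal.toReal_mono (hfin y).ne (eVariationOn_Iic_mono f h)
  refine ⟨fun x => (eVariationOn f (Set.Iic x)).toReal, hmono, fun x hx => ?_, fun x => ?_, ?_, ?_⟩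
  · simp only [eVariationOn_Iic_of_neg hf0 hx, ENNReal.toReal_zero]
  · have h1 := ENNReal.toReal_mono (hfin x).ne (edist_le_eVariationOn_Iic hf0 x)
    rwa [← dist_edist, Real.dist_eq, sub_zero] at h1
  · intro x y h
    have h1 := ENNReal.toReal_mono (hfin y).ne (eVariationOn_Iic_add_edist_le f h)
    rw [ENNReal.toReal_add (hfin x).ne (edist_ne_top _ _), ← dist_edist, Real.dist_eq] at h1
    simp only
    linarith [le_abs_self (f y - f x)]
  · refine ⟨(Measurable.mul (by fun_prop) hmono.measurable).aestronglyMeasurable, ?_⟩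
    refine lt_of_le_of_lt (setLIntegral_mono' measurableSet_Ioi fun x _ => ?_) hvar
    rw [enorm_mul, Real.enorm_of_nonneg (Real.exp_nonneg _),
      Real.enorm_of_nonneg ENNReal.toReal_nonneg, ENNReal.ofReal_toReal (hfin x).ne]

end BoundedVariation

/-! ### Completing the integrals over [0, t] to moments. -/

section Tail

variable {f v : ℝ → ℝ} {θ : ℝ}

theorem pow_mul_exp_neg_le (k : ℕ) {δ y : ℝ} (hδ : 0 < δ) (hy : 0 ≤ y) :
    y ^ k * Real.exp (-(δ * y)) ≤ k.factorial / δ ^ k := by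
  have h1 := Real.pow_div_factorial_le_exp (δ * y) (by positivity) k
  have hk : (0 : ℝ) < k.factorial := by exact_mod_cast k.factorial_pos
  rw [div_le_iff₀ hk, mul_pow] at h1
  rw [le_div_iff₀ (by positivity), Real.exp_neg]
  have he := Real.exp_pos (δ * y)
  calc y ^ k * (Real.exp (δ * y))⁻¹ * δ ^ k = δ ^ k * y ^ k * (Real.exp (δ * y))⁻¹ := by ring
    _ ≤ Real.exp (δ * y) * k.factorial * (Real.exp (δ * y))⁻¹ := by gcongr
    _ = k.factorial := by field_simp

/-- With `δ = Re l - θ`, the exponential splits into `e^{-δ(x-t)}`, which absorbs the power of `x -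
t`, `e^{-δt}`, which gives the decay in `t`, and `e^{-θx}`, which is kept for the integral of `v`.
-/
theorem norm_shifted_moment_le (hfv : ∀ x, |f x| ≤ v x) {l : ℂ} (hl : θ < l.re) (k : ℕ) {t x : ℝ}
    (hx : t ≤ x) : ‖(f x : ℂ) * ((t : ℂ) - x) ^ k * Complex.exp (-l * x)‖ ≤
      k.factorial / (l.re - θ) ^ k * Real.exp (-(l.re - θ) * t) * (Real.exp (-θ * x) * v x) := by
  have h1 := pow_mul_exp_neg_le k (sub_pos.2 hl) (sub_nonneg.2 hx)
  have h2 : ‖(t : ℂ) - x‖ = x - t := by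
    rw [← Complex.ofReal_sub, Complex.norm_real, Real.norm_of_nonpos (by linarith)]
    ring
  have h3 : Real.exp (-l.re * x) = Real.exp (-((l.re - θ) * (x - t))) *
      (Real.exp (-(l.re - θ) * t) * Real.exp (-θ * x)) := by
    rw [← Real.exp_add, ← Real.exp_add]
    congr 1
    ring
  rw [norm_mul, norm_mul, norm_exp_neg_mul, norm_pow, h2, Complex.norm_real, Real.norm_eq_abs, h3]
  have hv : 0 ≤ v x := (abs_nonneg _).trans (hfv x)
  have hxt : 0 ≤ x - t := sub_nonneg.2 hx
  calc |f x| * (x - t) ^ k * (Real.exp (-((l.re - θ) * (x - t))) *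
      (Real.exp (-(l.re - θ) * t) * Real.exp (-θ * x)))
      = (x - t) ^ k * Real.exp (-((l.re - θ) * (x - t))) *
        (Real.exp (-(l.re - θ) * t) * (Real.exp (-θ * x) * |f x|)) := by ring
    _ ≤ k.factorial / (l.re - θ) ^ k *
        (Real.exp (-(l.re - θ) * t) * (Real.exp (-θ * x) * v x)) := by
        gcongr
        exact hfv x
    _ = _ := by ring

theorem integrableOn_shifted_moment (hf : Measurable f) (hfv : ∀ x, |f x| ≤ v x)
    (hv : IntegrableOn (fun x => Real.exp (-θ * x) * v x) (Set.Ioi 0)) {l : ℂ} (hl : θ < l.re)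
    (k : ℕ) {t : ℝ} (ht : 0 ≤ t) :
    IntegrableOn (fun x : ℝ => (f x : ℂ) * ((t : ℂ) - x) ^ k * Complex.exp (-l * x))
      (Set.Ioi t) := by
  have h1 := (hv.mono_set (Set.Ioi_subset_Ioi ht)).const_mul
    (k.factorial / (l.re - θ) ^ k * Real.exp (-(l.re - θ) * t))
  refine Integrable.mono' h1 ?_ ((ae_restrict_iff' measurableSet_Ioi).2
    (ae_of_all _ fun x hx => norm_shifted_moment_le hfv hl k (le_of_lt hx)))
  exact Measurable.aestronglyMeasurable (by fun_prop)

/-- Replacing the integrals over `[0, t]` by moments over `[0, ∞)`. -/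
theorem exists_moment_estimate (hf : Measurable f) (hfv : ∀ x, |f x| ≤ v x)
    (hv : IntegrableOn (fun x => Real.exp (-θ * x) * v x) (Set.Ioi 0)) {l : ℂ} (hl : θ < l.re)
    (k : ℕ) : ∃ C, 0 ≤ C ∧ ∀ t : ℝ, 0 ≤ t → ‖Complex.exp (l * t) *
      ((∫ x in (0 : ℝ)..t, (f x : ℂ) * ((t : ℂ) - x) ^ k * Complex.exp (-l * x)) -
        ∑ m ∈ Finset.range (k + 1), (t : ℂ) ^ m * (k.choose m *
          ∫ x in Set.Ioi (0 : ℝ), (f x : ℂ) * (-(x : ℂ)) ^ (k - m) * Complex.exp (-l * x)))‖ ≤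
      C * Real.exp (θ * t) := by
  have hv0 : ∀ x, 0 ≤ v x := fun x => (abs_nonneg _).trans (hfv x)
  have hδ : 0 < l.re - θ := sub_pos.2 hl
  have hmom : ∀ r : ℕ, IntegrableOn
      (fun x : ℝ => (f x : ℂ) * (-(x : ℂ)) ^ r * Complex.exp (-l * x)) (Set.Ioi 0) := fun r => by
    simpa using integrableOn_shifted_moment hf hfv hv hl r le_rfl
  set I := ∫ x in Set.Ioi (0 : ℝ), Real.exp (-θ * x) * v x with hI
  have hI0 : 0 ≤ I := integral_nonneg fun x => mul_nonneg (Real.exp_nonneg _) (hv0 x)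
  refine ⟨k.factorial / (l.re - θ) ^ k * I, by positivity, fun t ht => ?_⟩
  have hexpand : ∀ x : ℝ, (f x : ℂ) * ((t : ℂ) - x) ^ k * Complex.exp (-l * x) =
      ∑ m ∈ Finset.range (k + 1), (t : ℂ) ^ m * (k.choose m *
        ((f x : ℂ) * (-(x : ℂ)) ^ (k - m) * Complex.exp (-l * x))) := fun x => by
    rw [sub_eq_add_neg, add_pow, Finset.mul_sum, Finset.sum_mul]
    exact Finset.sum_congr rfl fun m _ => by ring
  have hterm : ∀ m : ℕ, IntegrableOn (fun x : ℝ => (t : ℂ) ^ m * (k.choose m *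
        ((f x : ℂ) * (-(x : ℂ)) ^ (k - m) * Complex.exp (-l * x)))) (Set.Ioi 0) := fun m =>
    ((hmom (k - m)).const_mul _).const_mul _
  have hall : IntegrableOn (fun x : ℝ => (f x : ℂ) * ((t : ℂ) - x) ^ k * Complex.exp (-l * x))
      (Set.Ioi 0) := by
    simp only [hexpand]
    exact integrable_finsetSum _ fun m _ => hterm m
  have h1 : ∑ m ∈ Finset.range (k + 1), (t : ℂ) ^ m * (k.choose m *
          ∫ x in Set.Ioi (0 : ℝ), (f x : ℂ) * (-(x : ℂ)) ^ (k - m) * Complex.exp (-l * x)) =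
      ∫ x in Set.Ioi (0 : ℝ), (f x : ℂ) * ((t : ℂ) - x) ^ k * Complex.exp (-l * x) := by
    simp only [hexpand]
    rw [integral_finsetSum _ fun m _ => hterm m]
    refine Finset.sum_congr rfl fun m _ => ?_
    rw [integral_const_mul, integral_const_mul]
  -- By the binomial theorem the subtracted moments add up to the integral over `(0, ∞)`, so the
  -- error is minus the tail over `(t, ∞)`.
  have h2 : ∫ x in Set.Ioi (0 : ℝ), (f x : ℂ) * ((t : ℂ) - x) ^ k * Complex.exp (-l * x) =
      (∫ x in (0 : ℝ)..t, (f x : ℂ) * ((t : ℂ) - x) ^ k * Complex.exp (-l * x)) +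
      ∫ x in Set.Ioi t, (f x : ℂ) * ((t : ℂ) - x) ^ k * Complex.exp (-l * x) := by
    rw [intervalIntegral.integral_of_le ht, ← setIntegral_union
      (Set.Ioc_disjoint_Ioi le_rfl) measurableSet_Ioi (hall.mono_set Set.Ioc_subset_Ioi_self)
      (hall.mono_set (Set.Ioi_subset_Ioi ht)), Set.Ioc_union_Ioi_eq_Ioi ht]
  have h3 : ‖∫ x in Set.Ioi t, (f x : ℂ) * ((t : ℂ) - x) ^ k * Complex.exp (-l * x)‖ ≤
      k.factorial / (l.re - θ) ^ k * Real.exp (-(l.re - θ) * t) * I := by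
    refine (norm_integral_le_of_norm_le ((hv.mono_set (Set.Ioi_subset_Ioi ht)).const_mul
      (k.factorial / (l.re - θ) ^ k * Real.exp (-(l.re - θ) * t)))
      ((ae_restrict_iff' measurableSet_Ioi).2 (ae_of_all _ fun x hx =>
        norm_shifted_moment_le hfv hl k (le_of_lt hx)))).trans ?_
    rw [integral_const_mul]
    gcongr
    exact setIntegral_mono_set hv (ae_of_all _ fun x => mul_nonneg (Real.exp_nonneg _) (hv0 x))
      (Set.Ioi_subset_Ioi ht).eventuallyLE
  rw [h1, h2, sub_add_cancel_left, mul_neg, norm_neg, norm_mul, Complex.norm_exp,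
    Complex.re_mul_ofReal]
  calc Real.exp (l.re * t) * _ ≤ Real.exp (l.re * t) *
        (k.factorial / (l.re - θ) ^ k * Real.exp (-(l.re - θ) * t) * I) := by gcongr
    _ = k.factorial / (l.re - θ) ^ k * I *
        (Real.exp (l.re * t) * Real.exp (-(l.re - θ) * t)) := by ring
    _ = _ := by
        rw [← Real.exp_add]
        congr 2
        ring

end Tail

/-! ### Symmetry of roots and pole orders under complex conjugation. -/

section Conjugation

variable {p : ℕ} {μ : Fin p → Fin p → Measure ℝ} {ϑ : ℝ}

theorem one_sub_laplace_conj (z : ℂ) :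
    1 - laplace μ (conj z) = (starRingEnd ℂ).mapMatrix (1 - laplace μ z) := by
  rw [map_sub, map_one]
  congr 1
  ext i j
  rw [laplace_conj]
  rfl

theorem conj_mem_rootsAbove {l : ℂ} (hl : l ∈ rootsAbove μ ϑ) : conj l ∈ rootsAbove μ ϑ := by
  refine ⟨⟨fun i j => ?_, ?_⟩, ?_⟩
  · simpa using hl.1.1 i j
  · rw [one_sub_laplace_conj, ← RingHom.map_det, hl.1.2, map_zero]
  · simpa using hl.2

theorem resolvent_conj (z : ℂ) (i j : Fin p) :
    (1 - laplace μ (conj z))⁻¹ i j = conj ((1 - laplace μ z)⁻¹ i j) := by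
  rw [inv_apply_eq, inv_apply_eq, one_sub_laplace_conj, ← RingHom.map_det, ← RingHom.map_adjugate]
  simp

theorem analyticAt_conj_comp_conj {g : ℂ → ℂ} {l : ℂ} (hg : AnalyticAt ℂ g l) :
    AnalyticAt ℂ (fun z => conj (g (conj z))) (conj l) := by
  rw [Complex.analyticAt_iff_eventually_differentiableAt] at hg ⊢
  have hc : Tendsto (fun z : ℂ => conj z) (𝓝 (conj l)) (𝓝 l) := by
    have := Complex.continuous_conj.tendsto (conj l)
    simpa using this
  filter_upwards [hc.eventually hg] with z hz
  have := hz.conj_conj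
  simpa [Function.comp_def] using this

/-- Conjugating the holomorphic extensions carries every admissible exponent at `l` to `conj l`; the
same at `conj l` gives the other inclusion. -/
theorem poleOrder_conj (l : ℂ) : poleOrder μ (conj l) = poleOrder μ l := by
  have key : ∀ l : ℂ, {n : ℕ | ∀ i j, ∃ g : ℂ → ℂ, AnalyticAt ℂ g l ∧
      ∀ᶠ z in 𝓝[≠] l, g z = (z - l) ^ n * ((1 - laplace μ z)⁻¹ : Matrix (Fin p) (Fin p) ℂ) i j} ⊆
      {n : ℕ | ∀ i j, ∃ g : ℂ → ℂ, AnalyticAt ℂ g (conj l) ∧ ∀ᶠ z in 𝓝[≠] (conj l),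
        g z = (z - conj l) ^ n * ((1 - laplace μ z)⁻¹ : Matrix (Fin p) (Fin p) ℂ) i j} := by
    intro l n hn i j
    obtain ⟨g, hg, hgn⟩ := hn i j
    refine ⟨fun z => conj (g (conj z)), analyticAt_conj_comp_conj hg, ?_⟩
    have hc : Tendsto (fun z : ℂ => conj z) (𝓝[≠] (conj l)) (𝓝[≠] l) := by
      refine tendsto_nhdsWithin_iff.2 ⟨?_, ?_⟩
      · have := Complex.continuous_conj.tendsto (conj l)
        rw [Complex.conj_conj] at this
        exact this.mono_left nhdsWithin_le_nhds
      · filter_upwards [self_mem_nhdsWithin] with z hz h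
        refine hz ?_
        have h2 : conj z = l := h
        rw [Set.mem_singleton_iff, ← h2, Complex.conj_conj]
    filter_upwards [hc.eventually hgn] with z hz
    rw [hz, map_mul, map_pow, map_sub, Complex.conj_conj, ← resolvent_conj, Complex.conj_conj]
  have h2 := key (conj l)
  rw [Complex.conj_conj] at h2
  exact congrArg sInf (Set.Subset.antisymm h2 (key l))

end Conjugation

end CMJ

/-! ### Convolution of the renewal measure with functions of bounded variation. -/

namespace CMJ

section Convolution

variable {U : Measure ℝ} {f v : ℝ → ℝ} {θ : ℝ}

theorem measurable_of_monotone_sub (hv : Monotone v) (hvf : Monotone fun x => v x - f x) :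
    Measurable f := by
  have h := hv.measurable.sub hvf.measurable
  have he : v - (fun x => v x - f x) = f := by
    ext x
    simp
  rwa [he] at h

theorem eq_zero_of_neg_of_abs_le (hv0 : ∀ x < 0, v x = 0) (hfv : ∀ x, |f x| ≤ v x) {x : ℝ}
    (hx : x < 0) : f x = 0 :=
  abs_nonpos_iff.1 ((hfv x).trans (hv0 x hx).le)

/-- The convolution estimate for differences of monotone functions. -/
theorem exists_conv_estimate {G : ℝ → ℂ} {K : ℝ} (hU0 : U (Set.Iio 0) = 0)
    (hUf : ∀ t, U (Set.Iic t) < ∞)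
    (hθ : 0 < θ) (hG : Continuous G) (hK : ∀ t, 0 ≤ t → ∀ w : ℝ, (U (Set.Iio t)).toReal ≤ w →
      w ≤ (U (Set.Iic t)).toReal → ‖(w : ℂ) - ∫ x in (0 : ℝ)..t, G x‖ ≤ K * Real.exp (θ * t))
    (hv : Monotone v) (hv0 : ∀ x < 0, v x = 0) (hfv : ∀ x, |f x| ≤ v x)
    (hvf : Monotone fun x => v x - f x)
    (hvi : IntegrableOn (fun x => Real.exp (-θ * x) * v x) (Set.Ioi 0)) :
    ∃ C : ℝ, ∀ t, 0 ≤ t → ‖((∫ x, f (t - x) ∂U : ℝ) : ℂ) -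
      ∫ x in (0 : ℝ)..t, (f x : ℂ) * G (t - x)‖ ≤ C * Real.exp (θ * t) := by
  set g : ℝ → ℝ := fun x => v x - f x with hg
  have hf := measurable_of_monotone_sub hv hvf
  have hg0 : ∀ x < 0, g x = 0 := fun x hx => by
    simp [hg, hv0 x hx, eq_zero_of_neg_of_abs_le hv0 hfv hx]
  have hgv : ∀ x, |g x| ≤ 2 * v x := fun x => by
    have h1 := abs_le.1 (hfv x)
    have h2 := (abs_nonneg _).trans (hfv x)
    rw [hg, abs_le]
    constructor <;> simp only <;> linarith
  have hgi : IntegrableOn (fun x => Real.exp (-θ * x) * g x) (Set.Ioi 0) := by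
    refine (Integrable.const_mul hvi 2).mono'
      (Measurable.mul (by fun_prop) hvf.measurable).aestronglyMeasurable (ae_of_all _ fun x => ?_)
    rw [norm_mul, Real.norm_of_nonneg (Real.exp_nonneg _), Real.norm_eq_abs]
    have := mul_le_mul_of_nonneg_left (hgv x) (Real.exp_nonneg (-θ * x))
    linarith
  have hint : ∀ {h : ℝ → ℝ}, Monotone h → (∀ x < 0, h x = 0) → ∀ t,
      Integrable (fun x => h (t - x)) U := fun {h} hm h0 t =>
    integrable_comp_sub_of_bounded hU0 hUf hm.measurable h0 (c := h t) fun x hx => by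
      rw [abs_of_nonneg (nonneg_of_monotone_of_eq_zero hm h0 x)]
      exact hm hx
  refine ⟨K * (θ * ∫ x in Set.Ioi 0, Real.exp (-θ * x) * v x) +
    K * (θ * ∫ x in Set.Ioi 0, Real.exp (-θ * x) * g x), fun t ht => ?_⟩
  have e1 : ∫ x, f (t - x) ∂U = ∫ x, v (t - x) ∂U - ∫ x, g (t - x) ∂U := by
    rw [← integral_sub (hint hv hv0 t) (hint hvf hg0 t)]
    simp [hg]
  have hii : ∀ {h : ℝ → ℝ}, Monotone h →
      IntervalIntegrable (fun x => (h x : ℂ) * G (t - x)) volume 0 t := fun {h} hm => by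
    have h1 : IntervalIntegrable (fun x => (h x : ℂ)) volume 0 t := by
      have h2 : IntervalIntegrable h volume 0 t := hm.intervalIntegrable
      exact ⟨h2.1.ofReal, h2.2.ofReal⟩
    exact h1.mul_continuousOn (by fun_prop)
  have e2 : ∫ x in (0 : ℝ)..t, (f x : ℂ) * G (t - x) = (∫ x in (0 : ℝ)..t, (v x : ℂ) * G (t - x)) -
      ∫ x in (0 : ℝ)..t, (g x : ℂ) * G (t - x) := by
    rw [← intervalIntegral.integral_sub (hii hv) (hii hvf)]
    refine intervalIntegral.integral_congr fun x _ => ?_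
    simp only [hg, Complex.ofReal_sub]
    ring
  rw [e1, e2, Complex.ofReal_sub, sub_sub_sub_comm, add_mul]
  exact (norm_sub_le _ _).trans (add_le_add
    (norm_conv_monotone_sub_le hU0 hUf hθ hG hK hv hv0 hvi ht)
    (norm_conv_monotone_sub_le hU0 hUf hθ hG hK hvf hg0 hgi ht))

theorem integral_mul_expPoly {S : Finset ℂ} {n : ℂ → ℕ} {A : ℂ → ℕ → ℂ}
    {t : ℝ} (hf : IntervalIntegrable f volume 0 t) :
    ∫ x in (0 : ℝ)..t, (f x : ℂ) * expPoly S n A (t - x) =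
      ∑ l ∈ S, Complex.exp (l * t) * ∑ k ∈ Finset.range (n l), A l k / k.factorial *
        ∫ x in (0 : ℝ)..t, (f x : ℂ) * ((t : ℂ) - x) ^ k * Complex.exp (-l * x) := by
  have hfc : IntervalIntegrable (fun x => (f x : ℂ)) volume 0 t := ⟨hf.1.ofReal, hf.2.ofReal⟩
  have hi : ∀ l k, IntervalIntegrable (fun x : ℝ => Complex.exp (l * t) * (A l k / k.factorial *
      ((f x : ℂ) * ((t : ℂ) - x) ^ k * Complex.exp (-l * x)))) volume 0 t := fun l k => by
    refine IntervalIntegrable.const_mul (IntervalIntegrable.const_mul ?_ _) _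
    exact (hfc.mul_continuousOn (by fun_prop)).mul_continuousOn (by fun_prop)
  have he : ∀ x : ℝ, (f x : ℂ) * expPoly S n A (t - x) =
      ∑ l ∈ S, ∑ k ∈ Finset.range (n l), Complex.exp (l * t) * (A l k / k.factorial *
      ((f x : ℂ) * ((t : ℂ) - x) ^ k * Complex.exp (-l * x))) := fun x => by
    rw [expPoly, Finset.mul_sum]
    refine Finset.sum_congr rfl fun l _ => ?_
    rw [Finset.mul_sum]
    refine Finset.sum_congr rfl fun k _ => ?_
    have : Complex.exp (l * ((t - x : ℝ) : ℂ)) = Complex.exp (l * t) * Complex.exp (-l * x) := by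
      rw [← Complex.exp_add]
      push_cast
      ring_nf
    rw [this]
    push_cast
    ring
  simp only [he]
  rw [intervalIntegral.integral_finsetSum fun l _ => ?_]
  · refine Finset.sum_congr rfl fun l _ => ?_
    rw [intervalIntegral.integral_finsetSum fun k _ => hi l k, Finset.mul_sum]
    refine Finset.sum_congr rfl fun k _ => ?_
    rw [intervalIntegral.integral_const_mul, intervalIntegral.integral_const_mul]
  · have := IntervalIntegrable.sum (Finset.range (n l)) fun k _ => hi l k
    simpa only [Finset.sum_fn] using this

end Convolution

/-! ### The coefficients B and b. -/

section Coefficients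

variable {p : ℕ} {S : Finset ℂ} {n : ℂ → ℕ} {f : Fin p → ℝ → ℝ} {F : Fin p → ℝ → ℝ} {E : ℝ → ℝ}

/-- The coefficients of an expansion of a real function can be chosen symmetric with respect to
complex conjugation. -/
theorem exists_symmetric_coefficients (hS : ∀ l ∈ S, conj l ∈ S) (hn : ∀ l, n (conj l) = n l)
    (B₀ : ℂ → ℕ → Matrix (Fin p) (Fin p) ℂ)
    (h : ∀ i, (fun t : ℝ => (F i t : ℂ) - ∑ l ∈ S, Complex.exp (l * t) *
      ∑ k ∈ Finset.range (n l), (B₀ l k *ᵥ fun j => ∫ x in (0 : ℝ)..t,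
        (f j x : ℂ) * ((t : ℂ) - x) ^ k * Complex.exp (-l * x)) i) =O[atTop] E) :
    ∃ B : ℂ → ℕ → Matrix (Fin p) (Fin p) ℂ, (∀ l k i j, B (conj l) k i j = conj (B l k i j)) ∧
      ∀ i, (fun t : ℝ => (F i t : ℂ) - ∑ l ∈ S, Complex.exp (l * t) *
        ∑ k ∈ Finset.range (n l), (B l k *ᵥ fun j => ∫ x in (0 : ℝ)..t,
          (f j x : ℂ) * ((t : ℂ) - x) ^ k * Complex.exp (-l * x)) i) =O[atTop] E := by
  refine ⟨fun l k => Matrix.of fun i j => (B₀ l k i j + conj (B₀ (conj l) k i j)) / 2,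
    fun l k i j => ?_, fun i => ?_⟩
  · simp only [Matrix.of_apply, Complex.conj_conj, map_div₀, map_add, map_ofNat]
    ring
  have hI : ∀ (l : ℂ) (k : ℕ) (t : ℝ) (j : Fin p), conj (∫ x in (0 : ℝ)..t,
      (f j x : ℂ) * ((t : ℂ) - x) ^ k * Complex.exp (-l * x)) = ∫ x in (0 : ℝ)..t,
      (f j x : ℂ) * ((t : ℂ) - x) ^ k * Complex.exp (-(conj l) * x) := fun l k t j => by
    simp only [intervalIntegral, map_sub, ← integral_conj, map_mul, map_pow, map_neg,
      Complex.conj_ofReal, ← Complex.exp_conj]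
  -- As `F` and `f` are real, the conjugated expansion holds with the same error, and the average of
  -- the two has symmetric coefficients.
  have h2 : (fun t : ℝ => conj ((F i t : ℂ) - ∑ l ∈ S, Complex.exp (l * t) *
      ∑ k ∈ Finset.range (n l), (B₀ l k *ᵥ fun j => ∫ x in (0 : ℝ)..t,
        (f j x : ℂ) * ((t : ℂ) - x) ^ k * Complex.exp (-l * x)) i)) =O[atTop] E := by
    refine ((h i).norm_left.congr_left fun t => ?_).of_norm_left
    exact (RCLike.norm_conj _).symm
  refine (((h i).add h2).const_mul_left (1 / 2)).congr_left fun t => ?_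
  have h3 : conj (∑ l ∈ S, Complex.exp (l * t) *
      ∑ k ∈ Finset.range (n l), (B₀ l k *ᵥ fun j => ∫ x in (0 : ℝ)..t,
        (f j x : ℂ) * ((t : ℂ) - x) ^ k * Complex.exp (-l * x)) i) =
      ∑ l ∈ S, Complex.exp (l * t) * ∑ k ∈ Finset.range (n l), ∑ j, conj (B₀ (conj l) k i j) *
        ∫ x in (0 : ℝ)..t, (f j x : ℂ) * ((t : ℂ) - x) ^ k * Complex.exp (-l * x) := by
    rw [map_sum]
    refine Finset.sum_nbij' (fun l => conj l) (fun l => conj l) hS hS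
      (fun l _ => Complex.conj_conj l) (fun l _ => Complex.conj_conj l) fun l _ => ?_
    simp only [hn, map_mul, map_sum, Complex.conj_conj, ← Complex.exp_conj, Complex.conj_ofReal,
      Matrix.mulVec, dotProduct, hI]
  rw [map_sub, h3, Complex.conj_ofReal]
  simp only [Matrix.mulVec, dotProduct, Matrix.of_apply, Finset.mul_sum]
  have h4 : ∀ a b c d : ℂ, a = d → 1 / 2 * (a - b + (d - c)) = a - (b + c) / 2 := by
    rintro a b c d rfl
    ring
  rw [h4 _ _ _ _ rfl, ← Finset.sum_add_distrib, Finset.sum_div]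
  congr 1
  refine Finset.sum_congr rfl fun l _ => ?_
  rw [← Finset.sum_add_distrib, Finset.sum_div]
  refine Finset.sum_congr rfl fun k _ => ?_
  rw [← Finset.sum_add_distrib, Finset.sum_div]
  refine Finset.sum_congr rfl fun j _ => ?_
  ring

/-- The coefficients of the expansion in exponential polynomials, in terms of moments. -/
noncomputable def momentCoeff (n : ℂ → ℕ) (f : Fin p → ℝ → ℝ) (B : ℂ → ℕ → Matrix (Fin p) (Fin p) ℂ)
    (l : ℂ) (m : ℕ) (i : Fin p) : ℂ :=
  ∑ k ∈ Finset.range (n l), ∑ j, B l k i j * (k.choose m *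
    ∫ x in Set.Ioi (0 : ℝ), (f j x : ℂ) * (-(x : ℂ)) ^ (k - m) * Complex.exp (-l * x))

theorem momentCoeff_conj (hn : ∀ l, n (conj l) = n l) {B : ℂ → ℕ → Matrix (Fin p) (Fin p) ℂ}
    (hB : ∀ l k i j, B (conj l) k i j = conj (B l k i j)) (l : ℂ) (m : ℕ) (i : Fin p) :
    momentCoeff n f B (conj l) m i = conj (momentCoeff n f B l m i) := by
  simp only [momentCoeff, hn, map_sum, map_mul, hB, map_natCast, ← integral_conj, map_pow, map_neg,
    Complex.conj_ofReal, ← Complex.exp_conj]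

/-- All exponents lie to the right of `θ`, so the moments are finite and each completed integral
costs only `O(e^{θt})`. -/
theorem isBigO_sub_momentCoeff {θ : ℝ} {v : Fin p → ℝ → ℝ} (hf : ∀ j, Measurable (f j))
    (hfv : ∀ j x, |f j x| ≤ v j x)
    (hv : ∀ j, IntegrableOn (fun x => Real.exp (-θ * x) * v j x) (Set.Ioi 0))
    (hS : ∀ l ∈ S, θ < l.re) (B : ℂ → ℕ → Matrix (Fin p) (Fin p) ℂ) {i : Fin p}
    (h : (fun t : ℝ => (F i t : ℂ) - ∑ l ∈ S, Complex.exp (l * t) *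
      ∑ k ∈ Finset.range (n l), (B l k *ᵥ fun j => ∫ x in (0 : ℝ)..t,
        (f j x : ℂ) * ((t : ℂ) - x) ^ k * Complex.exp (-l * x)) i)
      =O[atTop] fun t : ℝ => Real.exp (θ * t)) :
    (fun t : ℝ => (F i t : ℂ) - ∑ l ∈ S, Complex.exp (l * t) *
      ∑ m ∈ Finset.range (n l), (t : ℂ) ^ m * momentCoeff n f B l m i)
      =O[atTop] fun t : ℝ => Real.exp (θ * t) := by
  have h1 : (fun t : ℝ => ∑ l ∈ S, ∑ k ∈ Finset.range (n l), ∑ j, B l k i j *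
      (Complex.exp (l * t) *
      ((∫ x in (0 : ℝ)..t, (f j x : ℂ) * ((t : ℂ) - x) ^ k * Complex.exp (-l * x)) -
        ∑ m ∈ Finset.range (k + 1), (t : ℂ) ^ m * (k.choose m *
          ∫ x in Set.Ioi (0 : ℝ), (f j x : ℂ) * (-(x : ℂ)) ^ (k - m) * Complex.exp (-l * x)))))
      =O[atTop] fun t : ℝ => Real.exp (θ * t) := by
    have hterm : ∀ l ∈ S, ∀ k j, (fun t : ℝ => Complex.exp (l * t) *
        ((∫ x in (0 : ℝ)..t, (f j x : ℂ) * ((t : ℂ) - x) ^ k * Complex.exp (-l * x)) -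
          ∑ m ∈ Finset.range (k + 1), (t : ℂ) ^ m * (k.choose m *
            ∫ x in Set.Ioi (0 : ℝ), (f j x : ℂ) * (-(x : ℂ)) ^ (k - m) * Complex.exp (-l * x))))
        =O[atTop] fun t : ℝ => Real.exp (θ * t) := fun l hl k j => by
      obtain ⟨C, -, hC⟩ := exists_moment_estimate (hf j) (hfv j) (hv j) (hS l hl) k
      refine IsBigO.of_bound C ?_
      filter_upwards [eventually_ge_atTop 0] with t ht
      rw [Real.norm_of_nonneg (Real.exp_nonneg _)]
      exact hC t ht
    exact IsBigO.fun_sum fun l hl => IsBigO.fun_sum fun k _ => IsBigO.fun_sum fun j _ =>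
      (hterm l hl k j).const_mul_left (B l k i j)
  refine (h.add h1).congr_left fun t => ?_
  have h2 : ∀ a b c d : ℂ, b = c + d → a - c = a - b + d := by
    rintro a b c d rfl
    ring
  refine (h2 _ _ _ _ ?_).symm
  rw [← Finset.sum_add_distrib]
  refine Finset.sum_congr rfl fun l _ => ?_
  have h3 : ∑ m ∈ Finset.range (n l), (t : ℂ) ^ m * momentCoeff n f B l m i =
      ∑ k ∈ Finset.range (n l), ∑ j, B l k i j * ∑ m ∈ Finset.range (k + 1), (t : ℂ) ^ m *
        (k.choose m *
          ∫ x in Set.Ioi (0 : ℝ), (f j x : ℂ) * (-(x : ℂ)) ^ (k - m) * Complex.exp (-l * x)) := by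
    simp only [momentCoeff, Finset.mul_sum]
    rw [Finset.sum_comm]
    refine Finset.sum_congr rfl fun k hk => ?_
    rw [Finset.sum_comm]
    refine Finset.sum_congr rfl fun j _ => ?_
    symm
    -- The expansion stops at `m = k`, whereas the coefficients run over all `m` below the pole
    -- order; the surplus binomial coefficients vanish.
    refine (Finset.sum_subset (Finset.range_subset_range.2 (Finset.mem_range.1 hk))
      fun m _ hm => ?_).trans (Finset.sum_congr rfl fun m _ => by ring)
    rw [Nat.choose_eq_zero_of_lt (by simpa using hm)]
    simp
  rw [h3, Finset.mul_sum, Finset.mul_sum, ← Finset.sum_add_distrib]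
  refine Finset.sum_congr rfl fun k _ => ?_
  simp only [Matrix.mulVec, dotProduct]
  rw [Finset.mul_sum, Finset.mul_sum, ← Finset.sum_add_distrib]
  refine Finset.sum_congr rfl fun j _ => ?_
  ring

end Coefficients

namespace Model

variable {p : ℕ} {Ω : Type*} [MeasurableSpace Ω] {P : Measure Ω} (M : Model p P)

theorem intensity_Iio (i j : Fin p) : M.intensity i j (Set.Iio 0) = 0 := by
  rw [M.intensity_apply i j measurableSet_Iio]
  refine (lintegral_congr fun ω => ?_).trans lintegral_zero
  rw [birthMeasure, Measure.sum_apply _ measurableSet_Iio]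
  refine ENNReal.tsum_eq_zero.2 fun k => ?_
  split_ifs
  · rw [Measure.dirac_apply' _ measurableSet_Iio]
    simp
  · simp

end Model

/-! ### Assembling the renewal expansion and the theorem. -/

section Renewal

variable {p : ℕ} {μ : Fin p → Fin p → Measure ℝ} {ϑ θ s : ℝ}

/-- The renewal equation: expansion of the convolution of a function of controlled variation with
the renewal measure. -/
theorem exists_renewal_expansion [∀ i j, SFinite (μ i j)] (hsupp : ∀ i j, μ i j (Set.Iio 0) = 0)
    (hϑ : (ϑ : ℂ) ∈ laplaceDomain μ) (hfin : (rootsAbove μ ϑ).Finite) (hϑθ : ϑ < θ) (hθ : 0 < θ)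
    (hθs : θ < s) (hsum : Summable fun n => laplace μ (s : ℂ) ^ n)
    {f v : Fin p → ℝ → ℝ} (hv : ∀ j, Monotone (v j)) (hv0 : ∀ j, ∀ x < 0, v j x = 0)
    (hfv : ∀ j x, |f j x| ≤ v j x) (hvf : ∀ j, Monotone fun x => v j x - f j x)
    (hvi : ∀ j, IntegrableOn (fun x => Real.exp (-θ * x) * v j x) (Set.Ioi 0)) :
    ∃ B : ℂ → ℕ → Matrix (Fin p) (Fin p) ℂ, ∀ i,
      (fun t : ℝ => ((∑ j, ∫ x, f j (t - x) ∂(renewal μ i j) : ℝ) : ℂ) -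
        ∑ l ∈ hfin.toFinset, Complex.exp (l * t) *
          ∑ k ∈ Finset.range (poleOrder μ l), (B l k *ᵥ fun j => ∫ x in (0 : ℝ)..t,
            (f j x : ℂ) * ((t : ℂ) - x) ^ k * Complex.exp (-l * x)) i)
        =O[atTop] fun t : ℝ => Real.exp (θ * t) := by
  have hsD : (s : ℂ) ∈ laplaceDomain μ :=
    mem_laplaceDomain_of_le hsupp hϑ (by simpa using (hϑθ.trans hθs).le)
  have hlap := fun {z : ℂ} (hz : s ≤ z.re) => laplace_renewal hsupp hsD hsum hz
  have hU0 := renewal_Iio hsupp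
  have hUe := lintegral_exp_renewal_lt_top hsD hsum
  have hUf : ∀ i j t, renewal μ i j (Set.Iic t) < ∞ := fun i j =>
    measure_Iic_lt_top_of_lintegral_exp (hθ.trans hθs).le (hUe i j)
  -- The line must lie to the right of `0` for the inversion and of `ϑ` for the bound on the
  -- remainder, and to the left of `θ` to pay for the difference quotients.
  obtain ⟨σ, hσ1, hσ2⟩ := exists_between (max_lt hϑθ hθ)
  have hϑσ : ϑ < σ := (le_max_left _ _).trans_lt hσ1
  have hσ0 : 0 < σ := (le_max_right _ _).trans_lt hσ1
  have hσs : σ ≤ s := (hσ2.trans hθs).le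
  choose A R hR hRC hdec using fun i j =>
    exists_resolvent_decomposition hsupp hϑ hfin hϑσ hσs hsum i j
  have hS : ∀ l ∈ hfin.toFinset, l.re < s := fun l hl => by
    by_contra h
    exact (hlap (not_lt.1 h)).2.1 (hfin.mem_toFinset.1 hl).1.2
  have hest : ∀ i j, (fun t : ℝ => ((∫ x, f j (t - x) ∂(renewal μ i j) : ℝ) : ℂ) -
      ∫ x in (0 : ℝ)..t, (f j x : ℂ) * expPoly hfin.toFinset (poleOrder μ) (A i j) (t - x))
      =O[atTop] fun t : ℝ => Real.exp (θ * t) := fun i j => by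
    have := sigmaFinite_of_lintegral_exp (hUe i j)
    obtain ⟨C, hC⟩ := hRC i j
    obtain ⟨K, -, hK⟩ := exists_distribution_estimate hσ0 hσs hϑσ hσ2 (hU0 i j)
      ((hlap (z := (s : ℂ)) (by simp)).1 i j) hS (hR i j) hC fun z hz => by
        rw [(hlap hz.ge).2.2 i j, hdec i j z fun hz' => ?_]
        exact (hlap hz.ge).2.1 hz'.1.2
    obtain ⟨C', hC'⟩ := exists_conv_estimate (hU0 i j) (hUf i j) hθ continuous_expPoly hK (hv j)
      (hv0 j) (hfv j) (hvf j) (hvi j)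
    refine IsBigO.of_bound C' ?_
    filter_upwards [eventually_ge_atTop 0] with t ht
    rw [Real.norm_of_nonneg (Real.exp_nonneg _)]
    exact hC' t ht
  refine ⟨fun l k => Matrix.of fun i j => A i j l k / k.factorial, fun i => ?_⟩
  have h1 : (fun t : ℝ => ∑ j, (((∫ x, f j (t - x) ∂(renewal μ i j) : ℝ) : ℂ) -
      ∫ x in (0 : ℝ)..t, (f j x : ℂ) *
        expPoly hfin.toFinset (poleOrder μ) (A i j) (t - x))) =O[atTop]
      fun t : ℝ => Real.exp (θ * t) := IsBigO.fun_sum fun j _ => hest i j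
  refine h1.congr_left fun t => ?_
  rw [Finset.sum_sub_distrib, Complex.ofReal_sum]
  congr 1
  have hfi : ∀ j, IntervalIntegrable (f j) volume 0 t := fun j => by
    have h2 := ((hv j).intervalIntegrable (μ := volume) (a := 0) (b := t)).sub
      ((hvf j).intervalIntegrable (μ := volume) (a := 0) (b := t))
    simpa using h2
  simp only [integral_mul_expPoly (hfi _), Matrix.mulVec, dotProduct, Matrix.of_apply]
  rw [Finset.sum_comm]
  refine Finset.sum_congr rfl fun l _ => ?_
  rw [← Finset.mul_sum, Finset.sum_comm]

end Renewal

end CMJ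

theorem mainTheorem9 {p : ℕ} {Ω : Type*} [MeasurableSpace Ω] {P : Measure Ω}
    [IsProbabilityMeasure P] (M : CMJ.Model p P) (ϑ θ : ℝ)
    (hA1 : (ϑ : ℂ) ∈ interior (CMJ.laplaceDomain M.intensity))
    (hA2 : spectralRadius ℂ (CMJ.massAtZero M.intensity) < 1)
    (hline : CMJ.BoundedInverseOnLine M.intensity ϑ)
    (hfin : (CMJ.rootsAbove M.intensity ϑ).Finite)
    (hexists : ∀ i, ∀ t, 0 ≤ t → M.MeanExists i t)
    (hint : ∀ i t, Integrable (fun ω => M.char [] ω t i) P)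
    (hneg : ∀ i, ∀ t, t < 0 → M.charMean i t = 0)
    (hcadlag : ∀ i, CMJ.IsCadlag (M.charMean i))
    (hθ : ϑ < θ)
    (hroots : CMJ.rootsAbove M.intensity ϑ = CMJ.rootsAbove M.intensity θ)
    (hvar : ∀ i, ∫⁻ x in Set.Ioi (0 : ℝ),
      ENNReal.ofReal (Real.exp (-θ * x)) * eVariationOn (M.charMean i) (Set.Iic x) < ∞) :
    (∀ i, ∀ t, 0 ≤ t →
      (∀ᵐ ω ∂P, Summable fun u => M.score i t u ω) ∧ Integrable (M.count i t) P) ∧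
    ∃ (B : ℂ → ℕ → Matrix (Fin p) (Fin p) ℂ) (b : ℂ → ℕ → Fin p → ℂ),
      (∀ l ∈ CMJ.rootsAbove M.intensity ϑ, ∀ k < CMJ.poleOrder M.intensity l, ∀ i,
        (∀ j, B (conj l) k i j = conj (B l k i j)) ∧ b (conj l) k i = conj (b l k i)) ∧
      (∀ i, (fun t : ℝ => (M.mean i t : ℂ) -
          ∑ l ∈ hfin.toFinset, Complex.exp (l * t) *
            ∑ k ∈ Finset.range (CMJ.poleOrder M.intensity l),
              (B l k *ᵥ fun j => ∫ x in (0 : ℝ)..t,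
                (M.charMean j x : ℂ) * ((t : ℂ) - x) ^ k * Complex.exp (-l * x)) i)
        =O[atTop] fun t : ℝ => Real.exp (θ * t)) ∧
      (∀ ε : ℝ, 0 < ε → ∀ i, (fun t : ℝ => (M.mean i t : ℂ) -
          ∑ l ∈ hfin.toFinset, Complex.exp (l * t) *
            ∑ k ∈ Finset.range (CMJ.poleOrder M.intensity l), (t : ℂ) ^ k * b l k i)
        =O[atTop] fun t : ℝ => Real.exp ((θ + ε) * t)) := by
  have hϑ := interior_subset hA1
  have hsupp := M.intensity_Iio
  have hsf : ∀ i j, SFinite (M.intensity i j) := fun i j => by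
    have := CMJ.sigmaFinite_of_lintegral_exp (hϑ i j)
    infer_instance
  -- A positive `s` makes the renewal measure finite on every `Iic t`.
  obtain ⟨s, hs, hsum⟩ := CMJ.exists_summable_laplace_pow hsupp hϑ hA2 (max θ 0)
  have hθs : θ < s := (le_max_left _ _).trans_lt hs
  have hs0 : 0 < s := (le_max_right _ _).trans_lt hs
  have hsD : (s : ℂ) ∈ CMJ.laplaceDomain M.intensity :=
    CMJ.mem_laplaceDomain_of_le hsupp hϑ (by simpa using (hθ.trans hθs).le)
  choose v hv hv0 hfv hvf hvi using fun j => CMJ.exists_monotone_majorant (hneg j) (hvar j)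
  have hf := fun j => CMJ.measurable_of_monotone_sub (hv j) (hvf j)
  -- The function `f_j(t - ·)` is bounded by `v j t` on the nonnegative half-line and vanishes
  -- beyond `t`, so its renewal integral converges absolutely.
  have hmean := fun i t ht => M.mean_eq_renewal i t (fun j => hint j) (hexists i t ht) fun j =>
    (CMJ.integrable_comp_sub_of_bounded (CMJ.renewal_Iio hsupp i j)
      (CMJ.measure_Iic_lt_top_of_lintegral_exp hs0.le
        (CMJ.lintegral_exp_renewal_lt_top hsD hsum i j)) (hf j) (hneg j) (c := v j t)
      fun x hx => (hfv j x).trans (hv j hx)).2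
  refine ⟨fun i t ht => ⟨(hmean i t ht).1, (hmean i t ht).2.1⟩, ?_⟩
  suffices h : ∃ B₀ : ℂ → ℕ → Matrix (Fin p) (Fin p) ℂ, ∀ i, (fun t : ℝ => (M.mean i t : ℂ) -
          ∑ l ∈ hfin.toFinset, Complex.exp (l * t) *
            ∑ k ∈ Finset.range (CMJ.poleOrder M.intensity l),
              (B₀ l k *ᵥ fun j => ∫ x in (0 : ℝ)..t,
                (M.charMean j x : ℂ) * ((t : ℂ) - x) ^ k * Complex.exp (-l * x)) i)
        =O[atTop] fun t : ℝ => Real.exp (θ * t) by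
    obtain ⟨B₀, hB₀⟩ := h
    obtain ⟨B, hB, hBO⟩ := CMJ.exists_symmetric_coefficients
      (fun l hl => hfin.mem_toFinset.2 (CMJ.conj_mem_rootsAbove (hfin.mem_toFinset.1 hl)))
      CMJ.poleOrder_conj B₀ hB₀
    refine ⟨B, CMJ.momentCoeff (CMJ.poleOrder M.intensity) M.charMean B, fun l _ k _ i =>
      ⟨hB l k i, CMJ.momentCoeff_conj CMJ.poleOrder_conj hB l k i⟩, hBO, fun ε hε i => ?_⟩
    refine (CMJ.isBigO_sub_momentCoeff hf hfv hvi (fun l hl => ?_) B (hBO i)).trans ?_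
    · have := hfin.mem_toFinset.1 hl
      -- This places every root to the right of `θ`, where the moments converge.
      rw [hroots] at this
      exact this.2
    · refine IsBigO.of_bound 1 ?_
      filter_upwards [eventually_ge_atTop 0] with t ht
      rw [Real.norm_of_nonneg (Real.exp_nonneg _), Real.norm_of_nonneg (Real.exp_nonneg _), one_mul]
      exact Real.exp_le_exp.2 (by nlinarith)
  -- For `θ ≤ 0` no line with `0 < σ < θ` exists, but then the mean characteristic vanishes
  -- identically and zero coefficients suffice.
  rcases le_or_gt θ 0 with h0 | h0
  · have hz : ∀ j x, M.charMean j x = 0 := fun j =>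
      CMJ.eq_zero_of_variation_of_nonpos (hneg j) h0 (hvar j)
    refine ⟨0, fun i => IsBigO.of_bound 0 ?_⟩
    filter_upwards [eventually_ge_atTop 0] with t ht
    simp [(hmean i t ht).2.2, hz]
  · obtain ⟨B, hB⟩ := CMJ.exists_renewal_expansion hsupp hϑ hfin hθ h0 hθs hsum hv hv0 hfv hvf hvi
    refine ⟨B, fun i => (hB i).congr' ?_ EventuallyEq.rfl⟩
    filter_upwards [eventually_ge_atTop 0] with t ht
    rw [(hmean i t ht).2.2]
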